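/- Work in constructive Zermelo--Fraenkel set theory $\mathbf{CZF}$: intuitionistic first-order logic with equality, in the language with the binary relation symbol $\in$, with the axioms Extensionality, Pairing, Union and Infinity and the axiom schemata Set Induction, Bounded ($\Delta_0$-)Separation, Strong Collection and Subset Collection. A \emph{rule} on a set $X$ is a pair $(a,b)$ of subsets of $X$. A subset $Y\subseteq X$ is closed under $(a,b)$ if $a\subseteq Y$ implies that $b\cap Y$ is inhabited; for a set $\mathcal R$ of rules on $X$, the subset $Y$ is $\mathcal R$-closed if it is closed under every rule in $\mathcal R$. The \emph{NID principle} says: for every set $X$ and every set $\mathcal R$ of rules on $X$, the class of $\mathcal R$-closed subsets of $X$ is set-generated, i.e. there is a set $G$ of $\mathcal R$-closed subsets of $X$ such that for every $\mathcal R$-closed $\alpha\subseteq X$ and every $x\in\alpha$ there is $\beta\in G$ with $x\in\beta\subseteq\alpha$. For a function $f:B\to A$ between sets, let $P_f$ be the functor on sets given by $P_f(X)=\{(a,t) : a\in A,\ t:f^{-1}(a)\to X\}$ and $P_f(\alpha)(a,t)=(a,\alpha\circ t)$. A $P_f$-algebra is a set $X$ with a function $s:P_f(X)\to X$; a morphism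 $(X,s)\to(Y,t)$ is a function $\alpha:X\to Y$ with $\alpha\circ s=t\circ P_f(\alpha)$. The \emph{W-type} associated to $f$ is the initial $P_f$-algebra, if it exists. \textbf{Theorem.} $\mathbf{CZF}$ proves: the NID principle implies that all W-types exist, i.e. that for all sets $A$, $B$ and every function $f:B\to A$ there is an initial $P_f$-algebra. -/

import Mathlib

namespace CST

/-- Formulas of the first-order language of set theory (membership and equality, no function
symbols), in de Bruijn form: the only terms are variables `k : ℕ`, and under a quantifier the
variable `0` is the bound one while an outer variable `k` is written `k + 1`. As the logic below is
intuitionistic, all connectives are primitive. -/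
inductive Fml : Type
  | mem : ℕ → ℕ → Fml
  | eq : ℕ → ℕ → Fml
  | bot : Fml
  | imp : Fml → Fml → Fml
  | and : Fml → Fml → Fml
  | or : Fml → Fml → Fml
  | all : Fml → Fml
  | ex : Fml → Fml

namespace Fml

/-- Logical equivalence of two formulas. -/
def iff (φ ψ : Fml) : Fml := and (imp φ ψ) (imp ψ φ)

/-- The bounded quantifier `∀ x ∈ y, φ`; inside `φ` the variable `x` is `0`. -/
def ball (y : ℕ) (φ : Fml) : Fml := all (imp (mem 0 (y + 1)) φ)

/-- The bounded quantifier `∃ x ∈ y, φ`; inside `φ` the variable `x` is `0`. -/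
def bex (y : ℕ) (φ : Fml) : Fml := ex (and (mem 0 (y + 1)) φ)

/-- Lift a renaming of variables under a quantifier. -/
def up (ρ : ℕ → ℕ) : ℕ → ℕ
  | 0 => 0
  | k + 1 => ρ k + 1

/-- Rename the free variables of a formula (capture avoiding). -/
def ren : (ℕ → ℕ) → Fml → Fml
  | ρ, mem x y => mem (ρ x) (ρ y)
  | ρ, eq x y => eq (ρ x) (ρ y)
  | _, bot => bot
  | ρ, imp φ ψ => imp (ren ρ φ) (ren ρ ψ)
  | ρ, and φ ψ => and (ren ρ φ) (ren ρ ψ)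
  | ρ, or φ ψ => or (ren ρ φ) (ren ρ ψ)
  | ρ, all φ => all (ren (up ρ) φ)
  | ρ, ex φ => ex (ren (up ρ) φ)

/-- The renaming that sends the first variables `0, 1, …` to the entries of the list `l`, and the
`k`-th variable after these to `k + d`. -/
def env : List ℕ → ℕ → ℕ → ℕ
  | [], d, k => k + d
  | t :: _, _, 0 => t
  | _ :: l, d, k + 1 => env l d k

/-- `φ.inst l d` is `φ` with its first variables instantiated by `l`, and with its remaining
variables (the parameters) read under `d` new quantifiers. In particular `φ.inst [] 1` is the
weakening of `φ`, and `φ.inst [t] 0` is `φ` with the variable `t` substituted for `0`. -/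
def inst (φ : Fml) (l : List ℕ) (d : ℕ) : Fml := ren (env l d) φ

/-- Bounded formulas: all quantifiers occur in the form `∀ x ∈ y` or `∃ x ∈ y`. -/
inductive IsBounded : Fml → Prop
  | mem (x y : ℕ) : IsBounded (mem x y)
  | eq (x y : ℕ) : IsBounded (eq x y)
  | bot : IsBounded bot
  | imp {φ ψ : Fml} : IsBounded φ → IsBounded ψ → IsBounded (imp φ ψ)
  | and {φ ψ : Fml} : IsBounded φ → IsBounded ψ → IsBounded (and φ ψ)
  | or {φ ψ : Fml} : IsBounded φ → IsBounded ψ → IsBounded (or φ ψ)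
  | ball (y : ℕ) {φ : Fml} : IsBounded φ → IsBounded (ball y φ)
  | bex (y : ℕ) {φ : Fml} : IsBounded φ → IsBounded (bex y φ)

end Fml

infix:60 "∈ₛ" => Fml.mem
infix:60 "=ₛ" => Fml.eq
infixr:35 "∧ₛ" => Fml.and
infixr:30 "∨ₛ" => Fml.or
infixr:25 "→ₛ" => Fml.imp
infix:20 "↔ₛ" => Fml.iff
prefix:40 "∀ₛ" => Fml.all
prefix:40 "∃ₛ" => Fml.ex

open Fml

/-- Derivability in intuitionistic first-order logic with equality, as natural deduction:
`Prv T Γ φ` says that `φ` has a derivation from the open assumptions `Γ` and the theory `T`. The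
free variables of the members of `T` are parameters, read as universally quantified. -/
inductive Prv (T : Set Fml) : List Fml → Fml → Prop
  | ax {Γ : List Fml} {φ : Fml} : φ ∈ T → Prv T Γ φ
  | hyp {Γ : List Fml} {φ : Fml} : φ ∈ Γ → Prv T Γ φ
  | botE {Γ : List Fml} {φ : Fml} : Prv T Γ bot → Prv T Γ φ
  | impI {Γ : List Fml} {φ ψ : Fml} : Prv T (φ :: Γ) ψ → Prv T Γ (φ →ₛ ψ)
  | impE {Γ : List Fml} {φ ψ : Fml} : Prv T Γ (φ →ₛ ψ) → Prv T Γ φ → Prv T Γ ψ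
  | andI {Γ : List Fml} {φ ψ : Fml} : Prv T Γ φ → Prv T Γ ψ → Prv T Γ (φ ∧ₛ ψ)
  | andE₁ {Γ : List Fml} {φ ψ : Fml} : Prv T Γ (φ ∧ₛ ψ) → Prv T Γ φ
  | andE₂ {Γ : List Fml} {φ ψ : Fml} : Prv T Γ (φ ∧ₛ ψ) → Prv T Γ ψ
  | orI₁ {Γ : List Fml} {φ ψ : Fml} : Prv T Γ φ → Prv T Γ (φ ∨ₛ ψ)
  | orI₂ {Γ : List Fml} {φ ψ : Fml} : Prv T Γ ψ → Prv T Γ (φ ∨ₛ ψ)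
  | orE {Γ : List Fml} {φ ψ χ : Fml} :
      Prv T Γ (φ ∨ₛ ψ) → Prv T (φ :: Γ) χ → Prv T (ψ :: Γ) χ → Prv T Γ χ
  | allI {Γ : List Fml} {φ : Fml} :
      Prv T (Γ.map fun ψ => ψ.inst [] 1) φ → Prv T Γ (∀ₛ φ)
  | allE {Γ : List Fml} {φ : Fml} (t : ℕ) : Prv T Γ (∀ₛ φ) → Prv T Γ (φ.inst [t] 0)
  | exI {Γ : List Fml} {φ : Fml} (t : ℕ) : Prv T Γ (φ.inst [t] 0) → Prv T Γ (∃ₛ φ)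
  | exE {Γ : List Fml} {φ ψ : Fml} :
      Prv T Γ (∃ₛ φ) → Prv T (φ :: Γ.map fun χ => χ.inst [] 1) (ψ.inst [] 1) → Prv T Γ ψ
  | eqI {Γ : List Fml} (t : ℕ) : Prv T Γ (t =ₛ t)
  | eqE {Γ : List Fml} {s t : ℕ} (φ : Fml) :
      Prv T Γ (s =ₛ t) → Prv T Γ (φ.inst [s] 0) → Prv T Γ (φ.inst [t] 0)

/-- `u = ∅`. -/
def isEmpty (u : ℕ) : Fml := ball u bot

/-- `u = v ∪ {v}`. -/
def isSucc (u v : ℕ) : Fml := ∀ₛ (0 ∈ₛ u + 1 ↔ₛ 0 ∈ₛ v + 1 ∨ₛ 0 =ₛ v + 1)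

/-- The axioms of Constructive Zermelo–Fraenkel set theory; in the schemata `φ` is an arbitrary
formula, which may contain parameters. The comments name the variables `0, 1, …` in scope. -/
inductive IsCZF : Fml → Prop
  /-- `∀ a b, (∀ x, x ∈ a ↔ x ∈ b) → a = b`. -/
  | extensionality : IsCZF (∀ₛ ∀ₛ (∀ₛ (0 ∈ₛ 2 ↔ₛ 0 ∈ₛ 1) →ₛ 1 =ₛ 0))
  /-- `∀ a b, ∃ c, ∀ x, x ∈ c ↔ x = a ∨ x = b`. -/
  | pairing : IsCZF (∀ₛ ∀ₛ ∃ₛ ∀ₛ (0 ∈ₛ 1 ↔ₛ 0 =ₛ 3 ∨ₛ 0 =ₛ 2))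
  /-- `∀ a, ∃ c, ∀ x, x ∈ c ↔ ∃ z ∈ a, x ∈ z`. -/
  | union : IsCZF (∀ₛ ∃ₛ ∀ₛ (0 ∈ₛ 1 ↔ₛ bex 2 (1 ∈ₛ 0)))
  /-- `∃ w, ∀ u, u ∈ w ↔ u = ∅ ∨ ∃ v ∈ w, u = v ∪ {v}`. -/
  | infinity : IsCZF (∃ₛ ∀ₛ (0 ∈ₛ 1 ↔ₛ isEmpty 0 ∨ₛ bex 1 (isSucc 1 0)))
  /-- `(∀ a, (∀ x ∈ a, φ x) → φ a) → ∀ a, φ a`. -/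
  | setInduction (φ : Fml) :
      IsCZF (∀ₛ (ball 0 (φ.inst [0] 2) →ₛ φ.inst [0] 1) →ₛ ∀ₛ (φ.inst [0] 1))
  /-- `∀ a, ∃ b, ∀ x, x ∈ b ↔ x ∈ a ∧ φ x`, for bounded `φ`. -/
  | boundedSeparation (φ : Fml) : φ.IsBounded →
      IsCZF (∀ₛ ∃ₛ ∀ₛ (0 ∈ₛ 1 ↔ₛ 0 ∈ₛ 2 ∧ₛ φ.inst [0] 3))
  /-- `∀ a, (∀ x ∈ a, ∃ y, φ x y) →
  ∃ b, (∀ x ∈ a, ∃ y ∈ b, φ x y) ∧ (∀ y ∈ b, ∃ x ∈ a, φ x y)`. -/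
  | strongCollection (φ : Fml) :
      IsCZF (∀ₛ (ball 0 (∃ₛ (φ.inst [1, 0] 3)) →ₛ
        ∃ₛ (ball 1 (bex 1 (φ.inst [1, 0] 4)) ∧ₛ ball 0 (bex 2 (φ.inst [0, 1] 4)))))
  /-- `∀ a b, ∃ c, ∀ u, (∀ x ∈ a, ∃ y ∈ b, φ x y u) →
  ∃ d ∈ c, (∀ x ∈ a, ∃ y ∈ d, φ x y u) ∧ (∀ y ∈ d, ∃ x ∈ a, φ x y u)`. -/
  | subsetCollection (φ : Fml) :
      IsCZF (∀ₛ ∀ₛ ∃ₛ ∀ₛ (ball 3 (bex 3 (φ.inst [1, 0, 2] 6)) →ₛ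
        bex 1 (ball 4 (bex 1 (φ.inst [1, 0, 3] 7)) ∧ₛ ball 0 (bex 5 (φ.inst [0, 1, 3] 7)))))

/-- Constructive Zermelo–Fraenkel set theory. -/
def CZF : Set Fml := {φ | IsCZF φ}

/-! ### Pairs, relations and functions -/

/-- `x ⊆ y`. -/
def isSub (x y : ℕ) : Fml := ball x (0 ∈ₛ y + 1)

/-- `z = {a, b}`. -/
def isUpair (z a b : ℕ) : Fml := ∀ₛ (0 ∈ₛ z + 1 ↔ₛ 0 =ₛ a + 1 ∨ₛ 0 =ₛ b + 1)

/-- `p` is the ordered pair `(a, b) = {{a}, {a, b}}`. -/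
def isPair (p a b : ℕ) : Fml :=
  ∀ₛ (0 ∈ₛ p + 1 ↔ₛ isUpair 0 (a + 1) (a + 1) ∨ₛ isUpair 0 (a + 1) (b + 1))

/-- `(a, b) ∈ r`. -/
def pairMem (a b r : ℕ) : Fml := bex r (isPair 0 (a + 1) (b + 1))

/-- `g` is a function from `D` to `E`, as a set of ordered pairs: every element of `g` is a pair
`(d, e)` with `d ∈ D` and `e ∈ E`, and for every `d ∈ D` there is a unique `e` with
`(d, e) ∈ g`. -/
def isFun (g D E : ℕ) : Fml :=
  ball g (bex (D + 1) (bex (E + 2) (isPair 2 1 0))) ∧ₛ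
  ball D (∃ₛ (pairMem 1 0 (g + 2) ∧ₛ ∀ₛ (pairMem 2 0 (g + 3) →ₛ 0 =ₛ 1)))

/-! ### Non-deterministic inductive definitions -/

/-- `R` is a set of rules on `X`: every `r ∈ R` is a pair `(a, b)` of subsets of `X`. -/
def isRuleSet (R X : ℕ) : Fml :=
  ball R (∃ₛ ∃ₛ (isPair 2 1 0 ∧ₛ isSub 1 (X + 3) ∧ₛ isSub 0 (X + 3)))

/-- `Y` is a subset of `X` that is closed under all rules in `R`: for every rule `(a, b) ∈ R`, if
`a ⊆ Y` then `b ∩ Y` is inhabited. -/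
def isClosedSub (Y R X : ℕ) : Fml :=
  isSub Y X ∧ₛ
  ball R (∀ₛ ∀ₛ (isPair 2 1 0 →ₛ isSub 1 (Y + 3) →ₛ bex 0 (0 ∈ₛ Y + 4)))

/-- The set `G` generates the class of `R`-closed subsets of `X`: every `β ∈ G` is an `R`-closed
subset of `X`, and for every `R`-closed `α ⊆ X` and `x ∈ α` there is `β ∈ G` with
`x ∈ β ⊆ α`. -/
def isGenerating (G R X : ℕ) : Fml :=
  ball G (isClosedSub 0 (R + 1) (X + 1)) ∧ₛ
  ∀ₛ (isClosedSub 0 (R + 1) (X + 1) →ₛ ball 0 (bex (G + 2) (1 ∈ₛ 0 ∧ₛ isSub 0 2)))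

/-- The NID principle: for every set `X` and every set `R` of rules on `X`, the class of `R`-closed
subsets of `X` is set-generated. -/
def NID : Fml := ∀ₛ ∀ₛ (isRuleSet 0 1 →ₛ ∃ₛ (isGenerating 0 1 2))

/-! ### Polynomial functors and W-types

Below, `f` is a function `B → A`. -/

/-- `F` is the fibre `f⁻¹(a) = {b : (b, a) ∈ f}`. -/
def isFibre (F f a : ℕ) : Fml := ∀ₛ (0 ∈ₛ F + 1 ↔ₛ pairMem 0 (a + 1) (f + 1))

/-- `P = P_f(X)`, the set of all pairs `(a, t)` with `a ∈ A` and `t : f⁻¹(a) → X`.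
In the body `q = 3`, `a = 2`, `F = 1`, `t = 0`. -/
def isPoly (P f A X : ℕ) : Fml :=
  ∀ₛ (0 ∈ₛ P + 1 ↔ₛ
    bex (A + 1) (∃ₛ ∃ₛ (isFibre 1 (f + 4) 2 ∧ₛ isFun 0 1 (X + 4) ∧ₛ isPair 3 2 0)))

/-- `(X, s)` is a `P_f`-algebra: `s` is a function from `P_f(X)` to `X`. -/
def isAlg (f A X s : ℕ) : Fml :=
  ∃ₛ (isPoly 0 (f + 1) (A + 1) (X + 1) ∧ₛ isFun (s + 1) 0 (X + 1))

/-- `c = {(b, v) : ∃ w, (b, w) ∈ t ∧ (w, v) ∈ α}`, the composite `α ∘ t`.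
In the body `z = 3`, `b = 2`, `w = 1`, `v = 0`. -/
def isComp (c α t : ℕ) : Fml :=
  ∀ₛ (0 ∈ₛ c + 1 ↔ₛ
    ∃ₛ ∃ₛ ∃ₛ (pairMem 2 1 (t + 4) ∧ₛ pairMem 1 0 (α + 4) ∧ₛ isPair 3 2 0))

/-- `r = P_f(α)(q)`, that is, `q = (a, t)` and `r = (a, α ∘ t)` for some `a` and `t`.
In the body `a = 2`, `t = 1`, `α ∘ t = 0`. -/
def isPolyMap (α q r : ℕ) : Fml :=
  ∃ₛ ∃ₛ ∃ₛ (isPair (q + 3) 2 1 ∧ₛ isPair (r + 3) 2 0 ∧ₛ isComp 0 (α + 3) 1)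

/-- `α` is a morphism of `P_f`-algebras from `(X, s)` to `(Y, t)`: it is a function `X → Y`, and
`α (s q) = t (P_f(α)(q))` for all `q ∈ P_f(X)`; that is, whenever `(q, x) ∈ s`, there are
`r = P_f(α)(q)` and `y` with `(x, y) ∈ α` and `(r, y) ∈ t`.
In the body `q = 3`, `x = 2`, `r = 1`, `y = 0`. -/
def isMor (α X s Y t : ℕ) : Fml :=
  isFun α X Y ∧ₛ
  ∀ₛ ∀ₛ (pairMem 1 0 (s + 2) →ₛ
    ∃ₛ ∃ₛ (isPolyMap (α + 4) 3 1 ∧ₛ pairMem 2 0 (α + 4) ∧ₛ pairMem 1 0 (t + 4)))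

/-- `(W, s)` is an initial `P_f`-algebra: it is a `P_f`-algebra, and for every `P_f`-algebra
`(X, t)` there is a unique morphism of `P_f`-algebras from `(W, s)` to `(X, t)`. -/
def isInitialAlg (f A W s : ℕ) : Fml :=
  isAlg f A W s ∧ₛ
  ∀ₛ ∀ₛ (isAlg (f + 2) (A + 2) 1 0 →ₛ
    ∃ₛ (isMor 0 (W + 3) (s + 3) 2 1 ∧ₛ
      ∀ₛ (isMor 0 (W + 4) (s + 4) 3 2 →ₛ 0 =ₛ 1)))

/-- All W-types exist: for all sets `B`, `A` and every function `f : B → A` there is an initial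
`P_f`-algebra `(W, s)`. -/
def WTypesExist : Fml :=
  ∀ₛ ∀ₛ ∀ₛ (isFun 0 2 1 →ₛ ∃ₛ ∃ₛ (isInitialAlg 2 3 1 0))

end CST

/-! The derivation is obtained semantically. Intuitionistic logic is complete for Kripke models
(`prv_of_forces`), so it suffices to show that in a Kripke model of CZF every world forcing NID also
forces the existence of W-types (`forces_wTypesExist`). The metatheory is classical and uses choice,
but sets of the model are produced only by the CZF axioms: Separation is available for bounded
formulas only, there are no power sets, and each notion must be stable under passage to later
worlds.

The set-theoretic argument has four ingredients.

(1) NID gives least fixed points (`exists_lfp`). A deterministic rule "if `a ⊆ I` then `x ∈ I`" is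
the rule `(a, {x})`. A fresh point is added to the carrier and forced into every closed set.
Set-generation at that point puts a member of `G` inside every closed set, so the intersection of
all members of the set `G` is the least closed set.

(2) There is a `P_f`-algebra with injective structure map (`exists_injective_algebra`). Its carrier
is the product over `k ∈ ω` of the iterates `P_f^k({∅})`, and `(a, t)` goes to the sequence with
value `∅` at `0` and `(a, b ↦ t(b)(k))` at `k + 1`. The value at `1` gives back `a`, and the later
values give back every `t(b)(k)`, hence `t`.

(3) By (1), this algebra has a smallest subalgebra `W`. It inherits the injectivity and admits
induction for bounded predicates (`exists_tree`, `IsTree.induction`).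

(4) Given an algebra `X`, let `Γ` be the smallest subalgebra of `W × X`, again by (1). Induction on
`W`, with injectivity giving each element a unique presentation, shows that `Γ` is the graph of a
function (`IsRecGraph.isFun`), which is then a morphism. Any other morphism is closed under the
rules generating `Γ`, so it contains `Γ` and equals it (`IsRecGraph.eq_of_isMorphism`). -/

namespace CST

/-! ### Renamings and free variables -/

namespace Fml

theorem up_comp (ρ σ : ℕ → ℕ) : up (ρ ∘ σ) = up ρ ∘ up σ := by
  funext k; cases k <;> rfl

theorem up_id : up id = id := by
  funext k; cases k <;> rfl

theorem ren_ren (φ : Fml) : ∀ ρ σ : ℕ → ℕ, ren ρ (ren σ φ) = ren (ρ ∘ σ) φ := by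
  induction φ <;> intro ρ σ <;> simp_all [ren, up_comp]

theorem ren_id (φ : Fml) : ren id φ = φ := by
  induction φ <;> simp_all [ren, up_id]

/-- The variable `k` occurs free in the formula. -/
def Free : ℕ → Fml → Prop
  | k, mem x y => k = x ∨ k = y
  | k, eq x y => k = x ∨ k = y
  | _, bot => False
  | k, imp φ ψ => Free k φ ∨ Free k ψ
  | k, and φ ψ => Free k φ ∨ Free k ψ
  | k, or φ ψ => Free k φ ∨ Free k ψ
  | k, all φ => Free (k + 1) φ
  | k, ex φ => Free (k + 1) φ

theorem ren_congr (φ : Fml) :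
    ∀ ρ σ : ℕ → ℕ, (∀ k, Free k φ → ρ k = σ k) → ren ρ φ = ren σ φ := by
  induction φ with
  | mem x y => intro ρ σ h; simp [ren, h x (Or.inl rfl), h y (Or.inr rfl)]
  | eq x y => intro ρ σ h; simp [ren, h x (Or.inl rfl), h y (Or.inr rfl)]
  | bot => intro ρ σ h; rfl
  | imp φ ψ ih₁ ih₂ | and φ ψ ih₁ ih₂ | or φ ψ ih₁ ih₂ =>
    intro ρ σ h
    simp [ren, ih₁ ρ σ fun k hk => h k (Or.inl hk), ih₂ ρ σ fun k hk => h k (Or.inr hk)]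
  | all φ ih | ex φ ih =>
    intro ρ σ h
    simp only [ren]
    rw [ih (up ρ) (up σ)]
    rintro (_ | k) hk
    · rfl
    · simp [up, h k hk]

theorem exists_bound_free (φ : Fml) : ∃ N, ∀ k, Free k φ → k < N := by
  induction φ with
  | mem x y | eq x y =>
    refine ⟨x + y + 1, ?_⟩
    rintro k (rfl | rfl) <;> omega
  | bot => exact ⟨0, fun _ h => h.elim⟩
  | imp φ ψ ih₁ ih₂ | and φ ψ ih₁ ih₂ | or φ ψ ih₁ ih₂ =>
    obtain ⟨a, ha⟩ := ih₁
    obtain ⟨b, hb⟩ := ih₂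
    refine ⟨a + b, ?_⟩
    rintro k (h | h)
    · have := ha k h; omega
    · have := hb k h; omega
  | all φ ih | ex φ ih =>
    obtain ⟨a, ha⟩ := ih
    refine ⟨a, fun k h => ?_⟩
    have := ha _ h; omega

theorem exists_bound_free_list (L : List Fml) : ∃ N, ∀ φ ∈ L, ∀ k, Free k φ → k < N := by
  induction L with
  | nil => exact ⟨0, by simp⟩
  | cons φ L ih =>
    obtain ⟨a, ha⟩ := ih
    obtain ⟨b, hb⟩ := exists_bound_free φ
    refine ⟨a + b, ?_⟩
    intro ψ hψ k hk
    rcases List.mem_cons.1 hψ with rfl | h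
    · have := hb k hk; omega
    · have := ha ψ h k hk; omega

theorem free_ren (φ : Fml) :
    ∀ (ρ : ℕ → ℕ) (k : ℕ), Free k (ren ρ φ) → ∃ j, Free j φ ∧ ρ j = k := by
  induction φ with
  | mem x y | eq x y =>
    rintro ρ k (h | h)
    · exact ⟨x, Or.inl rfl, h.symm⟩
    · exact ⟨y, Or.inr rfl, h.symm⟩
  | bot => intro _ _ h; exact h.elim
  | imp φ ψ ih₁ ih₂ | and φ ψ ih₁ ih₂ | or φ ψ ih₁ ih₂ =>
    rintro ρ k (h | h)
    · obtain ⟨j, hj, e⟩ := ih₁ ρ k h; exact ⟨j, Or.inl hj, e⟩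
    · obtain ⟨j, hj, e⟩ := ih₂ ρ k h; exact ⟨j, Or.inr hj, e⟩
  | all φ ih | ex φ ih =>
    intro ρ k h
    obtain ⟨j, hj, e⟩ := ih (up ρ) (k + 1) h
    cases j with
    | zero => simp [up] at e
    | succ j => exact ⟨j, hj, by simpa [up] using e⟩

theorem ren_inst_nil (ρ : ℕ → ℕ) (φ : Fml) : ren (up ρ) (φ.inst [] 1) = (ren ρ φ).inst [] 1 := by
  simp only [inst, ren_ren]; rfl

theorem ren_inst_one (ρ : ℕ → ℕ) (φ : Fml) (t : ℕ) :
    ren ρ (φ.inst [t] 0) = (ren (up ρ) φ).inst [ρ t] 0 := by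
  simp only [inst, ren_ren]
  congr 1
  funext k; cases k <;> rfl

end Fml

open Fml

/-! ### Structural properties of derivations -/

namespace Prv

variable {T : Set Fml} {Γ Δ : List Fml} {φ ψ χ : Fml}

theorem weaken (h : Prv T Γ φ) : ∀ {Δ : List Fml}, Γ ⊆ Δ → Prv T Δ φ := by
  induction h with
  | ax h => intro Δ s; exact ax h
  | hyp h => intro Δ s; exact hyp (s h)
  | botE _ ih => intro Δ s; exact botE (ih s)
  | impI _ ih => intro Δ s; exact impI (ih (List.cons_subset_cons _ s))
  | impE _ _ ih₁ ih₂ => intro Δ s; exact impE (ih₁ s) (ih₂ s)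
  | andI _ _ ih₁ ih₂ => intro Δ s; exact andI (ih₁ s) (ih₂ s)
  | andE₁ _ ih => intro Δ s; exact andE₁ (ih s)
  | andE₂ _ ih => intro Δ s; exact andE₂ (ih s)
  | orI₁ _ ih => intro Δ s; exact orI₁ (ih s)
  | orI₂ _ ih => intro Δ s; exact orI₂ (ih s)
  | orE _ _ _ ih₁ ih₂ ih₃ =>
    intro Δ s
    exact orE (ih₁ s) (ih₂ (List.cons_subset_cons _ s)) (ih₃ (List.cons_subset_cons _ s))
  | allI _ ih => intro Δ s; exact allI (ih (List.map_subset _ s))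
  | allE t _ ih => intro Δ s; exact allE t (ih s)
  | exI t _ ih => intro Δ s; exact exI t (ih s)
  | exE _ _ ih₁ ih₂ =>
    intro Δ s
    exact exE (ih₁ s) (ih₂ (List.cons_subset_cons _ (List.map_subset _ s)))
  | eqI t => intro Δ s; exact eqI t
  | eqE φ _ _ ih₁ ih₂ => intro Δ s; exact eqE φ (ih₁ s) (ih₂ s)

theorem map_ren_inst (ρ : ℕ → ℕ) (Γ : List Fml) :
    (Γ.map fun ψ => ψ.inst [] 1).map (Fml.ren (up ρ)) =
      (Γ.map (Fml.ren ρ)).map fun ψ => ψ.inst [] 1 := by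
  simp [List.map_map, Function.comp_def, ren_inst_nil]

/-- The schemata of a theory carry free parameters, so stability of `T` under renaming is what
handles the axiom case. It later allows a fresh variable to be turned into a bound one. -/
theorem rename (hT : ∀ φ ∈ T, ∀ ρ, Fml.ren ρ φ ∈ T) (h : Prv T Γ φ) :
    ∀ ρ : ℕ → ℕ, Prv T (Γ.map (Fml.ren ρ)) (Fml.ren ρ φ) := by
  induction h with
  | ax h => intro ρ; exact ax (hT _ h ρ)
  | hyp h => intro ρ; exact hyp (List.mem_map_of_mem h)
  | botE _ ih => intro ρ; exact botE (ih ρ)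
  | impI _ ih => intro ρ; exact impI (ih ρ)
  | impE _ _ ih₁ ih₂ => intro ρ; exact impE (ih₁ ρ) (ih₂ ρ)
  | andI _ _ ih₁ ih₂ => intro ρ; exact andI (ih₁ ρ) (ih₂ ρ)
  | andE₁ _ ih => intro ρ; exact andE₁ (ih ρ)
  | andE₂ _ ih => intro ρ; exact andE₂ (ih ρ)
  | orI₁ _ ih => intro ρ; exact orI₁ (ih ρ)
  | orI₂ _ ih => intro ρ; exact orI₂ (ih ρ)
  | orE _ _ _ ih₁ ih₂ ih₃ => intro ρ; exact orE (ih₁ ρ) (ih₂ ρ) (ih₃ ρ)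
  | allI _ ih =>
    intro ρ
    have := ih (up ρ)
    rw [map_ren_inst] at this
    exact allI this
  | allE t _ ih => intro ρ; rw [ren_inst_one]; exact allE _ (ih ρ)
  | exI t _ ih => intro ρ; have := ih ρ; rw [ren_inst_one] at this; exact exI _ this
  | exE _ _ ih₁ ih₂ =>
    intro ρ
    have := ih₂ (up ρ)
    rw [List.map_cons, map_ren_inst, ren_inst_nil] at this
    exact exE (ih₁ ρ) this
  | eqI t => intro ρ; exact eqI _
  | eqE φ _ _ ih₁ ih₂ =>
    intro ρ
    have := ih₂ ρ
    rw [ren_inst_one] at this ⊢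
    exact eqE _ (ih₁ ρ) this

theorem cut (h₁ : Prv T Γ φ) (h₂ : Prv T (φ :: Γ) ψ) : Prv T Γ ψ := impE (impI h₂) h₁

end Prv

/-- Derivability from a set of assumptions. -/
def SPrv (T Γ : Set Fml) (φ : Fml) : Prop := ∃ L : List Fml, (∀ ψ ∈ L, ψ ∈ Γ) ∧ Prv T L φ

namespace SPrv

variable {T Γ Δ : Set Fml} {φ ψ χ : Fml}

theorem mono (h : SPrv T Γ φ) (s : Γ ⊆ Δ) : SPrv T Δ φ := by
  obtain ⟨L, hL, h⟩ := h
  exact ⟨L, fun ψ hψ => s (hL ψ hψ), h⟩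

theorem of_mem (h : φ ∈ Γ) : SPrv T Γ φ := ⟨[φ], by simpa, .hyp (by simp)⟩

theorem imp_of_insert (h : SPrv T (insert φ Γ) ψ) : SPrv T Γ (φ →ₛ ψ) := by
  classical
  obtain ⟨L, hL, h⟩ := h
  refine ⟨L.filter (· ≠ φ), ?_, .impI (h.weaken ?_)⟩
  · intro χ hχ
    simp only [ne_eq, decide_not, List.mem_filter, Bool.not_eq_eq_eq_not, Bool.not_true,
      decide_eq_false_iff_not] at hχ
    rcases hL χ hχ.1 with h | h
    · exact absurd h hχ.2
    · exact h
  · intro χ hχ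
    by_cases e : χ = φ
    · simp [e]
    · simp [e, hχ]

theorem two {α β : Fml} (h₁ : SPrv T Γ α) (h₂ : SPrv T Γ β)
    (h : Prv T [α, β] φ) : SPrv T Γ φ := by
  obtain ⟨L₁, hL₁, h₁⟩ := h₁
  obtain ⟨L₂, hL₂, h₂⟩ := h₂
  refine ⟨L₁ ++ L₂, ?_, ?_⟩
  · intro ψ hψ
    rcases List.mem_append.1 hψ with h | h
    · exact hL₁ _ h
    · exact hL₂ _ h
  · refine .cut (h₂.weaken (by simp)) (.cut (h₁.weaken ?_) (h.weaken (by simp)))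
    intro x hx; simp [hx]

theorem one {α : Fml} (h₁ : SPrv T Γ α) (h : Prv T [α] φ) : SPrv T Γ φ :=
  two h₁ h₁ (h.weaken (by simp))

theorem mp (h₁ : SPrv T Γ (φ →ₛ ψ)) (h₂ : SPrv T Γ φ) : SPrv T Γ ψ :=
  two h₁ h₂ (.impE (.hyp (by simp) : Prv T _ (φ →ₛ ψ)) (.hyp (by simp)))

theorem orE (h : SPrv T Γ (φ ∨ₛ ψ)) (h₁ : SPrv T (insert φ Γ) χ) (h₂ : SPrv T (insert ψ Γ) χ) :
    SPrv T Γ χ := by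
  have h₁ := imp_of_insert h₁
  have h₂ := imp_of_insert h₂
  have : SPrv T Γ ((φ →ₛ χ) →ₛ (ψ →ₛ χ) →ₛ χ) := by
    refine one h (.impI (.impI (.orE (φ := φ) (ψ := ψ) (.hyp (by simp)) ?_ ?_)))
    · exact .impE (φ := φ) (.hyp (by simp)) (.hyp (by simp))
    · exact .impE (φ := ψ) (.hyp (by simp)) (.hyp (by simp))
  exact (this.mp h₁).mp h₂

end SPrv

end CST

/-! ### Saturated theories -/

namespace CST

open Fml

deriving instance Countable for Fml

instance : Nonempty Fml := ⟨bot⟩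

/-- A saturated theory: consistent, deductively closed, prime, with witnesses for existentials. -/
structure Saturated (T Δ : Set Fml) : Prop where
  closed : ∀ {φ}, SPrv T Δ φ → φ ∈ Δ
  bot : bot ∉ Δ
  or : ∀ {φ ψ}, (φ ∨ₛ ψ) ∈ Δ → φ ∈ Δ ∨ ψ ∈ Δ
  ex : ∀ {φ}, (∃ₛ φ) ∈ Δ → ∃ t, φ.inst [t] 0 ∈ Δ

section Extension

variable {T : Set Fml}

theorem SPrv.exE_fresh (hT : ∀ φ ∈ T, ∀ ρ, ren ρ φ ∈ T) {Γ : Set Fml} {φ χ : Fml} {c : ℕ}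
    (hΓ : ∀ ψ ∈ Γ, ¬ Free c ψ) (hφ : ¬ Free c (∃ₛ φ)) (hχ : ¬ Free c χ)
    (h : SPrv T (insert (φ.inst [c] 0) Γ) χ) (h' : SPrv T Γ (∃ₛ φ)) : SPrv T Γ χ := by
  obtain ⟨L, hL, h⟩ := h.imp_of_insert
  obtain ⟨L', hL', h'⟩ := h'
  refine ⟨L' ++ L, ?_, .exE (φ := φ) (h'.weaken (by simp)) ?_⟩
  · intro ψ hψ
    rcases List.mem_append.1 hψ with h | h
    · exact hL' _ h
    · exact hL _ h
  -- The fresh name `c` becomes the bound variable `0` and all else is shifted past it, which is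
  -- exactly the context required by the rule `exE`.
  let ρ : ℕ → ℕ := fun k => if k = c then 0 else k + 1
  have key : ∀ ψ, ¬ Free c ψ → ren ρ ψ = ψ.inst [] 1 := by
    intro ψ hψ
    refine ren_congr ψ _ _ fun k hk => ?_
    have : k ≠ c := by rintro rfl; exact hψ hk
    simp [ρ, this, env]
  have e := h.rename hT ρ
  have e1 : ren ρ (φ.inst [c] 0) = φ := by
    rw [inst, ren_ren]
    conv_rhs => rw [← ren_id φ]
    refine ren_congr φ _ _ ?_
    rintro (_ | k) hk
    · simp [ρ, env]
    · have : k ≠ c := by rintro rfl; exact hφ hk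
      simp [ρ, this, env]
  rw [show ren ρ (φ.inst [c] 0 →ₛ χ) = (φ →ₛ χ.inst [] 1) by
    simp only [ren]; rw [e1, key χ hχ]] at e
  refine .impE (.weaken e ?_) (.hyp (by simp))
  intro ψ hψ
  obtain ⟨ψ', hψ', rfl⟩ := List.mem_map.1 hψ
  rw [key _ (hΓ _ (hL _ hψ'))]
  refine List.mem_cons_of_mem _ (List.mem_map.2 ⟨ψ', by simp [hψ'], rfl⟩)

/-- One stage of a Henkin construction that keeps `χ` underivable. Only finitely many formulas have
been added to `Γ` at any stage, so a fresh variable is always left to witness an existential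
formula. -/
theorem exists_extension_step (hT : ∀ φ ∈ T, ∀ ρ, ren ρ φ ∈ T) {Γ : Set Fml} {χ : Fml}
    (fresh : ∀ N, ∃ c ≥ N, ∀ ψ ∈ Γ, ¬ Free c ψ) (L : List Fml)
    (hL : ¬ SPrv T (Γ ∪ {ψ | ψ ∈ L}) χ) (φ : Fml) :
    ∃ L' : List Fml, L ⊆ L' ∧ ¬ SPrv T (Γ ∪ {ψ | ψ ∈ L'}) χ ∧
      (SPrv T (insert φ (Γ ∪ {ψ | ψ ∈ L'})) χ ∨
        φ ∈ L' ∧ ∀ ψ, φ = (∃ₛ ψ) → ∃ c, ψ.inst [c] 0 ∈ L') := by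
  by_cases h : SPrv T (insert φ (Γ ∪ {ψ | ψ ∈ L})) χ
  · exact ⟨L, fun _ h => h, hL, Or.inl h⟩
  have h1 : ¬ SPrv T (Γ ∪ {ψ | ψ ∈ φ :: L}) χ := by
    intro h2
    refine h (h2.mono ?_)
    rintro ψ (h | h)
    · exact Or.inr (Or.inl h)
    · rcases List.mem_cons.1 h with rfl | h
      · exact Or.inl rfl
      · exact Or.inr (Or.inr h)
  by_cases hex : ∃ ψ, φ = (∃ₛ ψ)
  · obtain ⟨ψ, rfl⟩ := hex
    obtain ⟨N, hN⟩ := exists_bound_free_list (χ :: (∃ₛ ψ) :: L)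
    obtain ⟨c, hc, hcΓ⟩ := fresh N
    have hcN : ∀ φ ∈ χ :: (∃ₛ ψ) :: L, ¬ Free c φ := fun φ hφ hf => by
      have := hN φ hφ c hf; omega
    refine ⟨ψ.inst [c] 0 :: (∃ₛ ψ) :: L, by intro x hx; simp [hx], ?_, Or.inr ⟨by simp, ?_⟩⟩
    · intro h2
      refine h1 (SPrv.exE_fresh hT (c := c) (φ := ψ) ?_ (hcN _ (by simp)) (hcN _ (by simp))
        (h2.mono ?_) (.of_mem (Or.inr (by simp))))
      · rintro θ (hθ | hθ)
        · exact hcΓ _ hθ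
        · exact hcN _ (List.mem_cons_of_mem _ hθ)
      · rintro θ (hθ | hθ)
        · exact Or.inr (Or.inl hθ)
        · rcases List.mem_cons.1 hθ with rfl | hθ
          · exact Or.inl rfl
          · exact Or.inr (Or.inr hθ)
    · rintro ψ' e
      cases e
      exact ⟨c, by simp⟩
  · exact ⟨φ :: L, by intro x hx; simp [hx], h1, Or.inr ⟨by simp, fun ψ e => (hex ⟨ψ, e⟩).elim⟩⟩

/-- Every formula is offered once, along an enumeration, and is accepted together with a witness
unless it would make `χ` derivable. In the limit, a rejected formula is one that yields `χ`, and
closure and primeness follow from this alone. -/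
theorem exists_saturated (hT : ∀ φ ∈ T, ∀ ρ, ren ρ φ ∈ T) {Γ : Set Fml} {χ : Fml}
    (fresh : ∀ N, ∃ c ≥ N, ∀ ψ ∈ Γ, ¬ Free c ψ) (h : ¬ SPrv T Γ χ) :
    ∃ Δ, Γ ⊆ Δ ∧ Saturated T Δ ∧ χ ∉ Δ := by
  obtain ⟨en, hen⟩ := exists_surjective_nat Fml
  choose! nxt h1 h2 h3 using
    fun (L : List Fml) (hL : ¬ SPrv T (Γ ∪ {ψ | ψ ∈ L}) χ) (φ : Fml) =>
      exists_extension_step hT fresh L hL φ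
  let s : ℕ → List Fml := fun n => Nat.rec [] (fun n L => nxt L (en n)) n
  have hs : ∀ n, ¬ SPrv T (Γ ∪ {ψ | ψ ∈ s n}) χ := by
    intro n
    induction n with
    | zero => simpa [s] using h
    | succ n ih => exact h2 _ ih _
  have hmono : ∀ m n, m ≤ n → s m ⊆ s n := by
    intro m n hmn
    induction n, hmn using Nat.le_induction with
    | base => exact fun _ h => h
    | succ n _ ih => exact fun _ hx => h1 _ (hs n) _ (ih hx)
  let Δ : Set Fml := Γ ∪ {ψ | ∃ n, ψ ∈ s n}
  have hsΔ : ∀ n, Γ ∪ {ψ | ψ ∈ s n} ⊆ Δ := by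
    rintro n ψ (h | h)
    · exact Or.inl h
    · exact Or.inr ⟨n, h⟩
  have hΔ : ¬ SPrv T Δ χ := by
    rintro ⟨L, hL, hp⟩
    have : ∃ n, ∀ ψ ∈ L, ψ ∈ Γ ∪ {ψ | ψ ∈ s n} := by
      clear hp
      induction L with
      | nil => exact ⟨0, by simp⟩
      | cons φ L ih =>
        obtain ⟨n, hn⟩ := ih fun ψ hψ => hL ψ (List.mem_cons_of_mem _ hψ)
        obtain ⟨m, hm⟩ : ∃ m, φ ∈ Γ ∪ {ψ | ψ ∈ s m} := by
          rcases hL φ List.mem_cons_self with h | ⟨m, h⟩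
          · exact ⟨0, Or.inl h⟩
          · exact ⟨m, Or.inr h⟩
        refine ⟨max m n, ?_⟩
        intro ψ hψ
        rcases List.mem_cons.1 hψ with rfl | hψ
        · rcases hm with h | h
          · exact Or.inl h
          · exact Or.inr (hmono _ _ (le_max_left _ _) h)
        · rcases hn ψ hψ with h | h
          · exact Or.inl h
          · exact Or.inr (hmono _ _ (le_max_right _ _) h)
    obtain ⟨n, hn⟩ := this
    exact hs n ⟨L, hn, hp⟩
  have hmax : ∀ φ, ¬ SPrv T (insert φ Δ) χ → φ ∈ Δ := by
    intro φ hφ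
    obtain ⟨n, rfl⟩ := hen φ
    rcases h3 _ (hs n) (en n) with h | h
    · exact (hφ (h.mono (Set.insert_subset_insert (hsΔ (n + 1))))).elim
    · exact Or.inr ⟨n + 1, h.1⟩
  have hcl : ∀ {φ}, SPrv T Δ φ → φ ∈ Δ := fun {φ} hφ =>
    hmax φ fun h => hΔ (h.imp_of_insert.mp hφ)
  refine ⟨Δ, fun _ h => Or.inl h, ⟨hcl, ?_, ?_, ?_⟩, fun h => hΔ (.of_mem h)⟩
  · intro h
    exact hΔ ((SPrv.of_mem h).one (.botE (.hyp (by simp))))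
  · intro φ ψ h
    by_contra! h'
    have h4 := not_imp_comm.1 (hmax φ) h'.1
    have h5 := not_imp_comm.1 (hmax ψ) h'.2
    exact hΔ (SPrv.orE (.of_mem h) h4 h5)
  · intro φ h
    obtain ⟨n, hn⟩ := hen (∃ₛ φ)
    rcases h3 _ (hs n) (en n) with h' | h'
    · refine (hΔ (h'.mono ?_)).elim
      rw [hn]
      refine Set.insert_subset h ?_
      rw [← hn]
      exact hsΔ (n + 1)
    · obtain ⟨c, hc⟩ := h'.2 φ hn
      exact ⟨c, Or.inr ⟨n + 1, hc⟩⟩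

end Extension

/-! ### Kripke models and completeness -/

/-- A Kripke model for the language of set theory, over a category of worlds. -/
structure KModel where
  W : Type
  Hom : W → W → Type
  idn : ∀ w, Hom w w
  comp : ∀ {w v u}, Hom w v → Hom v u → Hom w u
  idn_comp : ∀ {w v} (f : Hom w v), comp (idn w) f = f
  comp_idn : ∀ {w v} (f : Hom w v), comp f (idn v) = f
  comp_assoc : ∀ {w v u t} (f : Hom w v) (g : Hom v u) (h : Hom u t),
    comp (comp f g) h = comp f (comp g h)
  M : W → Type
  pt : ∀ w, M w
  res : ∀ {w v}, M w → Hom w v → M v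
  res_id : ∀ {w} (x : M w), res x (idn w) = x
  res_comp : ∀ {w v u} (f : Hom w v) (g : Hom v u) (x : M w), res (res x f) g = res x (comp f g)
  mem : ∀ {w}, M w → M w → Prop
  mem_res : ∀ {w v} {x y : M w} (f : Hom w v), mem x y → mem (res x f) (res y f)

infixl:70 " ⇡ " => KModel.res _

namespace KModel

variable {K : KModel}

instance {w : K.W} : Membership (K.M w) (K.M w) := ⟨fun y x => K.mem x y⟩

/-- Extend an assignment of the variables by a value for the variable `0`. -/
def cons {α : Type} (x : α) (e : ℕ → α) : ℕ → α
  | 0 => x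
  | k + 1 => e k

infixr:67 " ⦂ " => cons

/-- The forcing relation. -/
def Forces : Fml → ∀ w, (ℕ → K.M w) → Prop
  | .mem x y, _, e => e x ∈ e y
  | .eq x y, _, e => e x = e y
  | .bot, _, _ => False
  | .imp φ ψ, w, e => ∀ v (f : K.Hom w v),
      Forces φ v (fun k => K.res (e k) f) → Forces ψ v (fun k => K.res (e k) f)
  | .and φ ψ, w, e => Forces φ w e ∧ Forces ψ w e
  | .or φ ψ, w, e => Forces φ w e ∨ Forces ψ w e
  | .all φ, w, e => ∀ v (f : K.Hom w v) (x : K.M v), Forces φ v (x ⦂ fun k => K.res (e k) f)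
  | .ex φ, w, e => ∃ x : K.M w, Forces φ w (x ⦂ e)

end KModel

section Canonical

variable (T : Set Fml)

/-- Equality of variables in a saturated theory. -/
def canonicalSetoid (Δ : {Δ : Set Fml // Saturated T Δ}) : Setoid ℕ where
  r a b := (a =ₛ b) ∈ Δ.1
  iseqv := by
    have sym : ∀ {a b}, (a =ₛ b) ∈ Δ.1 → (b =ₛ a) ∈ Δ.1 := fun {a b} h =>
      Δ.2.closed ((SPrv.of_mem h).one
        (.eqE (φ := 0 =ₛ a + 1) (.hyp (by simp) : Prv T _ (a =ₛ b)) (.eqI a)))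
    refine ⟨fun a => Δ.2.closed ⟨[], by simp, .eqI a⟩, sym, ?_⟩
    intro a b c h₁ h₂
    exact Δ.2.closed ((SPrv.of_mem h₁).two (SPrv.of_mem h₂)
        (.eqE (φ := a + 1 =ₛ 0) (.hyp (by simp) : Prv T _ (b =ₛ c)) (.hyp (by simp [inst, ren, env]))))

/-- The canonical Kripke model of a theory. -/
def canonicalModel : KModel where
  W := {Δ : Set Fml // Saturated T Δ}
  -- All worlds name their elements by the same variables `ℕ`. Room for new names is made by
  -- renaming instead of enlarging the language, so arrows carry a renaming and the worlds form a
  -- category instead of a poset.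
  Hom Δ Δ' := {ρ : ℕ → ℕ // ∀ φ ∈ Δ.1, ren ρ φ ∈ Δ'.1}
  idn Δ := ⟨id, fun φ h => by rwa [ren_id]⟩
  comp f g := ⟨g.1 ∘ f.1, fun φ h => by rw [← ren_ren]; exact g.2 _ (f.2 _ h)⟩
  idn_comp _ := rfl
  comp_idn _ := rfl
  comp_assoc _ _ _ := rfl
  M Δ := Quotient (canonicalSetoid T Δ)
  pt Δ := Quotient.mk _ 0
  res {Δ Δ'} x f := Quotient.map f.1 (fun a b h => f.2 (a =ₛ b) h) x
  res_id x := by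
    induction x using Quotient.ind; rfl
  res_comp f g x := by
    induction x using Quotient.ind; rfl
  mem {Δ} x y := Quotient.liftOn₂ x y (fun a b => (a ∈ₛ b) ∈ Δ.1) (by
    have key : ∀ a b a' b', (a =ₛ a') ∈ Δ.1 → (b =ₛ b') ∈ Δ.1 →
        (a ∈ₛ b) ∈ Δ.1 → (a' ∈ₛ b') ∈ Δ.1 := by
      intro a b a' b' h₁ h₂ h
      have : (a' ∈ₛ b) ∈ Δ.1 := Δ.2.closed ((SPrv.of_mem h₁).two (SPrv.of_mem h)
        (.eqE (φ := 0 ∈ₛ b + 1) (.hyp (by simp) : Prv T _ (a =ₛ a'))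
          (.hyp (by simp [inst, ren, env]))))
      exact Δ.2.closed ((SPrv.of_mem h₂).two (SPrv.of_mem this)
        (.eqE (φ := a' + 1 ∈ₛ 0) (.hyp (by simp) : Prv T _ (b =ₛ b'))
          (.hyp (by simp [inst, ren, env]))))
    intro a b a' b' h₁ h₂
    exact propext ⟨key _ _ _ _ h₁ h₂,
      key _ _ _ _ ((canonicalSetoid T Δ).symm h₁) ((canonicalSetoid T Δ).symm h₂)⟩)
  mem_res {Δ Δ' x y} f h := by
    induction x using Quotient.ind
    induction y using Quotient.ind
    exact f.2 _ h

variable {T}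

open KModel

/-- Doubling all variables frees the odd ones. Infinitely many of them are also absent from `φ`, so
the theory can be saturated again. -/
theorem exists_canonical_succ (hT : ∀ φ ∈ T, ∀ ρ, ren ρ φ ∈ T) {Δ : Set Fml} {φ χ : Fml}
    (h : ¬ SPrv T (insert φ (ren (2 * ·) '' Δ)) χ) :
    ∃ Δ', (∀ ψ ∈ Δ, ren (2 * ·) ψ ∈ Δ') ∧ φ ∈ Δ' ∧ Saturated T Δ' ∧ χ ∉ Δ' := by
  obtain ⟨Δ', h₁, h₂, h₃⟩ := exists_saturated hT (fun N => by
    obtain ⟨B, hB⟩ := exists_bound_free φ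
    refine ⟨2 * (N + B) + 1, by omega, ?_⟩
    rintro ψ (rfl | ⟨ψ, -, rfl⟩) hf
    · have := hB _ hf; omega
    · obtain ⟨j, -, e⟩ := free_ren _ _ _ hf
      omega) h
  exact ⟨Δ', fun ψ hψ => h₁ (Or.inr ⟨ψ, hψ, rfl⟩), h₁ (Or.inl rfl), h₂, h₃⟩

/-- The element of the canonical model named by a variable. -/
def canonicalMk (Δ : (canonicalModel T).W) (t : ℕ) : (canonicalModel T).M Δ := Quotient.mk _ t

theorem canonicalMk_surjective (Δ : (canonicalModel T).W) :
    Function.Surjective (canonicalMk Δ) := Quotient.exists_rep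

theorem canonical_res (Δ Δ' : (canonicalModel T).W) (f : (canonicalModel T).Hom Δ Δ')
    (σ : ℕ → ℕ) :
    (fun k => (canonicalModel T).res (canonicalMk Δ (σ k)) f) =
      fun k => canonicalMk Δ' ((f.1 ∘ σ) k) := rfl

theorem canonical_cons (Δ : (canonicalModel T).W) (t : ℕ) (σ : ℕ → ℕ) :
    ((canonicalMk Δ t) ⦂ fun k => canonicalMk Δ (σ k)) =
      fun k => canonicalMk Δ ((t ⦂ σ) k) := by
  funext k; cases k <;> rfl

theorem inst_ren_up (φ : Fml) (t : ℕ) (σ : ℕ → ℕ) :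
    (ren (up σ) φ).inst [t] 0 = ren (t ⦂ σ) φ := by
  rw [inst, ren_ren]; congr 1; funext k; cases k <;> rfl

/-- The truth lemma. Only `imp` and `all` need a new world: a formula missing from `Δ` is refuted in
a saturated extension of the doubled theory. -/
theorem canonical_truth (hT : ∀ φ ∈ T, ∀ ρ, ren ρ φ ∈ T) (φ : Fml) :
    ∀ (Δ : (canonicalModel T).W) (σ : ℕ → ℕ),
      Forces (K := canonicalModel T) φ Δ (fun k => canonicalMk Δ (σ k)) ↔
        ren σ φ ∈ Δ.1 := by
  induction φ with
  | mem x y => intro Δ σ; rfl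
  | eq x y => intro Δ σ; exact Quotient.eq (r := canonicalSetoid T Δ)
  | bot => intro Δ σ; exact ⟨fun h => h.elim, fun h => Δ.2.bot h⟩
  | and φ ψ ih₁ ih₂ =>
    intro Δ σ
    simp only [Forces, ih₁, ih₂, ren]
    constructor
    · rintro ⟨h₁, h₂⟩
      exact Δ.2.closed ((SPrv.of_mem h₁).two (SPrv.of_mem h₂)
        (.andI (.hyp (by simp)) (.hyp (by simp))))
    · intro h
      exact ⟨Δ.2.closed ((SPrv.of_mem h).one (.andE₁ (.hyp List.mem_cons_self))),
        Δ.2.closed ((SPrv.of_mem h).one (.andE₂ (.hyp List.mem_cons_self)))⟩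
  | or φ ψ ih₁ ih₂ =>
    intro Δ σ
    simp only [Forces, ih₁, ih₂, ren]
    constructor
    · rintro (h | h)
      · exact Δ.2.closed ((SPrv.of_mem h).one (.orI₁ (.hyp (by simp))))
      · exact Δ.2.closed ((SPrv.of_mem h).one (.orI₂ (.hyp (by simp))))
    · exact Δ.2.or
  | ex φ ih =>
    intro Δ σ
    simp only [Forces, ren]
    constructor
    · rintro ⟨x, hx⟩
      obtain ⟨t, rfl⟩ := canonicalMk_surjective _ x
      rw [canonical_cons, ih, ← inst_ren_up] at hx
      exact Δ.2.closed ((SPrv.of_mem hx).one (.exI t (.hyp (by simp))))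
    · intro h
      obtain ⟨t, ht⟩ := Δ.2.ex h
      refine ⟨canonicalMk _ t, ?_⟩
      rw [canonical_cons, ih, ← inst_ren_up]
      exact ht
  | imp φ ψ ih₁ ih₂ =>
    intro Δ σ
    simp only [Forces, canonical_res, ih₁, ih₂]
    constructor
    · intro h
      by_contra hn
      obtain ⟨Δ', h₁, h₂, h₃, h₄⟩ := exists_canonical_succ (T := T) hT (Δ := Δ.1)
          (φ := ren (2 * ·) (ren σ φ)) (χ := ren (2 * ·) (ren σ ψ)) (by
        intro hp
        obtain ⟨L, hL, hp⟩ := hp.imp_of_insert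
        -- Halving undoes the doubling and brings the derivation back to `Δ`.
        refine hn (Δ.2.closed ⟨L.map (ren (· / 2)), ?_, ?_⟩)
        · intro ψ' hψ'
          obtain ⟨θ, hθ, rfl⟩ := List.mem_map.1 hψ'
          obtain ⟨θ', hθ', rfl⟩ := hL _ hθ
          rw [ren_ren, show ((· / 2) ∘ (2 * ·) : ℕ → ℕ) = id by funext k; simp, ren_id]
          exact hθ'
        · have := hp.rename hT (· / 2)
          simp only [ren] at this
          rw [ren_ren (ren σ φ), ren_ren (ren σ ψ),
            show ((· / 2) ∘ (2 * ·) : ℕ → ℕ) = id by funext k; simp, ren_id, ren_id] at this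
          exact this)
      rw [ren_ren] at h₂ h₄
      exact h₄ (h ⟨Δ', h₃⟩ ⟨(2 * ·), h₁⟩ h₂)
    · intro h Δ' f h₁
      have := f.2 _ h
      simp only [ren, ren_ren] at this
      exact Δ'.2.closed ((SPrv.of_mem this).mp (SPrv.of_mem h₁))
  | all φ ih =>
    intro Δ σ
    simp only [Forces, canonical_res]
    constructor
    · intro h
      by_contra hn
      -- The odd variable `1` names a generic element, about which nothing is assumed; hence the
      -- tautology in place of a new assumption.
      obtain ⟨Δ', h₁, -, h₃, h₄⟩ := exists_canonical_succ (T := T) hT (Δ := Δ.1)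
          (φ := bot →ₛ bot) (χ := ren (1 ⦂ ((2 * ·) ∘ σ)) φ) (by
        intro hp
        obtain ⟨L, hL, hp⟩ := hp.imp_of_insert.mp ⟨[], by simp, .impI (.hyp (by simp))⟩
        choose! g hg₁ hg₂ using hL
        refine hn (Δ.2.closed ⟨L.map g, ?_, .allI ?_⟩)
        · intro ψ' hψ'
          obtain ⟨θ, hθ, rfl⟩ := List.mem_map.1 hψ'
          exact hg₁ _ hθ
        -- The generic name `1` becomes the bound variable, and a doubled variable `2 * k` becomes
        -- the weakening of `k`.
        · let ρ : ℕ → ℕ := fun k => if k = 1 then 0 else k / 2 + 1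
          have := hp.rename hT ρ
          rw [ren_ren, show ρ ∘ (1 ⦂ ((2 * ·) ∘ σ)) = up σ by
            funext k; cases k with
            | zero => rfl
            | succ k =>
              have : ¬ 2 * σ k = 1 := by omega
              simp [ρ, cons, up, this]] at this
          refine this.weaken ?_
          intro ψ' hψ'
          obtain ⟨θ, hθ, rfl⟩ := List.mem_map.1 hψ'
          refine List.mem_map.2 ⟨g θ, List.mem_map_of_mem hθ, ?_⟩
          conv_rhs => rw [← hg₂ θ hθ]
          rw [ren_ren, inst]
          congr 1
          funext k
          have : ¬ 2 * k = 1 := by omega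
          simp [ρ, env, this])
      obtain ⟨Δ'', rfl⟩ : ∃ Δ'' : (canonicalModel T).W, Δ''.1 = Δ' := ⟨⟨Δ', h₃⟩, rfl⟩
      have := h Δ'' ⟨(2 * ·), h₁⟩ (canonicalMk _ 1)
      rw [canonical_cons, ih] at this
      exact h₄ this
    · intro h Δ' f x
      obtain ⟨t, rfl⟩ := canonicalMk_surjective _ x
      rw [canonical_cons, ih, ← inst_ren_up]
      have h1 := f.2 _ h
      simp only [ren, ren_ren, ← up_comp] at h1
      exact Δ'.2.closed ((SPrv.of_mem h1).one (.allE t (.hyp (by simp))))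

/-- Completeness of Kripke semantics. -/
theorem prv_of_forces (hT : ∀ φ ∈ T, ∀ ρ, ren ρ φ ∈ T) {φ : Fml}
    (h : ∀ K : KModel, (∀ ψ ∈ T, ∀ (w : K.W) (e : ℕ → K.M w), Forces ψ w e) →
      ∀ (w : K.W) (e : ℕ → K.M w), Forces φ w e) : Prv T [] φ := by
  by_contra hn
  obtain ⟨Δ, -, hΔ, hφ⟩ := exists_saturated hT (Γ := ∅) (χ := φ)
    (fun N => ⟨N, le_rfl, by simp⟩) (by
      rintro ⟨L, hL, hp⟩
      have : L = [] := List.eq_nil_iff_forall_not_mem.2 fun x hx => (hL x hx).elim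
      subst this
      exact hn hp)
  have := h (canonicalModel T) (fun ψ hψ w e => by
    choose σ hσ using fun k => canonicalMk_surjective w (e k)
    obtain rfl : (fun k => canonicalMk w (σ k)) = e := funext hσ
    rw [canonical_truth hT]
    exact w.2.closed ⟨[], by simp, .ax (hT _ hψ _)⟩) ⟨Δ, hΔ⟩ (fun k => canonicalMk _ (id k))
  exact hφ (ren_id φ ▸ (canonical_truth hT φ ⟨Δ, hΔ⟩ id).1 this)

end Canonical

/-- Renaming an instance of a schema renames the parameters of its formula and gives another
instance. `h2` moves the renaming past the instantiation `env l d`, whose listed variables lie under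
the quantifiers and stay fixed. -/
theorem ren_mem_czf : ∀ φ ∈ CZF, ∀ ρ, ren ρ φ ∈ CZF := by
  have h1 : ∀ (ρ : ℕ → ℕ) d, (up^[d]) ρ ∘ (· + d) = (· + d) ∘ ρ := by
    intro ρ d
    induction d with
    | zero => rfl
    | succ d ih =>
      rw [Function.iterate_succ']
      funext k
      exact congrArg Nat.succ (congrFun ih k)
  have h2 : ∀ (ρ σ τ : ℕ → ℕ) (l : List ℕ) (d : ℕ), (up^[d]) ρ = σ → l.map σ = l →
      (up^[l.length]) ρ = τ → σ ∘ env l d = env l d ∘ τ := by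
    rintro ρ _ _ l d rfl hl rfl
    induction l with
    | nil => exact h1 ρ d
    | cons t l ih =>
      rw [List.length_cons, Function.iterate_succ']
      simp only [List.map_cons, List.cons.injEq] at hl
      funext k
      cases k with
      | zero => exact hl.1
      | succ k => exact congrFun (ih hl.2) k
  have bdd : ∀ {φ : Fml}, φ.IsBounded → ∀ ρ, (ren ρ φ).IsBounded := by
    intro φ h
    induction h with
    | mem x y => intro ρ; exact .mem _ _
    | eq x y => intro ρ; exact .eq _ _
    | bot => intro ρ; exact .bot
    | imp _ _ h₁ h₂ => intro ρ; exact .imp (h₁ ρ) (h₂ ρ)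
    | and _ _ h₁ h₂ => intro ρ; exact .and (h₁ ρ) (h₂ ρ)
    | or _ _ h₁ h₂ => intro ρ; exact .or (h₁ ρ) (h₂ ρ)
    | ball y _ h => intro ρ; exact .ball (ρ y) (h (up ρ))
    | bex y _ h => intro ρ; exact .bex (ρ y) (h (up ρ))
  intro φ h ρ
  cases h with
  | extensionality => exact .extensionality
  | pairing => exact .pairing
  | union => exact .union
  | infinity => exact .infinity
  | setInduction φ =>
    refine (congrArg IsCZF ?_).mpr (IsCZF.setInduction (ren (up ρ) φ))
    simp only [ren, ball, inst, ren_ren]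
    rw [h2 ρ (up (up ρ)) (up ρ) [0] 2 rfl rfl rfl, h2 ρ (up ρ) (up ρ) [0] 1 rfl rfl rfl]
    rfl
  | boundedSeparation φ hφ =>
    refine (congrArg IsCZF ?_).mpr (IsCZF.boundedSeparation (ren (up ρ) φ) (bdd hφ _))
    simp only [ren, iff, inst, ren_ren]
    rw [h2 ρ (up (up (up ρ))) (up ρ) [0] 3 rfl rfl rfl]
    rfl
  | strongCollection φ =>
    refine (congrArg IsCZF ?_).mpr (IsCZF.strongCollection (ren (up (up ρ)) φ))
    simp only [ren, ball, bex, inst, ren_ren]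
    rw [h2 ρ (up (up (up ρ))) (up (up ρ)) [1, 0] 3 rfl rfl rfl,
      h2 ρ (up (up (up (up ρ)))) (up (up ρ)) [1, 0] 4 rfl rfl rfl,
      h2 ρ (up (up (up (up ρ)))) (up (up ρ)) [0, 1] 4 rfl rfl rfl]
    rfl
  | subsetCollection φ =>
    refine (congrArg IsCZF ?_).mpr (IsCZF.subsetCollection (ren (up (up (up ρ))) φ))
    simp only [ren, ball, bex, inst, ren_ren]
    rw [h2 ρ (up (up (up (up (up (up ρ)))))) (up (up (up ρ))) [1, 0, 2] 6 rfl rfl rfl,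
      h2 ρ (up (up (up (up (up (up (up ρ))))))) (up (up (up ρ))) [1, 0, 3] 7 rfl rfl rfl,
      h2 ρ (up (up (up (up (up (up (up ρ))))))) (up (up (up ρ))) [0, 1, 3] 7 rfl rfl rfl]
    rfl

end CST

/-! ### CZF inside a Kripke model -/

namespace CST

open Fml

namespace KModel

variable {K : KModel} {w v u : K.W}

attribute [simp] res_id res_comp idn_comp comp_idn comp_assoc

@[simp] theorem cons_zero {α : Type} (x : α) (e : ℕ → α) : (x ⦂ e) 0 = x := rfl

@[simp] theorem cons_succ {α : Type} (x : α) (e : ℕ → α) (k : ℕ) : (x ⦂ e) (k + 1) = e k := rfl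

@[simp] theorem cons_res (x : K.M w) (e : ℕ → K.M w) (f : K.Hom w v) :
    (fun k => (x ⦂ e) k ⇡ f) = x ⇡ f ⦂ fun k => e k ⇡ f := by
  funext k; cases k <;> rfl

theorem mem_res' {x y : K.M w} (h : x ∈ y) (f : K.Hom w v) : x ⇡ f ∈ y ⇡ f := K.mem_res f h

theorem forces_res (φ : Fml) : ∀ {w v : K.W} {e : ℕ → K.M w} (f : K.Hom w v),
    Forces φ w e → Forces φ v fun k => e k ⇡ f := by
  induction φ with
  | mem x y => intro w v e f h; exact mem_res' h f
  | eq x y => intro w v e f h; exact congrArg (· ⇡ f) h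
  | bot => intro w v e f h; exact h
  | and φ ψ ih₁ ih₂ => intro w v e f h; exact ⟨ih₁ f h.1, ih₂ f h.2⟩
  | or φ ψ ih₁ ih₂ => intro w v e f h; exact h.imp (ih₁ f) (ih₂ f)
  | imp φ ψ ih₁ ih₂ =>
    intro w v e f h u g
    simp only [res_comp]
    exact h u (K.comp f g)
  | all φ ih =>
    intro w v e f h u g
    simp only [res_comp]
    exact h u (K.comp f g)
  | ex φ ih =>
    rintro w v e f ⟨x, h⟩
    exact ⟨x ⇡ f, by simpa using ih f h⟩

theorem forces_ren (φ : Fml) : ∀ (ρ : ℕ → ℕ) {w : K.W} (e : ℕ → K.M w),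
    Forces (ren ρ φ) w e ↔ Forces φ w (e ∘ ρ) := by
  have key : ∀ (ρ : ℕ → ℕ) {w : K.W} (x : K.M w) (e : ℕ → K.M w),
      (x ⦂ e) ∘ up ρ = x ⦂ (e ∘ ρ) := by
    intro ρ w x e; funext k; cases k <;> rfl
  induction φ with
  | mem x y | eq x y | bot => intro ρ w e; rfl
  | and φ ψ ih₁ ih₂ | or φ ψ ih₁ ih₂ =>
    intro ρ w e; simp only [ren, Forces, ih₁, ih₂]
  | imp φ ψ ih₁ ih₂ => intro ρ w e; simp only [ren, Forces, ih₁, ih₂]; rfl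
  | all φ ih => intro ρ w e; simp only [ren, Forces, ih, key]; rfl
  | ex φ ih => intro ρ w e; simp only [ren, Forces, ih, key]

section Simp

variable {φ ψ χ : Fml} {e : ℕ → K.M w}

@[simp] theorem forces_mem {x y : ℕ} : Forces (x ∈ₛ y) w e ↔ e x ∈ e y := Iff.rfl

@[simp] theorem forces_eq {x y : ℕ} : Forces (x =ₛ y) w e ↔ e x = e y := Iff.rfl

@[simp] theorem forces_bot : Forces bot w e ↔ False := Iff.rfl

@[simp] theorem forces_and : Forces (φ ∧ₛ ψ) w e ↔ Forces φ w e ∧ Forces ψ w e := Iff.rfl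

@[simp] theorem forces_or : Forces (φ ∨ₛ ψ) w e ↔ Forces φ w e ∨ Forces ψ w e := Iff.rfl

@[simp] theorem forces_ex : Forces (∃ₛ φ) w e ↔ ∃ x, Forces φ w (x ⦂ e) := Iff.rfl

theorem forces_imp : Forces (φ →ₛ ψ) w e ↔ ∀ v (f : K.Hom w v),
    Forces φ v (fun k => e k ⇡ f) → Forces ψ v (fun k => e k ⇡ f) := Iff.rfl

theorem forces_all : Forces (∀ₛ φ) w e ↔
    ∀ v (f : K.Hom w v) x, Forces φ v (x ⦂ fun k => e k ⇡ f) := Iff.rfl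

/-- The passages to a later world made by `∀` and by `→` compose into a single one. This keeps the
semantic form of nested formulas readable. -/
theorem forces_all_imp : Forces (∀ₛ (φ →ₛ ψ)) w e ↔ ∀ v (f : K.Hom w v) x,
    Forces φ v (x ⦂ fun k => e k ⇡ f) → Forces ψ v (x ⦂ fun k => e k ⇡ f) := by
  simp only [forces_all, forces_imp]
  constructor
  · intro h v f x; simpa using h v f x v (K.idn v)
  · intro h v f x u g; simpa using h u (K.comp f g) (x ⇡ g)

theorem forces_all_iff : Forces (∀ₛ (φ ↔ₛ ψ)) w e ↔ ∀ v (f : K.Hom w v) x,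
    (Forces φ v (x ⦂ fun k => e k ⇡ f) ↔ Forces ψ v (x ⦂ fun k => e k ⇡ f)) := by
  have : Forces (∀ₛ (φ ↔ₛ ψ)) w e ↔ Forces (∀ₛ (φ →ₛ ψ)) w e ∧ Forces (∀ₛ (ψ →ₛ φ)) w e :=
    ⟨fun h => ⟨fun v f x => (h v f x).1, fun v f x => (h v f x).2⟩,
      fun h v f x => ⟨h.1 v f x, h.2 v f x⟩⟩
  rw [this, forces_all_imp, forces_all_imp]
  exact ⟨fun h v f x => ⟨h.1 v f x, h.2 v f x⟩,
      fun h => ⟨fun v f x => (h v f x).1, fun v f x => (h v f x).2⟩⟩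

theorem forces_ball {y : ℕ} : Forces (ball y φ) w e ↔ ∀ v (f : K.Hom w v) x,
    x ∈ e y ⇡ f → Forces φ v (x ⦂ fun k => e k ⇡ f) := forces_all_imp

@[simp] theorem forces_bex {y : ℕ} : Forces (bex y φ) w e ↔ ∃ x ∈ e y, Forces φ w (x ⦂ e) :=
  Iff.rfl

end Simp

section Bounded

variable {φ ψ : Fml}

@[simp] theorem isBounded_mem {x y : ℕ} : (x ∈ₛ y).IsBounded := .mem x y

@[simp] theorem isBounded_eq {x y : ℕ} : (x =ₛ y).IsBounded := .eq x y

@[simp] theorem isBounded_and : (φ ∧ₛ ψ).IsBounded ↔ φ.IsBounded ∧ ψ.IsBounded :=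
  ⟨fun h => by cases h with | and h₁ h₂ => exact ⟨h₁, h₂⟩, fun h => .and h.1 h.2⟩

@[simp] theorem isBounded_or : (φ ∨ₛ ψ).IsBounded ↔ φ.IsBounded ∧ ψ.IsBounded :=
  ⟨fun h => by cases h with | or h₁ h₂ => exact ⟨h₁, h₂⟩, fun h => .or h.1 h.2⟩

@[simp] theorem isBounded_imp : (φ →ₛ ψ).IsBounded ↔ φ.IsBounded ∧ ψ.IsBounded :=
  ⟨fun h => by cases h with | imp h₁ h₂ => exact ⟨h₁, h₂⟩, fun h => .imp h.1 h.2⟩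

@[simp] theorem isBounded_ball {y : ℕ} : (ball y φ).IsBounded ↔ φ.IsBounded :=
  ⟨fun h => by cases h with | ball _ h => exact h, .ball y⟩

@[simp] theorem isBounded_bex {y : ℕ} : (bex y φ).IsBounded ↔ φ.IsBounded :=
  ⟨fun h => by cases h with | bex _ h => exact h, .bex y⟩

end Bounded

/-- The assignment that is used where no further parameters are needed. -/
def nil (w : K.W) : ℕ → K.M w := fun _ => K.pt w

end KModel

open KModel

/-- A Kripke model that forces all axioms of `CZF`. -/
class CZFModel (K : KModel) : Prop where
  forces : ∀ φ ∈ CZF, ∀ (w : K.W) (e : ℕ → K.M w), Forces φ w e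

variable {K : KModel} [CZFModel K] {w v u : K.W}

theorem ext {a b : K.M w} (h : ∀ v (f : K.Hom w v) x, x ∈ a ⇡ f ↔ x ∈ b ⇡ f) : a = b := by
  have h1 := CZFModel.forces _ IsCZF.extensionality w (nil w) w (K.idn w) a w (K.idn w) b w (K.idn w)
  simpa using h1 (by rw [forces_all_iff]; simpa using h)

theorem separation (φ : Fml) (hφ : φ.IsBounded) (e : ℕ → K.M w) (a : K.M w) :
    ∃ c, ∀ v (f : K.Hom w v) x, x ∈ c ⇡ f ↔ x ∈ a ⇡ f ∧ Forces φ v (x ⦂ fun k => e k ⇡ f) := by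
  obtain ⟨c, h⟩ := CZFModel.forces _ (IsCZF.boundedSeparation φ hφ) w e w (K.idn w) a
  refine ⟨c, fun v f x => ?_⟩
  have := (forces_all_iff.1 h) v f x
  simp only [cons_res, res_id, forces_mem, cons_zero, cons_succ, forces_and, inst,
    forces_ren] at this
  rw [this, show (x ⦂ c ⇡ f ⦂ a ⇡ f ⦂ fun k => e k ⇡ f) ∘ env [0] 3 = x ⦂ fun k => e k ⇡ f by
    funext k; cases k <;> rfl]

theorem collection (φ : Fml) (e : ℕ → K.M w) (a : K.M w)
    (h : ∀ v (f : K.Hom w v) x, x ∈ a ⇡ f → ∃ y, Forces φ v (x ⦂ y ⦂ fun k => e k ⇡ f)) :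
    ∃ b, (∀ v (f : K.Hom w v) x, x ∈ a ⇡ f →
        ∃ y ∈ b ⇡ f, Forces φ v (x ⦂ y ⦂ fun k => e k ⇡ f)) ∧
      (∀ v (f : K.Hom w v) y, y ∈ b ⇡ f →
        ∃ x ∈ a ⇡ f, Forces φ v (x ⦂ y ⦂ fun k => e k ⇡ f)) := by
  have e1 : ∀ {v : K.W} (x y z : K.M v) (e : ℕ → K.M v),
      (y ⦂ x ⦂ z ⦂ e) ∘ env [1, 0] 3 = x ⦂ y ⦂ e := by
    intro v x y z e; funext k; rcases k with _ | _ | k <;> rfl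
  have e2 : ∀ {v : K.W} (x y z z' : K.M v) (e : ℕ → K.M v),
      (y ⦂ x ⦂ z ⦂ z' ⦂ e) ∘ env [1, 0] 4 = x ⦂ y ⦂ e := by
    intro v x y z z' e; funext k; rcases k with _ | _ | k <;> rfl
  have e3 : ∀ {v : K.W} (x y z z' : K.M v) (e : ℕ → K.M v),
      (x ⦂ y ⦂ z ⦂ z' ⦂ e) ∘ env [0, 1] 4 = x ⦂ y ⦂ e := by
    intro v x y z z' e; funext k; rcases k with _ | _ | k <;> rfl
  obtain ⟨b, h1, h2⟩ := (forces_all_imp.1 (CZFModel.forces _ (IsCZF.strongCollection φ) w e))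
    w (K.idn w) a (by
      rw [forces_ball]
      simpa [inst, forces_ren, e1] using h)
  rw [forces_ball] at h1 h2
  simp [inst, forces_ren, e2, e3] at h1 h2
  exact ⟨b, h1, h2⟩

theorem subset_collection (φ : Fml) (e : ℕ → K.M w) (a b : K.M w) :
    ∃ c : K.M w, ∀ v (f : K.Hom w v) s,
      (∀ u (g : K.Hom v u) x, x ∈ a ⇡ f ⇡ g →
        ∃ y ∈ b ⇡ f ⇡ g, Forces φ u (x ⦂ y ⦂ s ⇡ g ⦂ fun k => e k ⇡ f ⇡ g)) →
      ∃ d ∈ c ⇡ f, (∀ u (g : K.Hom v u) x, x ∈ a ⇡ f ⇡ g →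
          ∃ y ∈ d ⇡ g, Forces φ u (x ⦂ y ⦂ s ⇡ g ⦂ fun k => e k ⇡ f ⇡ g)) ∧
        (∀ u (g : K.Hom v u) y, y ∈ d ⇡ g →
          ∃ x ∈ a ⇡ f ⇡ g, Forces φ u (x ⦂ y ⦂ s ⇡ g ⦂ fun k => e k ⇡ f ⇡ g)) := by
  have e1 : ∀ {v : K.W} (x y s a b c : K.M v) (e : ℕ → K.M v),
      (y ⦂ x ⦂ s ⦂ c ⦂ b ⦂ a ⦂ e) ∘ env [1, 0, 2] 6 = x ⦂ y ⦂ s ⦂ e := by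
    intro v x y s a b c e; funext k; rcases k with _ | _ | _ | k <;> rfl
  have e2 : ∀ {v : K.W} (x y d s a b c : K.M v) (e : ℕ → K.M v),
      (y ⦂ x ⦂ d ⦂ s ⦂ c ⦂ b ⦂ a ⦂ e) ∘ env [1, 0, 3] 7 = x ⦂ y ⦂ s ⦂ e := by
    intro v x y d s a b c e; funext k; rcases k with _ | _ | _ | k <;> rfl
  have e3 : ∀ {v : K.W} (x y d s a b c : K.M v) (e : ℕ → K.M v),
      (x ⦂ y ⦂ d ⦂ s ⦂ c ⦂ b ⦂ a ⦂ e) ∘ env [0, 1, 3] 7 = x ⦂ y ⦂ s ⦂ e := by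
    intro v x y d s a b c e; funext k; rcases k with _ | _ | _ | k <;> rfl
  obtain ⟨c, hc⟩ := CZFModel.forces _ (IsCZF.subsetCollection φ) w e w (K.idn w) a w (K.idn w) b
  refine ⟨c, fun v f s h => ?_⟩
  obtain ⟨d, hd, h1, h2⟩ := forces_all_imp.1 hc v f s (by
    rw [forces_ball]
    simpa [inst, forces_ren, e1] using h)
  rw [forces_ball] at h1 h2
  simp [inst, forces_ren, e2, e3] at h1 h2 hd
  exact ⟨d, hd, by simpa using h1, by simpa using h2⟩

/-- Here and below, `P` is a predicate of the metalanguage, and `hP` certifies that `φ`, with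
parameters from `e`, defines it at all later worlds. -/
theorem set_induction {P : ∀ v, K.Hom w v → K.M v → Prop} (φ : Fml) (e : ℕ → K.M w)
    (hP : ∀ v f x, Forces φ v (x ⦂ fun k => e k ⇡ f) ↔ P v f x)
    (h : ∀ v f a, (∀ u (g : K.Hom v u) x, x ∈ a ⇡ g → P u (K.comp f g) x) → P v f a)
    (a : K.M w) : P w (K.idn w) a := by
  have e1 : ∀ {v : K.W} (x y : K.M v) (e : ℕ → K.M v),
      (x ⦂ y ⦂ e) ∘ env [0] 2 = x ⦂ e := by
    intro v x y e; funext k; rcases k with _ | k <;> rfl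
  have e2 : ∀ {v : K.W} (x : K.M v) (e : ℕ → K.M v),
      (x ⦂ e) ∘ env [0] 1 = x ⦂ e := by
    intro v x e; funext k; rcases k with _ | k <;> rfl
  have h1 := CZFModel.forces _ (IsCZF.setInduction φ) w e w (K.idn w)
  have h2 := h1 (by
    rw [forces_all_imp]
    intro v f x hx
    rw [forces_ball] at hx
    simp only [inst, forces_ren, e1, e2, cons_res, res_id, hP, res_comp, cons_zero] at hx ⊢
    exact h v f x hx)
  have h3 := h2 w (K.idn w) a
  rw [inst, forces_ren, e2] at h3
  exact (hP _ _ _).1 (by simpa using h3)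

/-! ### Pairs and unions -/

theorem exists_upair (a b : K.M w) :
    ∃ c, ∀ v (f : K.Hom w v) x, x ∈ c ⇡ f ↔ x = a ⇡ f ∨ x = b ⇡ f := by
  obtain ⟨c, h⟩ := CZFModel.forces _ IsCZF.pairing w (nil w) w (K.idn w) a w (K.idn w) b
  exact ⟨c, by simpa using forces_all_iff.1 h⟩

/-- The unordered pair. -/
noncomputable def upair (a b : K.M w) : K.M w := Classical.choose (exists_upair a b)

-- The set is chosen anew at each world. Extensionality makes the choice unique, hence compatible
-- with restriction; the same holds for the other operations below.
@[simp] theorem res_upair (a b : K.M w) (f : K.Hom w v) :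
    (upair a b) ⇡ f = upair (a ⇡ f) (b ⇡ f) := ext fun u g x => by
  have h1 := Classical.choose_spec (exists_upair a b) u (K.comp f g) x
  have h2 := Classical.choose_spec (exists_upair (a ⇡ f) (b ⇡ f)) u g x
  rw [res_comp, upair, upair, h1, h2]; simp

@[simp] theorem mem_upair {a b x : K.M w} : x ∈ upair a b ↔ x = a ∨ x = b := by
  simpa [upair] using Classical.choose_spec (exists_upair a b) w (K.idn w) x

theorem exists_sUnion (a : K.M w) :
    ∃ c, ∀ v (f : K.Hom w v) x, x ∈ c ⇡ f ↔ ∃ y ∈ a ⇡ f, x ∈ y := by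
  obtain ⟨c, h⟩ := CZFModel.forces _ IsCZF.union w (nil w) w (K.idn w) a
  exact ⟨c, by simpa using forces_all_iff.1 h⟩

/-- The union of a set. -/
noncomputable def sUnion (a : K.M w) : K.M w := Classical.choose (exists_sUnion a)

@[simp] theorem res_sUnion (a : K.M w) (f : K.Hom w v) :
    (sUnion a) ⇡ f = sUnion (a ⇡ f) := ext fun u g x => by
  have h1 := Classical.choose_spec (exists_sUnion a) u (K.comp f g) x
  have h2 := Classical.choose_spec (exists_sUnion (a ⇡ f)) u g x
  rw [res_comp, sUnion, sUnion, h1, h2]; simp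

@[simp] theorem mem_sUnion {a x : K.M w} : x ∈ sUnion a ↔ ∃ y ∈ a, x ∈ y := by
  simpa [sUnion] using Classical.choose_spec (exists_sUnion a) w (K.idn w) x

/-- The union of two sets. -/
noncomputable def cup (a b : K.M w) : K.M w := sUnion (upair a b)

@[simp] theorem res_cup (a b : K.M w) (f : K.Hom w v) : (cup a b) ⇡ f = cup (a ⇡ f) (b ⇡ f) := by
  simp [cup]

@[simp] theorem mem_cup {a b x : K.M w} : x ∈ cup a b ↔ x ∈ a ∨ x ∈ b := by
  simp [cup]

/-- The singleton. -/
noncomputable def sing (a : K.M w) : K.M w := upair a a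

@[simp] theorem res_sing (a : K.M w) (f : K.Hom w v) : (sing a) ⇡ f = sing (a ⇡ f) := by
  simp [sing]

@[simp] theorem mem_sing {a x : K.M w} : x ∈ sing a ↔ x = a := by simp [sing]

theorem exists_emp (w : K.W) : ∃ c : K.M w, ∀ v (f : K.Hom w v) x, ¬ x ∈ c ⇡ f := by
  obtain ⟨c, hc⟩ := separation bot .bot (nil w) (K.pt w)
  exact ⟨c, by simpa using hc⟩

/-- The empty set. -/
noncomputable def emp (w : K.W) : K.M w := Classical.choose (exists_emp w)

@[simp] theorem not_mem_emp {x : K.M w} : ¬ x ∈ emp w := by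
  simpa [emp] using Classical.choose_spec (exists_emp w) w (K.idn w) x

@[simp] theorem res_emp (f : K.Hom w v) : (emp w) ⇡ f = emp v := ext fun u g x => by
  have h1 := Classical.choose_spec (exists_emp w) u (K.comp f g) x
  have h2 := Classical.choose_spec (exists_emp v) u g x
  rw [res_comp, emp, emp]; tauto

theorem eq_emp {a : K.M w} (h : ∀ v (f : K.Hom w v) x, ¬ x ∈ a ⇡ f) : a = emp w :=
  ext fun v f x => by simpa using h v f x

/-- The successor `a ∪ {a}`. -/
noncomputable def succ (a : K.M w) : K.M w := cup a (sing a)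

@[simp] theorem res_succ (a : K.M w) (f : K.Hom w v) : (succ a) ⇡ f = succ (a ⇡ f) := by
  simp [succ]

@[simp] theorem mem_succ {a x : K.M w} : x ∈ succ a ↔ x ∈ a ∨ x = a := by simp [succ]

theorem upair_eq_sing {a b c : K.M w} : upair a b = sing c ↔ a = c ∧ b = c := by
  constructor
  · intro h
    exact ⟨mem_sing.1 (h ▸ mem_upair.2 (Or.inl rfl)), mem_sing.1 (h ▸ mem_upair.2 (Or.inr rfl))⟩
  · rintro ⟨rfl, rfl⟩; rfl

theorem sing_inj {a b : K.M w} : sing a = sing b ↔ a = b := by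
  conv_lhs => rw [sing, upair_eq_sing, and_self]

/-- The ordered pair. -/
noncomputable def opair (a b : K.M w) : K.M w := upair (sing a) (upair a b)

notation "⟪" a ", " b "⟫" => opair a b

@[simp] theorem res_opair (a b : K.M w) (f : K.Hom w v) : ⟪a, b⟫ ⇡ f = ⟪a ⇡ f, b ⇡ f⟫ := by
  simp [opair]

@[simp] theorem opair_inj {a b c d : K.M w} : ⟪a, b⟫ = ⟪c, d⟫ ↔ a = c ∧ b = d := by
  constructor
  · intro h
    have hac : a = c := by
      have h1 : sing a ∈ ⟪c, d⟫ := h ▸ mem_upair.2 (Or.inl rfl)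
      rcases mem_upair.1 h1 with h1 | h1
      · exact sing_inj.1 h1
      · exact (upair_eq_sing.1 h1.symm).1.symm
    subst hac
    refine ⟨rfl, ?_⟩
    have h1 : upair a b ∈ ⟪a, d⟫ := h ▸ mem_upair.2 (Or.inr rfl)
    have h2 : upair a d ∈ ⟪a, b⟫ := h.symm ▸ mem_upair.2 (Or.inr rfl)
    have h3 : b = a ∨ b = d := by
      rcases mem_upair.1 h1 with h1 | h1
      · exact Or.inl (upair_eq_sing.1 h1).2
      · exact mem_upair.1 (h1 ▸ mem_upair.2 (Or.inr rfl))
    have h4 : d = a ∨ d = b := by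
      rcases mem_upair.1 h2 with h1 | h1
      · exact Or.inl (upair_eq_sing.1 h1).2
      · exact mem_upair.1 (h1 ▸ mem_upair.2 (Or.inr rfl))
    grind
  · rintro ⟨rfl, rfl⟩; rfl

section FormulaSemantics

variable {e : ℕ → K.M w}

@[simp] theorem forces_isEmpty {x : ℕ} : Forces (isEmpty x) w e ↔ e x = emp w := by
  rw [isEmpty, forces_ball]
  exact ⟨fun h => eq_emp h, fun h v f y hy => by simp [h] at hy⟩

/-- Turns a definition "`c` is the set of all `x` such that ..." into an equation with the
corresponding operation. -/
theorem eq_iff_of_mem_iff {c d : K.M w} {P : ∀ v, K.Hom w v → K.M v → Prop}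
    (h : ∀ v (f : K.Hom w v) x, x ∈ d ⇡ f ↔ P v f x) :
    c = d ↔ ∀ v (f : K.Hom w v) x, x ∈ c ⇡ f ↔ P v f x :=
  ⟨fun e => e ▸ h, fun h' => ext fun v f x => by rw [h, h']⟩

@[simp] theorem forces_isSucc {x y : ℕ} : Forces (isSucc x y) w e ↔ e x = succ (e y) := by
  rw [isSucc, forces_all_iff, eq_iff_of_mem_iff (P := fun v f z => z ∈ e y ⇡ f ∨ z = e y ⇡ f)]
  · rfl
  · simp

@[simp] theorem forces_isUpair {z x y : ℕ} :
    Forces (isUpair z x y) w e ↔ e z = upair (e x) (e y) := by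
  rw [isUpair, forces_all_iff, eq_iff_of_mem_iff (P := fun v f z => z = e x ⇡ f ∨ z = e y ⇡ f)]
  · rfl
  · simp

@[simp] theorem forces_isPair {z x y : ℕ} :
    Forces (isPair z x y) w e ↔ e z = ⟪e x, e y⟫ := by
  rw [isPair, forces_all_iff, eq_iff_of_mem_iff
    (P := fun v f z => z = sing (e x ⇡ f) ∨ z = upair (e x ⇡ f) (e y ⇡ f))]
  · simp [sing]
  · simp [opair]

@[simp] theorem forces_pairMem {z x y : ℕ} :
    Forces (pairMem x y z) w e ↔ ⟪e x, e y⟫ ∈ e z := by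
  simp [pairMem]

/-- A bounded form of `isUpair`. -/
def bUpair (z x y : ℕ) : Fml := x ∈ₛ z ∧ₛ y ∈ₛ z ∧ₛ ball z (0 =ₛ x + 1 ∨ₛ 0 =ₛ y + 1)

@[simp] theorem isBounded_bUpair {z x y : ℕ} : (bUpair z x y).IsBounded := by simp [bUpair]

-- The official formulas for pairs and functions contain unbounded quantifiers. Separation needs
-- bounded equivalents, which are supplied from here on.
@[simp] theorem forces_bUpair {z x y : ℕ} :
    Forces (bUpair z x y) w e ↔ e z = upair (e x) (e y) := by
  simp only [bUpair, forces_and, forces_ball, forces_mem, forces_or, forces_eq, cons_zero,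
    cons_succ]
  constructor
  · rintro ⟨h1, h2, h3⟩
    refine ext fun v f a => ⟨fun h => by simpa using h3 v f a h, ?_⟩
    simp only [res_upair, mem_upair]
    rintro (rfl | rfl)
    · exact mem_res' h1 f
    · exact mem_res' h2 f
  · intro h; simp [h]

/-- A bounded form of `isPair`. -/
def bPair (z x y : ℕ) : Fml :=
  bex z (bUpair 0 (x + 1) (x + 1)) ∧ₛ bex z (bUpair 0 (x + 1) (y + 1)) ∧ₛ
    ball z (bUpair 0 (x + 1) (x + 1) ∨ₛ bUpair 0 (x + 1) (y + 1))

@[simp] theorem isBounded_bPair {z x y : ℕ} : (bPair z x y).IsBounded := by simp [bPair]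

@[simp] theorem forces_bPair {z x y : ℕ} :
    Forces (bPair z x y) w e ↔ e z = ⟪e x, e y⟫ := by
  simp only [bPair, forces_and, forces_ball, forces_bex, forces_or, cons_zero,
    cons_succ, forces_bUpair, exists_eq_right]
  constructor
  · rintro ⟨h1, h2, h3⟩
    refine ext fun v f a => ⟨fun h => by simpa [opair, sing] using h3 v f a h, ?_⟩
    simp only [opair, sing, res_upair, mem_upair]
    rintro (rfl | rfl)
    · simpa using mem_res' h1 f
    · simpa using mem_res' h2 f
  · intro h; simp [h, opair, sing]

/-- A bounded form of `pairMem`. -/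
def bPairMem (x y z : ℕ) : Fml := bex z (bPair 0 (x + 1) (y + 1))

@[simp] theorem isBounded_bPairMem {z x y : ℕ} : (bPairMem x y z).IsBounded := by simp [bPairMem]

@[simp] theorem forces_bPairMem {z x y : ℕ} :
    Forces (bPairMem x y z) w e ↔ ⟪e x, e y⟫ ∈ e z := by
  simp [bPairMem]

end FormulaSemantics

/-- The union of a family of definable sets. -/
theorem union_image {P : ∀ v, K.Hom w v → K.M v → K.M v → Prop} (φ : Fml) (e : ℕ → K.M w)
    (a : K.M w) (hP : ∀ v f y z, Forces φ v (z ⦂ y ⦂ fun k => e k ⇡ f) ↔ P v f y z)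
    (h : ∀ v f y, y ∈ a ⇡ f → ∃ S, ∀ u (g : K.Hom v u) z, z ∈ S ⇡ g ↔ P u (K.comp f g) (y ⇡ g) z) :
    ∃ c, ∀ v f z, z ∈ c ⇡ f ↔ ∃ y ∈ a ⇡ f, P v f y z := by
  let ρ : ℕ → ℕ := fun k => match k with
    | 0 => 0
    | 1 => 1
    | k + 2 => k + 3
  have e1 : ∀ {v : K.W} (x y s : K.M v) (e : ℕ → K.M v),
      (x ⦂ y ⦂ s ⦂ e) ∘ ρ = x ⦂ y ⦂ e := by
    intro v x y s e; funext k; rcases k with _ | _ | k <;> rfl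
  have key : ∀ v (f : K.Hom w v) y S,
      Forces (∀ₛ (0 ∈ₛ 2 ↔ₛ ren ρ φ)) v (y ⦂ S ⦂ fun k => e k ⇡ f) ↔
        ∀ u (g : K.Hom v u) z, z ∈ S ⇡ g ↔ P u (K.comp f g) (y ⇡ g) z := by
    intro v f y S
    rw [forces_all_iff]
    simp [forces_ren, e1, hP]
  -- Collection is applied to "`S` is the set of all `z` with `P y z`". The second half of Strong
  -- Collection ensures that `b` has no other members, so its union is exact.
  obtain ⟨b, h1, h2⟩ := collection _ e a fun v f y hy => by
    obtain ⟨S, hS⟩ := h v f y hy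
    exact ⟨S, (key v f y S).2 hS⟩
  simp only [key] at h1 h2
  refine ⟨sUnion b, fun v f z => ?_⟩
  simp only [res_sUnion, mem_sUnion]
  constructor
  · rintro ⟨S, hS, hz⟩
    obtain ⟨y, hy, h⟩ := h2 v f S hS
    have := (h v (K.idn v) z).1 (by simpa using hz)
    refine ⟨y, hy, ?_⟩
    rw [← hP] at this ⊢
    simpa [← res_comp] using this
  · rintro ⟨y, hy, hz⟩
    obtain ⟨S, hS, h⟩ := h1 v f y hy
    have := (h v (K.idn v) z).2 (by
      rw [← hP] at hz ⊢
      simpa [← res_comp] using hz)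
    exact ⟨S, hS, by simpa using this⟩

/-- The image of a set under a definable function. -/
theorem image {P : ∀ v, K.Hom w v → K.M v → K.M v → Prop} (φ : Fml) (e : ℕ → K.M w)
    (a : K.M w) (hP : ∀ v f y z, Forces φ v (z ⦂ y ⦂ fun k => e k ⇡ f) ↔ P v f y z)
    (h : ∀ v f y, y ∈ a ⇡ f → ∃ x, P v f y x)
    (h' : ∀ v f y, y ∈ a ⇡ f → ∀ x x', P v f y x → P v f y x' → x = x') :
    ∃ c, ∀ v f z, z ∈ c ⇡ f ↔ ∃ y ∈ a ⇡ f, P v f y z := by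
  refine union_image φ e a hP fun v f y hy => ?_
  obtain ⟨x, hx⟩ := h v f y hy
  refine ⟨sing x, fun u g z => ?_⟩
  have hxg : P u (K.comp f g) (y ⇡ g) (x ⇡ g) := by
    rw [← hP] at hx ⊢
    simpa using forces_res _ g hx
  simp only [res_sing, mem_sing]
  constructor
  · rintro rfl; exact hxg
  · intro hz
    exact h' u _ _ (by simpa using mem_res' hy g) _ _ hz hxg

end CST

namespace CST

open Fml KModel

variable {K : KModel} [CZFModel K] {w v u : K.W}

/-! ### Functions -/

/-- The relation `g` is a function from `D` to `E`. -/
structure IsFun (g D E : K.M w) : Prop where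
  pairs : ∀ v (f : K.Hom w v) p, p ∈ g ⇡ f → ∃ d ∈ D ⇡ f, ∃ y ∈ E ⇡ f, p = ⟪d, y⟫
  total : ∀ v (f : K.Hom w v) d, d ∈ D ⇡ f → ∃ y, ⟪d, y⟫ ∈ g ⇡ f
  unique : ∀ v (f : K.Hom w v) d y y', ⟪d, y⟫ ∈ g ⇡ f → ⟪d, y'⟫ ∈ g ⇡ f → y = y'

namespace IsFun

variable {g D E : K.M w}

theorem res (h : IsFun g D E) (f : K.Hom w v) : IsFun (g ⇡ f) (D ⇡ f) (E ⇡ f) := by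
  refine ⟨fun u k => ?_, fun u k => ?_, fun u k => ?_⟩ <;> simp only [res_comp]
  · exact h.pairs u _
  · exact h.total u _
  · exact h.unique u _

theorem exists_eq {p : K.M w} (h : IsFun g D E) (hp : p ∈ g) :
    ∃ d ∈ D, ∃ y ∈ E, p = ⟪d, y⟫ := by simpa using h.pairs w (K.idn w) p (by simpa using hp)

theorem mem_dom {x y : K.M w} (h : IsFun g D E) (hp : ⟪x, y⟫ ∈ g) : x ∈ D := by
  obtain ⟨d, hd, y, hy, e⟩ := h.exists_eq hp
  rw [opair_inj] at e
  exact e.1 ▸ hd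

theorem mem_cod {x y : K.M w} (h : IsFun g D E) (hp : ⟪x, y⟫ ∈ g) : y ∈ E := by
  obtain ⟨d, hd, y, hy, e⟩ := h.exists_eq hp
  rw [opair_inj] at e
  exact e.2 ▸ hy

theorem exists_val {x : K.M w} (h : IsFun g D E) (hx : x ∈ D) : ∃ y ∈ E, ⟪x, y⟫ ∈ g := by
  obtain ⟨y, hy⟩ := h.total w (K.idn w) x (by simpa using hx)
  rw [res_id] at hy
  exact ⟨y, h.mem_cod hy, hy⟩

theorem eq {x y y' : K.M w} (h : IsFun g D E) (h₁ : ⟪x, y⟫ ∈ g) (h₂ : ⟪x, y'⟫ ∈ g) : y = y' :=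
  h.unique w (K.idn w) x y y' (by simpa using h₁) (by simpa using h₂)

theorem ext {g' E' : K.M w} (h : IsFun g D E) (h' : IsFun g' D E')
    (H : ∀ v (f : K.Hom w v) x y, ⟪x, y⟫ ∈ g ⇡ f → ⟪x, y⟫ ∈ g' ⇡ f) : g = g' := by
  refine CST.ext fun v f p => ⟨fun hp => ?_, fun hp => ?_⟩
  · obtain ⟨d, hd, y, hy, rfl⟩ := (h.res f).exists_eq hp
    exact H v f _ _ hp
  · obtain ⟨d, hd, y, hy, rfl⟩ := (h'.res f).exists_eq hp
    obtain ⟨y', -, hy'⟩ := (h.res f).exists_val hd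
    rwa [(h'.res f).eq hp (H v f _ _ hy')]

theorem mono {E' : K.M w} (h : IsFun g D E)
    (H : ∀ v (f : K.Hom w v) x y, ⟪x, y⟫ ∈ g ⇡ f → y ∈ E' ⇡ f) : IsFun g D E' := by
  refine ⟨fun v f p hp => ?_, h.total, h.unique⟩
  obtain ⟨d, hd, y, -, rfl⟩ := h.pairs v f p hp
  exact ⟨d, hd, y, H v f _ _ hp, rfl⟩

end IsFun

section FormulaSemantics

variable {e : ℕ → K.M w}

@[simp] theorem forces_isFun {g D E : ℕ} :
    Forces (isFun g D E) w e ↔ IsFun (e g) (e D) (e E) := by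
  simp only [isFun, forces_and, forces_ball, forces_bex, forces_ex, forces_isPair, forces_pairMem,
    forces_all_imp, cons_zero, cons_succ, forces_eq, cons_res, res_comp]
  constructor
  · rintro ⟨h₁, h₂⟩
    refine ⟨h₁, fun v f d hd => ?_, fun v f d y y' hy hy' => ?_⟩
    · obtain ⟨y, hy, -⟩ := h₂ v f d hd
      exact ⟨y, hy⟩
    · obtain ⟨d', hd', y'', -, e⟩ := h₁ v f _ hy
      rw [opair_inj] at e
      obtain ⟨rfl, rfl⟩ := e
      obtain ⟨y'', hy'', h⟩ := h₂ v f d hd'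
      have h1 := h v (K.idn v) y
      have h2 := h v (K.idn v) y'
      simp only [res_id] at h1 h2
      simp only [← res_comp, res_id] at h1 h2
      rw [h1 hy, h2 hy']
  · intro h
    refine ⟨h.pairs, fun v f d hd => ?_⟩
    obtain ⟨y, hy⟩ := h.total v f d hd
    refine ⟨y, hy, fun u g z hz => h.unique u (K.comp f g) (d ⇡ g) _ _ hz ?_⟩
    simpa using mem_res' hy g

/-- A bounded form of `isFun`. -/
def bFun (g D E : ℕ) : Fml :=
  ball g (bex (D + 1) (bex (E + 2) (bPair 2 1 0))) ∧ₛ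
  ball D (bex (E + 1) (bPairMem 1 0 (g + 2))) ∧ₛ
  ball D (ball (E + 1) (ball (E + 2)
    (bPairMem 2 1 (g + 3) →ₛ bPairMem 2 0 (g + 3) →ₛ 1 =ₛ 0)))

@[simp] theorem isBounded_bFun {g D E : ℕ} : (bFun g D E).IsBounded := by simp [bFun]

@[simp] theorem forces_bFun {g D E : ℕ} :
    Forces (bFun g D E) w e ↔ IsFun (e g) (e D) (e E) := by
  simp only [bFun, forces_and, forces_ball, forces_bex, forces_bPair, forces_bPairMem,
    forces_imp, cons_zero, cons_succ, forces_eq, cons_res, res_comp]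
  constructor
  · rintro ⟨h₁, h₂, h₃⟩
    refine ⟨h₁, fun v f d hd => ?_, fun v f d y y' hy hy' => ?_⟩
    · obtain ⟨y, -, hy⟩ := h₂ v f d hd
      exact ⟨y, hy⟩
    · obtain ⟨d', hd', y'', hy'', e⟩ := h₁ v f _ hy
      rw [opair_inj] at e
      obtain ⟨rfl, rfl⟩ := e
      obtain ⟨d', -, y'', hy''', e⟩ := h₁ v f _ hy'
      rw [opair_inj] at e
      obtain ⟨rfl, rfl⟩ := e
      have h := h₃ v f d hd' v (K.idn v) y (by simpa [← res_comp] using hy'') v (K.idn v) y'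
        (by simpa [← res_comp] using hy''') v (K.idn v) (by simpa [← res_comp] using hy)
        v (K.idn v)
      simp only [← res_comp, res_id] at h
      exact h hy'
  · intro h
    refine ⟨h.pairs, fun v f d hd => ?_, ?_⟩
    · obtain ⟨y, hy, h⟩ := (h.res f).exists_val hd
      exact ⟨y, hy, h⟩
    · intro v f d _ v1 f1 y _ v2 f2 y' _ v3 f3 hy v4 f4 hy'
      refine h.unique _ _ _ _ _ ?_ hy'
      simpa using mem_res' hy f4

end FormulaSemantics

/-- The graph arises as an image, through Collection and not Separation, so `φ` need not be bounded.
-/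
theorem exists_fun {P : ∀ v, K.Hom w v → K.M v → K.M v → Prop} (φ : Fml) (e : ℕ → K.M w)
    (D E : K.M w) (hP : ∀ v f x y, Forces φ v (y ⦂ x ⦂ fun k => e k ⇡ f) ↔ P v f x y)
    (h : ∀ v f x, x ∈ D ⇡ f → ∃ y ∈ E ⇡ f, P v f x y)
    (h' : ∀ v f x, x ∈ D ⇡ f → ∀ y y', P v f x y → P v f x y' → y = y') :
    ∃ g, IsFun g D E ∧ ∀ v f x y, ⟪x, y⟫ ∈ g ⇡ f ↔ x ∈ D ⇡ f ∧ P v f x y := by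
  let ρ : ℕ → ℕ := fun k => match k with
    | 0 => 0
    | 1 => 2
    | k + 2 => k + 3
  have e1 : ∀ {v : K.W} (y z x : K.M v) (e : ℕ → K.M v),
      (y ⦂ z ⦂ x ⦂ e) ∘ ρ = y ⦂ x ⦂ e := by
    intro v x y s e; funext k; rcases k with _ | _ | k <;> rfl
  obtain ⟨g, hg⟩ := image (P := fun v f x z => ∃ y, P v f x y ∧ z = ⟪x, y⟫)
    (∃ₛ (ren ρ φ ∧ₛ isPair 1 2 0)) e D (by intro v f x z; simp [forces_ren, e1, hP])
    (by
      intro v f x hx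
      obtain ⟨y, -, hy⟩ := h v f x hx
      exact ⟨_, y, hy, rfl⟩)
    (by
      rintro v f x hx _ _ ⟨y, hy, rfl⟩ ⟨y', hy', rfl⟩
      rw [h' v f x hx y y' hy hy'])
  have hg' : ∀ v f x y, ⟪x, y⟫ ∈ g ⇡ f ↔ x ∈ D ⇡ f ∧ P v f x y := by
    intro v f x y
    rw [hg]
    constructor
    · rintro ⟨x', hx, y', hy, e⟩
      rw [opair_inj] at e
      obtain ⟨rfl, rfl⟩ := e
      exact ⟨hx, hy⟩
    · rintro ⟨hx, hy⟩
      exact ⟨x, hx, y, hy, rfl⟩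
  refine ⟨g, ⟨?_, ?_, ?_⟩, hg'⟩
  · intro v f p hp
    obtain ⟨x, hx, y, hy, rfl⟩ := (hg v f p).1 hp
    obtain ⟨y', hy', h1⟩ := h v f x hx
    exact ⟨x, hx, y, h' v f x hx y y' hy h1 ▸ hy', rfl⟩
  · intro v f d hd
    obtain ⟨y, -, hy⟩ := h v f d hd
    exact ⟨y, (hg' v f d y).2 ⟨hd, hy⟩⟩
  · intro v f d y y' hy hy'
    rw [hg'] at hy hy'
    exact h' v f d hy.1 y y' hy.2 hy'.2

/-! ### Products and function sets -/

theorem exists_prod (D E : K.M w) : ∃ c, ∀ v (f : K.Hom w v) z,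
    z ∈ c ⇡ f ↔ ∃ x ∈ D ⇡ f, ∃ y ∈ E ⇡ f, z = ⟪x, y⟫ := by
  refine union_image (P := fun v f x z => ∃ y ∈ E ⇡ f, z = ⟪x, y⟫)
    (bex 2 (isPair 1 2 0)) (E ⦂ nil w) D (by intro v f x z; simp) fun v f x hx => ?_
  obtain ⟨c, hc⟩ := image (P := fun u g y z => z = ⟪x ⇡ g, y⟫)
    (isPair 0 2 1) (x ⦂ nil v) (E ⇡ f) (by intro v f x z; simp) (by simp)
    (by rintro v f y - _ _ rfl rfl; rfl)
  exact ⟨c, by simpa using hc⟩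

/-- The cartesian product. -/
noncomputable def prod (D E : K.M w) : K.M w := Classical.choose (exists_prod D E)

@[simp] theorem mem_prod {D E z : K.M w} : z ∈ prod D E ↔ ∃ x ∈ D, ∃ y ∈ E, z = ⟪x, y⟫ := by
  simpa [prod] using Classical.choose_spec (exists_prod D E) w (K.idn w) z

@[simp] theorem res_prod (D E : K.M w) (f : K.Hom w v) :
    (prod D E) ⇡ f = prod (D ⇡ f) (E ⇡ f) := ext fun u g x => by
  have h1 := Classical.choose_spec (exists_prod D E) u (K.comp f g) x
  have h2 := Classical.choose_spec (exists_prod (D ⇡ f) (E ⇡ f)) u g x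
  rw [res_comp, prod, prod, h1, h2]; simp

theorem opair_mem_prod {D E x y : K.M w} : ⟪x, y⟫ ∈ prod D E ↔ x ∈ D ∧ y ∈ E := by
  rw [mem_prod]
  constructor
  · rintro ⟨x', hx, y', hy, e⟩
    rw [opair_inj] at e
    obtain ⟨rfl, rfl⟩ := e
    exact ⟨hx, hy⟩
  · rintro ⟨hx, hy⟩
    exact ⟨x, hx, y, hy, rfl⟩

/-- Subset Collection is applied to `D`, `D × E` and the relation "`y ∈ g` and `y` is a pair with
first coordinate `x`", with `g` as the parameter `u`. For a function `g`, a set `d` that matches `D`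
under this relation can only be `g` itself, so the collecting set contains all functions. -/
theorem exists_exp (D E : K.M w) : ∃ c, ∀ v (f : K.Hom w v) g,
    g ∈ c ⇡ f ↔ IsFun g (D ⇡ f) (E ⇡ f) := by
  obtain ⟨c, hc⟩ := subset_collection (1 ∈ₛ 2 ∧ₛ ∃ₛ (isPair 2 1 0)) (nil w) D (prod D E)
  obtain ⟨c', hc'⟩ := separation (bFun 0 1 2) (by simp) (D ⦂ E ⦂ nil w) c
  refine ⟨c', fun v f g => ?_⟩
  simp only [hc', cons_res, forces_bFun, cons_zero, cons_succ]
  refine ⟨fun h => h.2, fun h => ⟨?_, h⟩⟩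
  obtain ⟨d, hd, h1, h2⟩ := hc v f g (by
    intro u k x hx
    obtain ⟨y, hy, hxy⟩ := (h.res k).exists_val hx
    refine ⟨⟪x, y⟫, ?_, ?_⟩
    · rw [res_prod, res_prod, opair_mem_prod]; exact ⟨hx, hy⟩
    · simpa using hxy)
  suffices g = d by rwa [this]
  refine ext fun u k p => ⟨fun hp => ?_, fun hp => ?_⟩
  · obtain ⟨x, hx, y, hy, rfl⟩ := (h.res k).exists_eq hp
    obtain ⟨y', hy', h3⟩ := h1 u k x hx
    simp only [forces_and, forces_mem, forces_ex, cons_zero, cons_succ, forces_isPair] at h3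
    obtain ⟨h3, y'', rfl⟩ := h3
    rwa [(h.res k).eq hp h3]
  · obtain ⟨x, -, h3⟩ := h2 u k p hp
    exact h3.1

/-- The set of functions from `D` to `E`. -/
noncomputable def exp (D E : K.M w) : K.M w := Classical.choose (exists_exp D E)

@[simp] theorem mem_exp {D E g : K.M w} : g ∈ exp D E ↔ IsFun g D E := by
  simpa [exp] using Classical.choose_spec (exists_exp D E) w (K.idn w) g

@[simp] theorem res_exp (D E : K.M w) (f : K.Hom w v) :
    (exp D E) ⇡ f = exp (D ⇡ f) (E ⇡ f) := ext fun u g x => by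
  have h1 := Classical.choose_spec (exists_exp D E) u (K.comp f g) x
  have h2 := Classical.choose_spec (exists_exp (D ⇡ f) (E ⇡ f)) u g x
  rw [res_comp, exp, exp, h1, h2]; simp

/-! ### Fibres and polynomial functors -/

theorem exists_fib (p a : K.M w) : ∃ c, ∀ v (f : K.Hom w v) b,
    b ∈ c ⇡ f ↔ ⟪b, a ⇡ f⟫ ∈ p ⇡ f := by
  obtain ⟨c, hc⟩ := separation (bPairMem 0 2 1) (by simp) (p ⦂ a ⦂ nil w) (sUnion (sUnion p))
  refine ⟨c, fun v f b => ?_⟩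
  rw [hc]
  simp only [res_sUnion, mem_sUnion, cons_res, forces_bPairMem, cons_zero, cons_succ,
    and_iff_right_iff_imp]
  intro h
  exact ⟨sing b, ⟨_, h, by simp [opair]⟩, by simp⟩

/-- The fibre of `p` over `a`. -/
noncomputable def fib (p a : K.M w) : K.M w := Classical.choose (exists_fib p a)

@[simp] theorem mem_fib {p a b : K.M w} : b ∈ fib p a ↔ ⟪b, a⟫ ∈ p := by
  simpa [fib] using Classical.choose_spec (exists_fib p a) w (K.idn w) b

@[simp] theorem res_fib (p a : K.M w) (f : K.Hom w v) :
    (fib p a) ⇡ f = fib (p ⇡ f) (a ⇡ f) := ext fun u g x => by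
  have h1 := Classical.choose_spec (exists_fib p a) u (K.comp f g) x
  have h2 := Classical.choose_spec (exists_fib (p ⇡ f) (a ⇡ f)) u g x
  rw [res_comp, fib, fib, h1, h2]; simp

@[simp] theorem forces_isFibre {e : ℕ → K.M w} {F p a : ℕ} :
    Forces (isFibre F p a) w e ↔ e F = fib (e p) (e a) := by
  rw [isFibre, forces_all_iff, eq_iff_of_mem_iff (P := fun v f b => ⟪b, e a ⇡ f⟫ ∈ e p ⇡ f)]
  · simp
  · simp

theorem exists_poly (p A X : K.M w) : ∃ c, ∀ v (f : K.Hom w v) q,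
    q ∈ c ⇡ f ↔ ∃ a ∈ A ⇡ f, ∃ t, IsFun t (fib (p ⇡ f) a) (X ⇡ f) ∧ q = ⟪a, t⟫ := by
  refine union_image (P := fun v f a q => ∃ t, IsFun t (fib (p ⇡ f) a) (X ⇡ f) ∧ q = ⟪a, t⟫)
    (∃ₛ ∃ₛ (isFibre 1 4 3 ∧ₛ isFun 0 1 5 ∧ₛ isPair 2 3 0)) (p ⦂ X ⦂ nil w) A ?_ fun v f a ha => ?_
  · intro v f x z; simp
  · obtain ⟨c, hc⟩ := image (P := fun u g t q => q = ⟪a ⇡ g, t⟫) (isPair 0 2 1) (a ⦂ nil v)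
      (exp (fib (p ⇡ f) a) (X ⇡ f)) (by intro v f x z; simp) (by simp)
      (by rintro v f y - _ _ rfl rfl; rfl)
    exact ⟨c, by simpa using hc⟩

/-- The value of the polynomial functor of `p` at `X`. -/
noncomputable def poly (p A X : K.M w) : K.M w := Classical.choose (exists_poly p A X)

theorem mem_poly {p A X q : K.M w} :
    q ∈ poly p A X ↔ ∃ a ∈ A, ∃ t, IsFun t (fib p a) X ∧ q = ⟪a, t⟫ := by
  simpa [poly] using Classical.choose_spec (exists_poly p A X) w (K.idn w) q

@[simp] theorem res_poly (p A X : K.M w) (f : K.Hom w v) :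
    (poly p A X) ⇡ f = poly (p ⇡ f) (A ⇡ f) (X ⇡ f) := ext fun u g x => by
  have h1 := Classical.choose_spec (exists_poly p A X) u (K.comp f g) x
  have h2 := Classical.choose_spec (exists_poly (p ⇡ f) (A ⇡ f) (X ⇡ f)) u g x
  rw [res_comp, poly, poly, h1, h2]; simp

@[simp] theorem opair_mem_poly {p A X a t : K.M w} :
    ⟪a, t⟫ ∈ poly p A X ↔ a ∈ A ∧ IsFun t (fib p a) X := by
  rw [mem_poly]
  constructor
  · rintro ⟨a', ha, t', ht, e⟩
    rw [opair_inj] at e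
    obtain ⟨rfl, rfl⟩ := e
    exact ⟨ha, ht⟩
  · rintro ⟨ha, ht⟩
    exact ⟨a, ha, t, ht, rfl⟩

@[simp] theorem forces_isPoly {e : ℕ → K.M w} {P p A X : ℕ} :
    Forces (isPoly P p A X) w e ↔ e P = poly (e p) (e A) (e X) := by
  rw [isPoly, forces_all_iff, eq_iff_of_mem_iff (P := fun v f q =>
    ∃ a ∈ e A ⇡ f, ∃ t, IsFun t (fib (e p ⇡ f) a) (e X ⇡ f) ∧ q = ⟪a, t⟫)]
  · simp
  · intro v f x
    rw [res_poly, mem_poly]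

/-! ### Foundation and natural numbers -/

/-- Set Induction excludes membership cycles of length two. Its uses are the injectivity of `succ`
and the freshness of `X` as a point outside `X`. -/
theorem not_mem_of_mem {x y : K.M w} (h : y ∈ x) : ¬ x ∈ y := by
  have := set_induction (P := fun v f x => ∀ u (g : K.Hom v u) y, y ∈ x ⇡ g →
      ∀ u' (g' : K.Hom u u'), ¬ x ⇡ g ⇡ g' ∈ y ⇡ g') (ball 0 (1 ∈ₛ 0 →ₛ bot)) (nil w)
    (by intro v f x; simp [forces_ball, forces_imp]) (by
      intro v f a ih u g y hy u' g' ha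
      refine ih u g y hy u' g' _ ha u' (K.idn _) ?_
      simpa using mem_res' hy g') x w (K.idn w) y (by simpa using h) w (K.idn w)
  simpa using this

theorem not_mem_self (x : K.M w) : ¬ x ∈ x := fun h => not_mem_of_mem h h

theorem succ_inj {x y : K.M w} (h : succ x = succ y) : x = y := by
  have h1 : x ∈ succ y := h ▸ mem_succ.2 (Or.inr rfl)
  have h2 : y ∈ succ x := h ▸ mem_succ.2 (Or.inr rfl)
  rw [mem_succ] at h1 h2
  rcases h1 with h1 | rfl
  · rcases h2 with h2 | rfl
    · exact (not_mem_of_mem h1 h2).elim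
    · rfl
  · rfl

theorem succ_ne_emp {x : K.M w} : succ x ≠ emp w := fun h =>
  not_mem_emp (x := x) (h ▸ mem_succ.2 (Or.inr rfl))

/-- `n` is the set of natural numbers. -/
def IsOmega (n : K.M w) : Prop :=
  ∀ v (f : K.Hom w v) x, x ∈ n ⇡ f ↔ x = emp v ∨ ∃ k ∈ n ⇡ f, x = succ k

theorem exists_omega (w : K.W) : ∃ n : K.M w, IsOmega n := by
  obtain ⟨c, h⟩ := CZFModel.forces _ IsCZF.infinity w (nil w)
  exact ⟨c, fun v f x => by simpa using forces_all_iff.1 h v f x⟩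

namespace IsOmega

variable {n : K.M w}

theorem res (h : IsOmega n) (f : K.Hom w v) : IsOmega (n ⇡ f) := by
  intro u g x
  simpa using h u (K.comp f g) x

theorem mem_iff (h : IsOmega n) {x : K.M w} : x ∈ n ↔ x = emp w ∨ ∃ k ∈ n, x = succ k := by
  simpa using h w (K.idn w) x

theorem emp_mem (h : IsOmega n) : emp w ∈ n := h.mem_iff.2 (Or.inl rfl)

theorem succ_mem (h : IsOmega n) {k : K.M w} (hk : k ∈ n) : succ k ∈ n :=
  h.mem_iff.2 (Or.inr ⟨k, hk, rfl⟩)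

/-- Infinity only describes `n` as a fixed point of zero and successor. Set Induction, applied to
"if `x ∈ n` then `P x`", supplies the leastness, and does so for arbitrary formulas. -/
theorem induction (hn : IsOmega n) {P : ∀ v, K.Hom w v → K.M v → Prop} (φ : Fml) (e : ℕ → K.M w)
    (hP : ∀ v f x, Forces φ v (x ⦂ fun k => e k ⇡ f) ↔ P v f x)
    (h0 : ∀ v f, P v f (emp v)) (hs : ∀ v f k, k ∈ n ⇡ f → P v f k → P v f (succ k)) :
    ∀ v f k, k ∈ n ⇡ f → P v f k := by
  let ρ : ℕ → ℕ := fun k => match k with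
    | 0 => 0
    | k + 1 => k + 2
  have e1 : ∀ {v : K.W} (x y : K.M v) (e : ℕ → K.M v), (x ⦂ y ⦂ e) ∘ ρ = x ⦂ e := by
    intro v x y e; funext k; rcases k with _ | k <;> rfl
  have hP' : ∀ {v u f x} (g : K.Hom v u), P v f x → P u (K.comp f g) (x ⇡ g) := by
    intro v u f x g h
    rw [← hP] at h ⊢
    simpa using forces_res _ g h
  intro v f k hk
  have := set_induction (w := v) (P := fun u g x => ∀ u' (g' : K.Hom u u'),
      x ⇡ g' ∈ n ⇡ K.comp f g ⇡ g' → P u' (K.comp (K.comp f g) g') (x ⇡ g'))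
    (0 ∈ₛ 1 →ₛ ren ρ φ) (n ⇡ f ⦂ fun k => e k ⇡ f)
    (by intro u g x; simp [forces_imp, forces_ren, e1, hP]) (by
      intro u g a ih u' g' ha
      rcases ((hn.res _).res _).mem_iff.1 ha with h | ⟨k, hk, h⟩
      · rw [h]; exact h0 _ _
      · rw [h]
        refine hs _ _ _ (by simpa using hk) ?_
        have := ih u' g' k (by rw [h]; simp) u' (K.idn _)
        rw [← hP] at this ⊢
        simp only [res_id, ← res_comp] at this ⊢
        simpa using this (by simpa using hk)) k v (K.idn v) (by simpa [← res_comp] using hk)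
  rw [← hP] at this ⊢
  simpa [← res_comp] using this

end IsOmega

end CST

namespace CST

open Fml KModel

variable {K : KModel} {w v u : K.W}

/-! ### Inductive definitions -/

/-- Inclusion of sets. -/
def Sub (x y : K.M w) : Prop := ∀ v (f : K.Hom w v) z, z ∈ x ⇡ f → z ∈ y ⇡ f

theorem Sub.res {x y : K.M w} (h : Sub x y) (f : K.Hom w v) : Sub (x ⇡ f) (y ⇡ f) := by
  intro u g z
  simpa using h u (K.comp f g) z

theorem Sub.mem {x y z : K.M w} (h : Sub x y) (hz : z ∈ x) : z ∈ y := by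
  simpa using h w (K.idn w) z (by simpa using hz)

theorem Sub.trans {x y z : K.M w} (h : Sub x y) (h' : Sub y z) : Sub x z :=
  fun v f a ha => h' v f a (h v f a ha)

@[simp] theorem forces_isSub {e : ℕ → K.M w} {x y : ℕ} :
    Forces (isSub x y) w e ↔ Sub (e x) (e y) := by
  rw [isSub, forces_ball]; rfl

@[simp] theorem isBounded_isSub {x y : ℕ} : (isSub x y).IsBounded := by simp [isSub]

variable [CZFModel K]

/-- `Y` is a subset of `X` that is closed under the rules in `R`. -/
structure ClosedSub (Y R X : K.M w) : Prop where
  sub : Sub Y X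
  closed : ∀ v (f : K.Hom w v) a b, ⟪a, b⟫ ∈ R ⇡ f → Sub a (Y ⇡ f) → ∃ y ∈ b, y ∈ Y ⇡ f

@[simp] theorem forces_isClosedSub {e : ℕ → K.M w} {Y R X : ℕ} :
    Forces (isClosedSub Y R X) w e ↔ ClosedSub (e Y) (e R) (e X) := by
  simp only [isClosedSub, forces_and, forces_isSub, forces_ball]
  constructor
  · rintro ⟨h₁, h₂⟩
    refine ⟨h₁, fun v f a b hr hs => ?_⟩
    have := h₂ v f _ hr v (K.idn v) a v (K.idn v) b v (K.idn v)
    simp [forces_imp] at this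
    simpa using this v (K.idn v) (by simpa using hs)
  · rintro ⟨h₁, h₂⟩
    refine ⟨h₁, fun v f r hr v1 f1 a v2 f2 b v3 f3 hp v4 f4 hs => ?_⟩
    simp only [forces_isPair, forces_isSub, forces_bex, forces_mem, cons_zero, cons_succ, cons_res,
      res_comp, comp_assoc] at hp hs ⊢
    refine h₂ _ _ (a ⇡ K.comp f2 (K.comp f3 f4)) (b ⇡ K.comp f3 f4) ?_ hs
    have := mem_res' hr (K.comp f1 (K.comp f2 (K.comp f3 f4)))
    have hp' := congrArg (· ⇡ f4) hp
    simp only [res_comp, comp_assoc, res_opair] at hp' this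
    rwa [hp'] at this

/-- The NID principle in a model. -/
theorem exists_generating (hN : ∃ e : ℕ → K.M w, Forces NID w e) (X R : K.M w)
    (hR : ∀ v (f : K.Hom w v) r, r ∈ R ⇡ f →
      ∃ a b, r = ⟪a, b⟫ ∧ Sub a (X ⇡ f) ∧ Sub b (X ⇡ f)) :
    ∃ G : K.M w, (∀ v (f : K.Hom w v) Y, Y ∈ G ⇡ f → ClosedSub Y (R ⇡ f) (X ⇡ f)) ∧
      ∀ v (f : K.Hom w v) Y, ClosedSub Y (R ⇡ f) (X ⇡ f) → ∀ x ∈ Y, ∃ Z ∈ G ⇡ f, x ∈ Z ∧ Sub Z Y := by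
  obtain ⟨e, he⟩ := hN
  obtain ⟨G, h1, h2⟩ := he w (K.idn w) X w (K.idn w) R w (K.idn w) (by
    simpa [isRuleSet, forces_ball] using hR)
  rw [forces_ball] at h1
  refine ⟨G, by simpa using h1, fun v f Y hY x hx => ?_⟩
  rw [forces_all_imp] at h2
  have := forces_ball.1 (h2 v f Y (by simpa using hY)) v (K.idn v) x (by simpa using hx)
  simpa using this

/-- The set `I` is inductively generated by the set `Φ` of rules `⟪a, x⟫`: "if `a ⊆ I`, then
`x ∈ I`". -/
structure IsLfp (I Φ : K.M w) : Prop where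
  closed : ∀ v (f : K.Hom w v) a x, ⟪a, x⟫ ∈ Φ ⇡ f → Sub a (I ⇡ f) → x ∈ I ⇡ f
  least : ∀ v (f : K.Hom w v) Y, (∀ u (g : K.Hom v u) a x, ⟪a, x⟫ ∈ Φ ⇡ f ⇡ g →
    Sub a (Y ⇡ g) → x ∈ Y ⇡ g) → Sub (I ⇡ f) Y

namespace IsLfp

variable {I Φ : K.M w}

theorem res (h : IsLfp I Φ) (f : K.Hom w v) : IsLfp (I ⇡ f) (Φ ⇡ f) := by
  refine ⟨fun u g => ?_, fun u g => ?_⟩ <;> simp only [res_comp]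
  · exact h.closed u _
  · have := h.least u (K.comp f g)
    simpa only [res_comp] using this

theorem mem {a x : K.M w} (h : IsLfp I Φ) (hp : ⟪a, x⟫ ∈ Φ) (ha : Sub a I) : x ∈ I := by
  simpa using h.closed w (K.idn w) a x (by simpa using hp) (by simpa using ha)

theorem sub {Y : K.M w} (h : IsLfp I Φ) (hY : ∀ u (g : K.Hom w u) a x, ⟪a, x⟫ ∈ Φ ⇡ g →
    Sub a (Y ⇡ g) → x ∈ Y ⇡ g) : Sub I Y := by
  simpa using h.least w (K.idn w) Y (by simpa using hY)

/-- Leastness compares `I` with sets only, so the predicate is first cut out of `I` by Bounded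
Separation. -/
theorem induction (h : IsLfp I Φ) {P : ∀ v, K.Hom w v → K.M v → Prop} (φ : Fml)
    (hφ : φ.IsBounded) (e : ℕ → K.M w)
    (hP : ∀ v f x, Forces φ v (x ⦂ fun k => e k ⇡ f) ↔ P v f x)
    (H : ∀ v f a x, ⟪a, x⟫ ∈ Φ ⇡ f → Sub a (I ⇡ f) →
      (∀ u (g : K.Hom v u) y, y ∈ a ⇡ g → P u (K.comp f g) y) → P v f x) :
    ∀ v f x, x ∈ I ⇡ f → P v f x := by
  obtain ⟨Y, hY⟩ := separation φ hφ e I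
  simp only [hP] at hY
  have : Sub I Y := h.sub fun u g a x hp ha => by
    have haI : Sub a (I ⇡ g) := fun u' g' z hz => by
      have := ha u' g' z hz
      rw [res_comp, hY] at this
      simpa using this.1
    refine (hY u g x).2 ⟨h.closed u g a x hp haI, H u g a x hp haI fun u' g' y hy => ?_⟩
    have := ha u' g' y hy
    rw [res_comp, hY] at this
    exact this.2
  exact fun v f x hx => ((hY v f x).1 (this v f x hx)).2

/-- The elements concluded by a rule with premises in `I` form a closed subset of `I`. The bound
`sUnion (sUnion Φ)` on `a` is there only to make the predicate bounded. -/
theorem exists_rule (h : IsLfp I Φ) {x : K.M w} (hx : x ∈ I) : ∃ a, ⟪a, x⟫ ∈ Φ ∧ Sub a I := by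
  have := h.induction (P := fun v f x => ∃ a ∈ sUnion (sUnion (Φ ⇡ f)),
      ⟪a, x⟫ ∈ Φ ⇡ f ∧ Sub a (I ⇡ f))
    (bex 1 (bPairMem 0 1 3 ∧ₛ isSub 0 4)) (by simp) (sUnion (sUnion Φ) ⦂ Φ ⦂ I ⦂ nil w)
    (by intro v f x; simp) (by
      intro v f a x hp ha _
      exact ⟨a, by simpa using ⟨sing a, ⟨_, hp, by simp [opair]⟩, by simp⟩, hp, ha⟩)
    w (K.idn w) x (by simpa using hx)
  obtain ⟨a, -, h1, h2⟩ := this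
  exact ⟨a, by simpa using h1, by simpa using h2⟩

end IsLfp

/-- Set-generation says nothing about a closed set without elements, so a point common to all closed
sets is added: `X` itself, which is not a member of `X`. The rule `(∅, {X})` forces it in, and the
generating family at this point reaches below every closed set. -/
theorem exists_lfp (hN : ∃ e : ℕ → K.M w, Forces NID w e) (X Φ : K.M w)
    (hΦ : ∀ v (f : K.Hom w v) p, p ∈ Φ ⇡ f → ∃ a x, p = ⟪a, x⟫ ∧ Sub a (X ⇡ f) ∧ x ∈ X ⇡ f) :
    ∃ I, IsLfp I Φ ∧ Sub I X := by
  obtain ⟨R₀, hR₀⟩ := image (P := fun v f p r => ∃ a x, p = ⟪a, x⟫ ∧ r = ⟪a, sing x⟫)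
    (∃ₛ ∃ₛ (isPair 3 1 0 ∧ₛ ∃ₛ (isUpair 0 1 1 ∧ₛ isPair 3 2 0))) (nil w) Φ
    (by intro v f x z; simp [sing]) (by
      intro v f p hp
      obtain ⟨a, x, rfl, -⟩ := hΦ v f p hp
      exact ⟨_, a, x, rfl, rfl⟩) (by
      rintro v f p - _ _ ⟨a, x, rfl, rfl⟩ ⟨a', x', e, rfl⟩
      rw [opair_inj] at e
      rw [e.1, e.2])
  let R := cup R₀ (sing ⟪emp w, sing X⟫)
  let X' := cup X (sing X)
  have hR : ∀ v (f : K.Hom w v) a b, ⟪a, b⟫ ∈ R ⇡ f ↔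
      (∃ x, ⟪a, x⟫ ∈ Φ ⇡ f ∧ b = sing x) ∨ a = emp v ∧ b = sing (X ⇡ f) := by
    intro v f a b
    simp only [R, res_cup, mem_cup, hR₀, res_sing, res_opair, mem_sing, opair_inj, res_emp]
    refine or_congr ⟨?_, ?_⟩ Iff.rfl
    · rintro ⟨_, hp, a, x, rfl, rfl, rfl⟩
      exact ⟨x, hp, rfl⟩
    · rintro ⟨x, hp, rfl⟩
      exact ⟨_, hp, a, x, rfl, rfl, rfl⟩
  obtain ⟨G, hG₁, hG₂⟩ := exists_generating hN X' R (by
    intro v f r hr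
    simp only [R, res_cup, mem_cup, hR₀, res_sing, res_opair, mem_sing, res_emp] at hr
    rcases hr with ⟨p, hp, a, x, rfl, rfl⟩ | rfl
    · obtain ⟨a', x', e, h₁, h₂⟩ := hΦ v f _ hp
      rw [opair_inj] at e
      obtain ⟨rfl, rfl⟩ := e
      refine ⟨a, sing x, rfl, fun u g z hz => ?_, fun u g z hz => ?_⟩
      · simp only [X', res_cup, mem_cup]
        exact Or.inl (h₁ u g z hz)
      · simp only [X', res_cup, mem_cup, res_sing, mem_sing] at hz ⊢
        rw [hz]
        exact Or.inl (mem_res' h₂ g)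
    · refine ⟨_, _, rfl, fun u g z hz => by simp at hz, fun u g z hz => ?_⟩
      simp only [X', res_cup, mem_cup, res_sing, mem_sing] at hz ⊢
      exact Or.inr hz)
  -- The intersection of the members of `G`, without the extra point. It is a set by Bounded
  -- Separation because `G` is a set.
  obtain ⟨I, hI⟩ := separation (ball 1 (1 ∈ₛ 0)) (by simp) (G ⦂ nil w) X
  simp only [forces_ball, forces_mem, cons_res, cons_zero, cons_succ, res_comp] at hI
  refine ⟨I, ⟨fun v f a x hp ha => ?_, fun v f Y hY => ?_⟩, fun v f x hx => ((hI v f x).1 hx).1⟩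
  · rw [hI]
    obtain ⟨a', x', e, -, h₂⟩ := hΦ v f _ hp
    rw [opair_inj] at e
    refine ⟨e.2 ▸ h₂, fun u g Z hZ => ?_⟩
    obtain ⟨y, hy, hyZ⟩ := (hG₁ u _ Z hZ).closed u (K.idn u) (a ⇡ g) (sing (x ⇡ g)) (by
      rw [res_id, hR]
      exact Or.inl ⟨x ⇡ g, by simpa using mem_res' hp g, rfl⟩) (by
      intro u' g' z hz
      rw [res_comp] at hz
      have h3 := ha u' _ z hz
      rw [res_comp, hI] at h3
      have h4 := h3.2 u' (K.idn u') (Z ⇡ g') (by simpa [← res_comp] using mem_res' hZ g')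
      simpa using h4)
    simp only [mem_sing, res_id] at hy hyZ
    rwa [← hy]
  -- `Y` need not lie inside `X`. Its trace on `X` together with the extra point is a closed set to
  -- which `G` applies.
  · obtain ⟨Y', hY'⟩ := separation (0 ∈ₛ 1) (by simp) (Y ⦂ nil v) (X ⇡ f)
    simp only [forces_mem, cons_res, cons_zero, cons_succ] at hY'
    have hcl : ClosedSub (cup Y' (sing (X ⇡ f))) (R ⇡ f) (X' ⇡ f) := by
      refine ⟨fun u g z hz => ?_, fun u g a b hp ha => ?_⟩
      · simp only [X', res_cup, mem_cup, res_sing, mem_sing, hY'] at hz ⊢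
        tauto
      · simp only [res_cup, mem_cup, res_sing, mem_sing]
        rw [res_comp, hR] at hp
        rcases hp with ⟨x, hp, rfl⟩ | ⟨rfl, rfl⟩
        · obtain ⟨a', x', e, h₁, h₂⟩ := hΦ u _ _ hp
          rw [opair_inj] at e
          obtain ⟨rfl, rfl⟩ := e
          refine ⟨x, by simp, Or.inl ((hY' u g x).2 ⟨by simpa using h₂, ?_⟩)⟩
          refine hY u g a x (by simpa using hp) fun u' g' z hz => ?_
          have h3 := ha u' g' z hz
          simp only [res_cup, mem_cup, res_sing, mem_sing, res_comp, hY'] at h3 ⊢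
          rcases h3 with h3 | rfl
          · exact h3.2
          -- A premise of a rule from `Φ` lies in `X`, so it cannot be the extra point.
          · have := h₁ u' g' _ hz
            exact (not_mem_self _ (by simpa using this)).elim
        · exact ⟨_, mem_sing.2 rfl, Or.inr (by simp)⟩
    intro u g x hx
    rw [res_comp, hI] at hx
    -- Generation at the extra point: `I ⊆ Z ⊆ Y' ∪ {X}`.
    obtain ⟨Z, hZ, -, hZY⟩ := hG₂ v f _ hcl (X ⇡ f) (by simp)
    have h1 := hx.2 u (K.idn u) (Z ⇡ g) (by simpa [← res_comp] using mem_res' hZ g)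
    have h2 := hZY u g x (by simpa using h1)
    simp only [res_cup, mem_cup, res_sing, mem_sing, hY'] at h2
    rcases h2 with h2 | rfl
    · exact h2.2
    · exact (not_mem_self _ (by simpa using hx.1)).elim

end CST

namespace CST

open Fml KModel

variable {K : KModel} {w v u : K.W}

theorem forces_all_all_imp {φ ψ : Fml} {e : ℕ → K.M w} :
    Forces (∀ₛ ∀ₛ (φ →ₛ ψ)) w e ↔ ∀ v (f : K.Hom w v) x y,
      Forces φ v (y ⦂ x ⦂ fun k => e k ⇡ f) → Forces ψ v (y ⦂ x ⦂ fun k => e k ⇡ f) := by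
  rw [forces_all]
  simp only [forces_all_imp]
  constructor
  · intro h v f x y; simpa using h v f x v (K.idn v) y
  · intro h v f x u g; simpa using h u (K.comp f g) (x ⇡ g)

variable [CZFModel K]

/-! ### An algebra with an injective structure map -/

/-- Every element of `T` is `⟪0, {∅}⟫` or of the form `⟪k + 1, P_p(Z)⟫` with `⟪k, Z⟫ ∈ T`. -/
def IsTower (n p A T : K.M w) : Prop := ∀ v (f : K.Hom w v) q, q ∈ T ⇡ f →
  q = ⟪emp v, sing (emp v)⟫ ∨
    ∃ k ∈ n ⇡ f, ∃ Z, ⟪k, Z⟫ ∈ T ⇡ f ∧ q = ⟪succ k, poly (p ⇡ f) (A ⇡ f) Z⟫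

/-- The formula that defines `IsTower`. -/
def towerFml (n p A T : ℕ) : Fml :=
  ball T (∃ₛ ∃ₛ (isEmpty 1 ∧ₛ isUpair 0 1 1 ∧ₛ isPair 2 1 0) ∨ₛ
    bex (n + 1) (∃ₛ (pairMem 1 0 (T + 3) ∧ₛ
      ∃ₛ ∃ₛ (isSucc 1 3 ∧ₛ isPoly 0 (p + 5) (A + 5) 2 ∧ₛ isPair 4 1 0))))

@[simp] theorem forces_towerFml {e : ℕ → K.M w} {n p A T : ℕ} :
    Forces (towerFml n p A T) w e ↔ IsTower (e n) (e p) (e A) (e T) := by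
  rw [towerFml, forces_ball]
  simp [IsTower, sing]

namespace IsTower

variable {n p A T : K.M w}

theorem res (h : IsTower n p A T) (f : K.Hom w v) : IsTower (n ⇡ f) (p ⇡ f) (A ⇡ f) (T ⇡ f) := by
  intro u g
  simpa using h u (K.comp f g)

theorem cases {q : K.M w} (h : IsTower n p A T) (hq : q ∈ T) : q = ⟪emp w, sing (emp w)⟫ ∨
    ∃ k ∈ n, ∃ Z, ⟪k, Z⟫ ∈ T ∧ q = ⟪succ k, poly p A Z⟫ := by
  simpa using h w (K.idn w) q (by simpa using hq)

theorem zero {Y : K.M w} (h : IsTower n p A T) (hY : ⟪emp w, Y⟫ ∈ T) : Y = sing (emp w) := by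
  rcases h.cases hY with h | ⟨k, -, Z, -, h⟩ <;> rw [opair_inj] at h
  · exact h.2
  · exact (succ_ne_emp h.1.symm).elim

theorem succ {k Y : K.M w} (h : IsTower n p A T) (hY : ⟪succ k, Y⟫ ∈ T) :
    ∃ Z, ⟪k, Z⟫ ∈ T ∧ Y = poly p A Z := by
  rcases h.cases hY with h | ⟨k', -, Z, hZ, h⟩ <;> rw [opair_inj] at h
  · exact (succ_ne_emp h.1).elim
  · rw [succ_inj h.1]
    exact ⟨Z, hZ, h.2⟩

/-- A tower need not be total or built in any order: zero and successor are distinguishable and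
`succ` is injective, so each level is determined by the one below it. -/
theorem unique (h : IsTower n p A T) (hn : IsOmega n) {k Y Y' : K.M w} (hk : k ∈ n)
    (hY : ⟪k, Y⟫ ∈ T) (hY' : ⟪k, Y'⟫ ∈ T) : Y = Y' := by
  have := hn.induction (P := fun v f k => ∀ u (g : K.Hom v u) Y Y',
      ⟪k ⇡ g, Y⟫ ∈ T ⇡ K.comp f g → ⟪k ⇡ g, Y'⟫ ∈ T ⇡ K.comp f g → Y = Y')
    (∀ₛ ∀ₛ (pairMem 2 1 3 ∧ₛ pairMem 2 0 3 →ₛ 1 =ₛ 0)) (T ⦂ nil w)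
    (by intro v f x; simp [forces_all_all_imp]) (by
      intro v f u g Y Y' h₁ h₂
      rw [res_emp] at h₁ h₂
      rw [(h.res _).zero h₁, (h.res _).zero h₂]) (by
      intro v f k hk ih u g Y Y' h₁ h₂
      rw [res_succ] at h₁ h₂
      obtain ⟨Z, hZ, rfl⟩ := (h.res _).succ h₁
      obtain ⟨Z', hZ', rfl⟩ := (h.res _).succ h₂
      rw [ih u g Z Z' hZ hZ']) w (K.idn w) k (by simpa using hk)
  exact this w (K.idn w) Y Y' (by simpa using hY) (by simpa using hY')

end IsTower

/-- `T` is the function on the set `n` of natural numbers that takes `k` to `P_p^k({∅})`. -/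
structure IsFullTower (n p A T : K.M w) : Prop where
  omega : IsOmega n
  tower : IsTower n p A T
  total : ∀ v (f : K.Hom w v) k, k ∈ n ⇡ f → ∃ Y, ⟪k, Y⟫ ∈ T ⇡ f

/-- Being a tower is a local condition preserved by unions. Towers reaching each `k` exist by
induction, Strong Collection gathers some of them, and their union is total without any comparison
between them. -/
theorem exists_fullTower {n : K.M w} (hn : IsOmega n) (p A : K.M w) :
    ∃ T, IsFullTower n p A T := by
  have key := hn.induction (P := fun v f k => ∃ T, IsTower (n ⇡ f) (p ⇡ f) (A ⇡ f) T ∧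
      ∃ Y, ⟪k, Y⟫ ∈ T) (∃ₛ (towerFml 2 3 4 0 ∧ₛ ∃ₛ (pairMem 2 0 1))) (n ⦂ p ⦂ A ⦂ nil w)
    (by intro v f x; simp) (by
      intro v f
      refine ⟨sing ⟪emp v, sing (emp v)⟫, fun u g q hq => Or.inl ?_, _, by simp; rfl⟩
      simpa using hq) (by
      rintro v f k hk ⟨T, hT, Y, hY⟩
      refine ⟨cup T (sing ⟪succ k, poly (p ⇡ f) (A ⇡ f) Y⟫), fun u g q hq => ?_,
        poly (p ⇡ f) (A ⇡ f) Y, by simp⟩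
      simp only [res_cup, mem_cup, res_sing, mem_sing, res_opair] at hq ⊢
      rcases hq with hq | rfl
      · rcases hT u g q hq with h | ⟨k', hk', Z, hZ, h⟩
        · exact Or.inl h
        · exact Or.inr ⟨k', hk', Z, Or.inl hZ, h⟩
      · refine Or.inr ⟨k ⇡ g, mem_res' hk g, Y ⇡ g, Or.inl ?_, by simp⟩
        simpa using mem_res' hY g)
  obtain ⟨b, h₁, h₂⟩ := collection (towerFml 2 3 4 1 ∧ₛ ∃ₛ (pairMem 1 0 2)) (n ⦂ p ⦂ A ⦂ nil w) n
    (by simpa using key)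
  simp only [forces_and, forces_towerFml, cons_zero, cons_succ, forces_ex, forces_pairMem,
    cons_res] at h₁ h₂
  refine ⟨sUnion b, hn, fun v f q hq => ?_, fun v f k hk => ?_⟩
  · simp only [res_sUnion, mem_sUnion] at hq ⊢
    obtain ⟨T, hT, hq⟩ := hq
    obtain ⟨-, -, h, -⟩ := h₂ v f T hT
    rcases h.cases hq with h | ⟨k, hk, Z, hZ, h⟩
    · exact Or.inl h
    · exact Or.inr ⟨k, hk, Z, ⟨T, hT, hZ⟩, h⟩
  · obtain ⟨T, hT, -, Y, hY⟩ := h₁ v f k hk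
    exact ⟨Y, by simpa using ⟨T, hT, hY⟩⟩

namespace IsFullTower

variable {n p A T : K.M w}

theorem res (h : IsFullTower n p A T) (f : K.Hom w v) :
    IsFullTower (n ⇡ f) (p ⇡ f) (A ⇡ f) (T ⇡ f) := by
  refine ⟨h.omega.res f, h.tower.res f, fun u g => ?_⟩
  simpa using h.total u (K.comp f g)

theorem exists_level {k : K.M w} (h : IsFullTower n p A T) (hk : k ∈ n) : ∃ Y, ⟪k, Y⟫ ∈ T := by
  simpa using h.total w (K.idn w) k (by simpa using hk)

theorem emp_mem (h : IsFullTower n p A T) : ∃ Y, ⟪emp w, Y⟫ ∈ T ∧ emp w ∈ Y := by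
  obtain ⟨Y, hY⟩ := h.exists_level h.omega.emp_mem
  exact ⟨Y, hY, by simp [h.tower.zero hY]⟩

theorem succ_mem {k Z q : K.M w} (h : IsFullTower n p A T) (hk : k ∈ n) (hZ : ⟪k, Z⟫ ∈ T)
    (hq : q ∈ poly p A Z) : ∃ Y, ⟪succ k, Y⟫ ∈ T ∧ q ∈ Y := by
  obtain ⟨Y, hY⟩ := h.exists_level (h.omega.succ_mem hk)
  obtain ⟨Z', hZ', rfl⟩ := h.tower.succ hY
  rw [h.tower.unique h.omega hk hZ hZ'] at hq
  exact ⟨_, hY, hq⟩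

end IsFullTower

/-- The union of all values of `T`, with some further elements. -/
noncomputable def bigUnion (T : K.M w) : K.M w := sUnion (sUnion (sUnion T))

@[simp] theorem res_bigUnion (T : K.M w) (f : K.Hom w v) :
    (bigUnion T) ⇡ f = bigUnion (T ⇡ f) := by simp [bigUnion]

theorem mem_sUnion_sUnion {T k Y : K.M w} (h : ⟪k, Y⟫ ∈ T) : Y ∈ sUnion (sUnion T) := by
  simp only [mem_sUnion]
  exact ⟨upair k Y, ⟨_, h, by simp [opair]⟩, by simp⟩

theorem mem_bigUnion {T k Y y : K.M w} (h : ⟪k, Y⟫ ∈ T) (hy : y ∈ Y) : y ∈ bigUnion T := by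
  rw [bigUnion, mem_sUnion]
  exact ⟨Y, mem_sUnion_sUnion h, hy⟩

/-- `x` is a section of `T`: a function on `n` with `x(k) ∈ T(k)` for all `k`. -/
structure IsSection (n T x : K.M w) : Prop where
  isFun : IsFun x n (bigUnion T)
  mem : ∀ v (f : K.Hom w v) k y, ⟪k, y⟫ ∈ x ⇡ f → ∃ Y, ⟪k, Y⟫ ∈ T ⇡ f ∧ y ∈ Y

theorem IsSection.exists_mem {n T x k y : K.M w} (h : IsSection n T x) (hy : ⟪k, y⟫ ∈ x) :
    ∃ Y, ⟪k, Y⟫ ∈ T ∧ y ∈ Y := by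
  simpa using h.mem w (K.idn w) k y (by simpa using hy)

theorem exists_sections (n T : K.M w) :
    ∃ N, ∀ v (f : K.Hom w v) x, x ∈ N ⇡ f ↔ IsSection (n ⇡ f) (T ⇡ f) x := by
  obtain ⟨N, hN⟩ := separation
    (ball 0 (bex 2 (bex 5 (bex 7 (bPair 3 2 1 ∧ₛ bPairMem 2 0 6 ∧ₛ 1 ∈ₛ 0))))) (by simp)
    (n ⦂ T ⦂ bigUnion T ⦂ sUnion (sUnion T) ⦂ nil w) (exp n (bigUnion T))
  refine ⟨N, fun v f x => ?_⟩
  rw [hN]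
  simp only [forces_ball, res_exp, mem_exp, cons_res, cons_zero, cons_succ, forces_bex,
    forces_and, forces_bPair, forces_bPairMem, forces_mem, res_bigUnion, res_sUnion]
  constructor
  · rintro ⟨h₁, h₂⟩
    refine ⟨h₁, fun u g k y hy => ?_⟩
    obtain ⟨k', -, y', -, Y, -, e, h₃, h₄⟩ := h₂ u g _ hy
    rw [opair_inj] at e
    obtain ⟨rfl, rfl⟩ := e
    exact ⟨Y, h₃, h₄⟩
  · rintro ⟨h₁, h₂⟩
    refine ⟨h₁, fun u g q hq => ?_⟩
    obtain ⟨k, hk, y, -, rfl⟩ := (h₁.res g).exists_eq hq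
    obtain ⟨Y, hY, hy⟩ := h₂ u g _ _ hq
    exact ⟨k, hk, y, mem_bigUnion hY hy, Y, mem_sUnion_sUnion hY, rfl, hY, hy⟩

/-- `s` is the relation that takes `b` to `t(b)(k)`. -/
def IsSlice (s t k : K.M w) : Prop := ∀ v (f : K.Hom w v) z, z ∈ s ⇡ f ↔
  ∃ b y x, z = ⟪b, y⟫ ∧ ⟪b, x⟫ ∈ t ⇡ f ∧ ⟪k ⇡ f, y⟫ ∈ x

/-- The formula that defines `IsSlice`. -/
def sliceFml (s t k : ℕ) : Fml :=
  ∀ₛ (0 ∈ₛ s + 1 ↔ₛ ∃ₛ ∃ₛ ∃ₛ (isPair 3 2 1 ∧ₛ pairMem 2 0 (t + 4) ∧ₛ pairMem (k + 4) 1 0))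

@[simp] theorem forces_sliceFml {e : ℕ → K.M w} {s t k : ℕ} :
    Forces (sliceFml s t k) w e ↔ IsSlice (e s) (e t) (e k) := by
  rw [sliceFml, forces_all_iff]
  simp [IsSlice]

namespace IsSlice

variable {s t k : K.M w}

theorem opair_mem (h : IsSlice s t k) {b y : K.M w} :
    ⟪b, y⟫ ∈ s ↔ ∃ x, ⟪b, x⟫ ∈ t ∧ ⟪k, y⟫ ∈ x := by
  have := h w (K.idn w) ⟪b, y⟫
  simp only [res_id, opair_inj] at this
  rw [this]
  constructor
  · rintro ⟨b, y, x, ⟨rfl, rfl⟩, h⟩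
    exact ⟨x, h⟩
  · rintro ⟨x, h⟩
    exact ⟨b, y, x, ⟨rfl, rfl⟩, h⟩

theorem unique {s' : K.M w} (h : IsSlice s t k) (h' : IsSlice s' t k) : s = s' :=
  ext fun v f x => by rw [h v f x, h' v f x]

end IsSlice

/-- Each section has its value at `k` in some level attached to `k`; `hu` identifies that level with
`Z`. -/
theorem exists_slice {n T N F t k Z : K.M w}
    (hN : ∀ v (f : K.Hom w v) x, x ∈ N ⇡ f ↔ IsSection (n ⇡ f) (T ⇡ f) x)
    (hu : ∀ v (f : K.Hom w v) Y Y', ⟪k ⇡ f, Y⟫ ∈ T ⇡ f → ⟪k ⇡ f, Y'⟫ ∈ T ⇡ f → Y = Y')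
    (ht : IsFun t F N) (hk : k ∈ n) (hZ : ⟪k, Z⟫ ∈ T) : ∃ s, IsSlice s t k ∧ IsFun s F Z := by
  obtain ⟨s, hs, h⟩ := exists_fun (P := fun v f b y => ∃ x, ⟪b, x⟫ ∈ t ⇡ f ∧ ⟪k ⇡ f, y⟫ ∈ x)
    (∃ₛ (pairMem 2 0 3 ∧ₛ pairMem 4 1 0)) (t ⦂ k ⦂ nil w) F Z (by intro v f b y; simp) (by
      intro v f b hb
      obtain ⟨x, hx, hbx⟩ := (ht.res f).exists_val hb
      rw [hN] at hx
      obtain ⟨y, -, hy⟩ := hx.isFun.exists_val (mem_res' hk f)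
      obtain ⟨Y, hY, hyY⟩ := hx.exists_mem hy
      rw [hu v f Y (Z ⇡ f) hY (by simpa using mem_res' hZ f)] at hyY
      exact ⟨y, hyY, x, hbx, hy⟩) (by
      rintro v f b hb y y' ⟨x, hx, hy⟩ ⟨x', hx', hy'⟩
      obtain rfl := (ht.res f).eq hx hx'
      exact ((hN v f x).1 ((ht.res f).mem_cod hx)).isFun.eq hy hy')
  refine ⟨s, fun v f z => ⟨fun hz => ?_, ?_⟩, hs⟩
  · obtain ⟨b, -, y, -, rfl⟩ := (hs.res f).exists_eq hz
    obtain ⟨x, hx⟩ := ((h v f b y).1 hz).2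
    exact ⟨b, y, x, rfl, hx⟩
  · rintro ⟨b, y, x, rfl, hx, hy⟩
    exact (h v f b y).2 ⟨(ht.res f).mem_dom hx, x, hx, hy⟩

/-- `y` is the value at `k` of the section that corresponds to `⟪a, t⟫`. -/
def IsSupVal (n a t k y : K.M w) : Prop :=
  k = emp w ∧ y = emp w ∨ ∃ j ∈ n, k = succ j ∧ ∃ s, IsSlice s t j ∧ y = ⟪a, s⟫

/-- The formula that defines `IsSupVal`. -/
def supValFml (n a t k y : ℕ) : Fml :=
  isEmpty k ∧ₛ isEmpty y ∨ₛ bex n (isSucc (k + 1) 0 ∧ₛ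
    ∃ₛ (sliceFml 0 (t + 2) 1 ∧ₛ isPair (y + 2) (a + 2) 0))

@[simp] theorem forces_supValFml {e : ℕ → K.M w} {n a t k y : ℕ} :
    Forces (supValFml n a t k y) w e ↔ IsSupVal (e n) (e a) (e t) (e k) (e y) := by
  simp [supValFml, IsSupVal]

/-- `x` is the section that corresponds to `⟪a, t⟫`. -/
def IsSup (n a t x : K.M w) : Prop := ∀ v (f : K.Hom w v) z, z ∈ x ⇡ f ↔
  ∃ k ∈ n ⇡ f, ∃ y, z = ⟪k, y⟫ ∧ IsSupVal (n ⇡ f) (a ⇡ f) (t ⇡ f) k y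

/-- The formula that defines `IsSup`. -/
def supFml (n a t x : ℕ) : Fml :=
  ∀ₛ (0 ∈ₛ x + 1 ↔ₛ bex (n + 1) (∃ₛ (isPair 2 1 0 ∧ₛ supValFml (n + 3) (a + 3) (t + 3) 1 0)))

@[simp] theorem forces_supFml {e : ℕ → K.M w} {n a t x : ℕ} :
    Forces (supFml n a t x) w e ↔ IsSup (e n) (e a) (e t) (e x) := by
  rw [supFml, forces_all_iff]
  simp [IsSup]

theorem IsSup.opair_mem {n a t x k y : K.M w} (h : IsSup n a t x) :
    ⟪k, y⟫ ∈ x ↔ k ∈ n ∧ IsSupVal n a t k y := by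
  have := h w (K.idn w) ⟪k, y⟫
  simp only [res_id, opair_inj] at this
  rw [this]
  constructor
  · rintro ⟨k, hk, y, ⟨rfl, rfl⟩, h⟩
    exact ⟨hk, h⟩
  · rintro ⟨hk, h⟩
    exact ⟨k, hk, y, ⟨rfl, rfl⟩, h⟩

section Sup

variable {n p A T N : K.M w}

theorem exists_slice_of_mem (hT : IsFullTower n p A T)
    (hN : ∀ v (f : K.Hom w v) x, x ∈ N ⇡ f ↔ IsSection (n ⇡ f) (T ⇡ f) x)
    {F t k : K.M w} (ht : IsFun t F N) (hk : k ∈ n) :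
    ∃ s Z, ⟪k, Z⟫ ∈ T ∧ IsSlice s t k ∧ IsFun s F Z := by
  obtain ⟨Z, hZ⟩ := hT.exists_level hk
  obtain ⟨s, h₁, h₂⟩ := exists_slice hN
    (fun v f Y Y' => (hT.res f).tower.unique (hT.res f).omega (mem_res' hk f)) ht hk hZ
  exact ⟨s, Z, hZ, h₁, h₂⟩

theorem exists_isSupVal (hT : IsFullTower n p A T)
    (hN : ∀ v (f : K.Hom w v) x, x ∈ N ⇡ f ↔ IsSection (n ⇡ f) (T ⇡ f) x)
    {a t k : K.M w} (ha : a ∈ A) (ht : IsFun t (fib p a) N) (hk : k ∈ n) :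
    ∃ y, IsSupVal n a t k y ∧ ∃ Y, ⟪k, Y⟫ ∈ T ∧ y ∈ Y := by
  rcases hT.omega.mem_iff.1 hk with rfl | ⟨j, hj, rfl⟩
  · exact ⟨emp w, Or.inl ⟨rfl, rfl⟩, hT.emp_mem⟩
  · obtain ⟨s, Z, hZ, h₁, h₂⟩ := exists_slice_of_mem hT hN ht hj
    exact ⟨⟪a, s⟫, Or.inr ⟨j, hj, rfl, s, h₁, rfl⟩,
      hT.succ_mem hj hZ (opair_mem_poly.2 ⟨ha, h₂⟩)⟩

theorem IsSupVal.unique {a t k y y' : K.M w} (h : IsSupVal n a t k y)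
    (h' : IsSupVal n a t k y') : y = y' := by
  rcases h with ⟨rfl, rfl⟩ | ⟨j, hj, rfl, s, hs, rfl⟩
  · rcases h' with ⟨-, rfl⟩ | ⟨j, hj, h, -⟩
    · rfl
    · exact (succ_ne_emp h.symm).elim
  · rcases h' with ⟨h, -⟩ | ⟨j', hj', h, s', hs', rfl⟩
    · exact (succ_ne_emp h).elim
    · obtain rfl := succ_inj h
      rw [hs.unique hs']

/-- The sequence is again a section: the slice of `t` at `k` maps the fibre into level `k`, so `⟪a,
s⟫` lies in `P_p` of that level, which is level `succ k`. -/
theorem exists_isSup (hT : IsFullTower n p A T)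
    (hN : ∀ v (f : K.Hom w v) x, x ∈ N ⇡ f ↔ IsSection (n ⇡ f) (T ⇡ f) x)
    {a t : K.M w} (ha : a ∈ A) (ht : IsFun t (fib p a) N) :
    ∃ x ∈ N, IsSup n a t x := by
  have hN' : ∀ v (f : K.Hom w v) v' (f' : K.Hom v v') x,
      x ∈ N ⇡ f ⇡ f' ↔ IsSection (n ⇡ f ⇡ f') (T ⇡ f ⇡ f') x := by
    intro v f v' f' x
    simp only [res_comp, hN]
  have key : ∀ v (f : K.Hom w v) k, k ∈ n ⇡ f →
      ∃ y, IsSupVal (n ⇡ f) (a ⇡ f) (t ⇡ f) k y ∧ ∃ Y, ⟪k, Y⟫ ∈ T ⇡ f ∧ y ∈ Y := by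
    intro v f k hk
    refine exists_isSupVal (hT.res f) (hN' v f) (mem_res' ha f) ?_ hk
    simpa using ht.res f
  obtain ⟨x, hx, h⟩ := exists_fun (P := fun v f k y => IsSupVal (n ⇡ f) (a ⇡ f) (t ⇡ f) k y)
    (supValFml 2 3 4 1 0) (n ⦂ a ⦂ t ⦂ nil w) n (bigUnion T) (by intro v f k y; simp) (by
      intro v f k hk
      obtain ⟨y, h, Y, hY, hy⟩ := key v f k hk
      exact ⟨y, by simpa using mem_bigUnion hY hy, h⟩)
    (by intro v f k hk y y' h h'; exact h.unique h')
  refine ⟨x, ?_, fun v f z => ⟨fun hz => ?_, ?_⟩⟩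
  · have hNx := hN w (K.idn w) x
    simp only [res_id] at hNx
    refine hNx.2 ⟨hx, fun v f k y hy => ?_⟩
    rw [h] at hy
    obtain ⟨y', h', Y, hY⟩ := key v f k hy.1
    rw [hy.2.unique h']
    exact ⟨Y, hY⟩
  · obtain ⟨k, hk, y, -, rfl⟩ := (hx.res f).exists_eq hz
    exact ⟨k, hk, y, rfl, ((h v f k y).1 hz).2⟩
  · rintro ⟨k, hk, y, rfl, h'⟩
    exact (h v f k y).2 ⟨hk, h'⟩

/-- Both descriptions of `x` are read off at `succ k`, where its value is the pair of the label and
the slice at `k`. -/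
theorem IsSup.slice_eq (hT : IsFullTower n p A T) {a a' t t' x k s : K.M w} (h : IsSup n a t x)
    (h' : IsSup n a' t' x) (hk : k ∈ n) (hs : IsSlice s t k) : a = a' ∧ IsSlice s t' k := by
  have h1 : ⟪succ k, ⟪a, s⟫⟫ ∈ x :=
    h.opair_mem.2 ⟨hT.omega.succ_mem hk, Or.inr ⟨k, hk, rfl, s, hs, rfl⟩⟩
  rcases (h'.opair_mem.1 h1).2 with ⟨h, -⟩ | ⟨j, hj, h, s', hs', e⟩
  · exact (succ_ne_emp h).elim
  · obtain rfl := succ_inj h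
    rw [opair_inj] at e
    obtain ⟨rfl, rfl⟩ := e
    exact ⟨rfl, hs'⟩

/-- The label is recovered from the slice at `0`, which exists even when the fibre is empty. The
functions agree because the sections `t(b)` and `t'(b)` agree at every `k`, the slices being equal.
-/
theorem IsSup.injective (hT : IsFullTower n p A T)
    (hN : ∀ v (f : K.Hom w v) x, x ∈ N ⇡ f ↔ IsSection (n ⇡ f) (T ⇡ f) x)
    {a a' t t' x : K.M w} (ht : IsFun t (fib p a) N)
    (ht' : IsFun t' (fib p a') N) (h : IsSup n a t x) (h' : IsSup n a' t' x) :
    a = a' ∧ t = t' := by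
  have ha : a = a' := by
    obtain ⟨s, Z, -, hs, -⟩ := exists_slice_of_mem hT hN ht hT.omega.emp_mem
    exact (h.slice_eq hT h' hT.omega.emp_mem hs).1
  subst ha
  refine ⟨rfl, ht.ext ht' fun v f b y hy => ?_⟩
  obtain ⟨y', hy'N, hy'⟩ := (ht'.res f).exists_val ((ht.res f).mem_dom hy)
  have hyN := (ht.res f).mem_cod hy
  rw [hN] at hyN hy'N
  suffices y = y' by rwa [this]
  refine hyN.isFun.ext hy'N.isFun fun u g k z hz => ?_
  have hk := (hyN.isFun.res g).mem_dom hz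
  have hN' : ∀ v' (f' : K.Hom u v') x,
      x ∈ N ⇡ K.comp f g ⇡ f' ↔ IsSection (n ⇡ K.comp f g ⇡ f') (T ⇡ K.comp f g ⇡ f') x := by
    intro v' f' x
    simp only [res_comp, hN]
  have hs1 : ∀ {a t : K.M w}, IsSup n a t x →
      IsSup (n ⇡ K.comp f g) (a ⇡ K.comp f g) (t ⇡ K.comp f g) (x ⇡ K.comp f g) := by
    intro a t h u' g'
    simpa using h u' (K.comp (K.comp f g) g')
  rw [res_comp] at hk
  obtain ⟨s, Z, -, hs, -⟩ := exists_slice_of_mem (hT.res (K.comp f g)) hN'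
    (ht.res (K.comp f g)) hk
  have hs' := ((hs1 h).slice_eq (hT.res _) (hs1 h') hk hs).2
  have hz' : ⟪b ⇡ g, z⟫ ∈ s := hs.opair_mem.2 ⟨y ⇡ g, by simpa using mem_res' hy g, hz⟩
  obtain ⟨y₂, hy₂, hz₂⟩ := hs'.opair_mem.1 hz'
  have e : y' ⇡ g = y₂ := (ht'.res (K.comp f g)).eq (by simpa using mem_res' hy' g) hy₂
  rwa [e]

end Sup

/-- The full product of the levels is used: no compatibility between successive levels is needed for
injectivity, and superfluous elements disappear on passing to the smallest subalgebra. -/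
theorem exists_injective_algebra (p A : K.M w) : ∃ N s, IsFun s (poly p A N) N ∧
    ∀ v (f : K.Hom w v) q q' x, ⟪q, x⟫ ∈ s ⇡ f → ⟪q', x⟫ ∈ s ⇡ f → q = q' := by
  obtain ⟨n, hn⟩ := exists_omega w
  obtain ⟨T, hT⟩ := exists_fullTower hn p A
  obtain ⟨N, hN⟩ := exists_sections n T
  have hN' : ∀ v (f : K.Hom w v) v' (f' : K.Hom v v') x,
      x ∈ N ⇡ f ⇡ f' ↔ IsSection (n ⇡ f ⇡ f') (T ⇡ f ⇡ f') x := by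
    intro v f v' f' x
    simp only [res_comp, hN]
  obtain ⟨s, hs, h⟩ := exists_fun
    (P := fun v f q x => ∃ a t, q = ⟪a, t⟫ ∧ IsSup (n ⇡ f) a t x)
    (∃ₛ ∃ₛ (isPair 3 1 0 ∧ₛ supFml 4 1 0 2)) (n ⦂ nil w) (poly p A N) N
    (by intro v f q x; simp) (by
      intro v f q hq
      rw [res_poly, mem_poly] at hq
      obtain ⟨a, ha, t, ht, rfl⟩ := hq
      obtain ⟨x, hx, h⟩ := exists_isSup (hT.res f) (hN' v f) ha ht
      exact ⟨x, hx, a, t, rfl, h⟩) (by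
      rintro v f q hq x x' ⟨a, t, rfl, h⟩ ⟨a', t', e, h'⟩
      rw [opair_inj] at e
      obtain ⟨rfl, rfl⟩ := e
      exact ext fun u g z => by rw [h u g z, h' u g z])
  refine ⟨N, s, hs, fun v f q q' x hq hq' => ?_⟩
  rw [h, res_poly] at hq hq'
  obtain ⟨hp, a, t, rfl, h₁⟩ := hq
  obtain ⟨hp', a', t', rfl, h₂⟩ := hq'
  rw [opair_mem_poly] at hp hp'
  rw [opair_inj]
  exact IsSup.injective (hT.res f) (hN' v f) hp.2 hp'.2 h₁ h₂

end CST

namespace CST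

open Fml KModel

variable {K : KModel} {w v u : K.W}

theorem forces_ball_ball_imp {φ ψ : Fml} {e : ℕ → K.M w} {i j : ℕ} :
    Forces (ball i (ball (j + 1) (φ →ₛ ψ))) w e ↔ ∀ v (f : K.Hom w v) x y,
      x ∈ e i ⇡ f → y ∈ e j ⇡ f → Forces φ v (y ⦂ x ⦂ fun k => e k ⇡ f) →
        Forces ψ v (y ⦂ x ⦂ fun k => e k ⇡ f) := by
  simp only [forces_ball, forces_imp]
  constructor
  · intro h v f x y hx hy
    simpa using h v f x hx v (K.idn v) y (by simpa using hy) v (K.idn v)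
  · intro h v f x hx v1 f1 y hy v2 f2
    simpa using h v2 (K.comp f (K.comp f1 f2)) (x ⇡ K.comp f1 f2) (y ⇡ f2)
      (by simpa using mem_res' hx (K.comp f1 f2)) (by simpa using mem_res' hy f2)

variable [CZFModel K]

/-! ### Ranges and zips -/

theorem exists_ran (t : K.M w) : ∃ c, ∀ v (f : K.Hom w v) x,
    x ∈ c ⇡ f ↔ ∃ b, ⟪b, x⟫ ∈ t ⇡ f := by
  obtain ⟨c, hc⟩ := separation (bex 1 (bPairMem 0 1 3)) (by simp)
    (sUnion (sUnion t) ⦂ t ⦂ nil w) (sUnion (sUnion t))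
  refine ⟨c, fun v f x => ?_⟩
  rw [hc]
  simp only [res_sUnion, cons_res, forces_bex, forces_bPairMem, cons_zero, cons_succ]
  constructor
  · rintro ⟨-, b, -, h⟩
    exact ⟨b, h⟩
  · rintro ⟨b, h⟩
    refine ⟨mem_sUnion_sUnion h, b, ?_, h⟩
    simp only [mem_sUnion]
    exact ⟨sing b, ⟨_, h, by simp [opair]⟩, by simp⟩

/-- The range of a relation. -/
noncomputable def ran (t : K.M w) : K.M w := Classical.choose (exists_ran t)

@[simp] theorem mem_ran {t x : K.M w} : x ∈ ran t ↔ ∃ b, ⟪b, x⟫ ∈ t := by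
  simpa [ran] using Classical.choose_spec (exists_ran t) w (K.idn w) x

@[simp] theorem res_ran (t : K.M w) (f : K.Hom w v) : (ran t) ⇡ f = ran (t ⇡ f) :=
  ext fun u g x => by
    have h1 := Classical.choose_spec (exists_ran t) u (K.comp f g) x
    have h2 := Classical.choose_spec (exists_ran (t ⇡ f)) u g x
    rw [res_comp, ran, ran, h1, h2]; simp

/-- The formula `r = ran t`. -/
def ranFml (r t : ℕ) : Fml := ∀ₛ (0 ∈ₛ r + 1 ↔ₛ ∃ₛ (pairMem 0 1 (t + 2)))

@[simp] theorem forces_ranFml {e : ℕ → K.M w} {r t : ℕ} :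
    Forces (ranFml r t) w e ↔ e r = ran (e t) := by
  rw [ranFml, forces_all_iff, eq_iff_of_mem_iff (P := fun v f x => ∃ b, ⟪b, x⟫ ∈ e t ⇡ f)]
  · simp
  · simp

theorem exists_zip (t s : K.M w) : ∃ c, ∀ v (f : K.Hom w v) z,
    z ∈ c ⇡ f ↔ ∃ b x y, ⟪b, x⟫ ∈ t ⇡ f ∧ ⟪b, y⟫ ∈ s ⇡ f ∧ z = ⟪x, y⟫ := by
  obtain ⟨c, hc⟩ := separation
    (bex 1 (bex 3 (bex 5 (bPairMem 2 1 7 ∧ₛ bPairMem 2 0 8 ∧ₛ bPair 3 1 0)))) (by simp)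
    (sUnion (sUnion t) ⦂ ran t ⦂ ran s ⦂ t ⦂ s ⦂ nil w) (prod (ran t) (ran s))
  refine ⟨c, fun v f z => ?_⟩
  rw [hc]
  simp only [res_sUnion, res_ran, res_prod, cons_res, forces_bex, forces_and, forces_bPair,
    forces_bPairMem, cons_zero, cons_succ]
  constructor
  · rintro ⟨-, b, -, x, -, y, -, h⟩
    exact ⟨b, x, y, h⟩
  · rintro ⟨b, x, y, h₁, h₂, rfl⟩
    have hx : x ∈ ran (t ⇡ f) := mem_ran.2 ⟨b, h₁⟩
    have hy : y ∈ ran (s ⇡ f) := mem_ran.2 ⟨b, h₂⟩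
    refine ⟨opair_mem_prod.2 ⟨hx, hy⟩, b, ?_, x, hx, y, hy, h₁, h₂, rfl⟩
    simp only [mem_sUnion]
    exact ⟨sing b, ⟨_, h₁, by simp [opair]⟩, by simp⟩

/-- The relation between the values of two functions at the same argument. -/
noncomputable def zip (t s : K.M w) : K.M w := Classical.choose (exists_zip t s)

@[simp] theorem mem_zip {t s z : K.M w} :
    z ∈ zip t s ↔ ∃ b x y, ⟪b, x⟫ ∈ t ∧ ⟪b, y⟫ ∈ s ∧ z = ⟪x, y⟫ := by
  simpa [zip] using Classical.choose_spec (exists_zip t s) w (K.idn w) z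

@[simp] theorem res_zip (t s : K.M w) (f : K.Hom w v) : (zip t s) ⇡ f = zip (t ⇡ f) (s ⇡ f) :=
  ext fun u g x => by
    have h1 := Classical.choose_spec (exists_zip t s) u (K.comp f g) x
    have h2 := Classical.choose_spec (exists_zip (t ⇡ f) (s ⇡ f)) u g x
    rw [res_comp, zip, zip, h1, h2]; simp

/-- The formula `z = zip t s`. -/
def zipFml (z t s : ℕ) : Fml :=
  ∀ₛ (0 ∈ₛ z + 1 ↔ₛ ∃ₛ ∃ₛ ∃ₛ (pairMem 2 1 (t + 4) ∧ₛ pairMem 2 0 (s + 4) ∧ₛ isPair 3 1 0))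

@[simp] theorem forces_zipFml {e : ℕ → K.M w} {z t s : ℕ} :
    Forces (zipFml z t s) w e ↔ e z = zip (e t) (e s) := by
  rw [zipFml, forces_all_iff, eq_iff_of_mem_iff
    (P := fun v f z => ∃ b x y, ⟪b, x⟫ ∈ e t ⇡ f ∧ ⟪b, y⟫ ∈ e s ⇡ f ∧ z = ⟪x, y⟫)]
  · simp
  · simp

/-! ### Minimal algebras with an injective structure map -/

/-- `(W, s)` is an algebra for the polynomial functor of `p` with an injective structure map and
without proper subalgebras. -/
structure IsTree (p A W s : K.M w) : Prop where
  alg : IsFun s (poly p A W) W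
  inj : ∀ v (f : K.Hom w v) q q' x, ⟪q, x⟫ ∈ s ⇡ f → ⟪q', x⟫ ∈ s ⇡ f → q = q'
  least : ∀ v (f : K.Hom w v) Y, (∀ u (g : K.Hom v u) a t x, ⟪⟪a, t⟫, x⟫ ∈ s ⇡ f ⇡ g →
    Sub (ran t) (Y ⇡ g) → x ∈ Y ⇡ g) → Sub (W ⇡ f) Y

theorem IsFun.sub_ran {t F Y : K.M w} (h : IsFun t F Y) : Sub (ran t) Y := by
  intro v f x hx
  rw [res_ran, mem_ran] at hx
  obtain ⟨b, hb⟩ := hx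
  exact (h.res f).mem_cod hb

theorem IsFun.of_sub_ran {t F X Y : K.M w} (h : IsFun t F X) (h' : Sub (ran t) Y) :
    IsFun t F Y := by
  refine h.mono fun v f b x hb => h' v f x ?_
  rw [res_ran, mem_ran]
  exact ⟨b, hb⟩

/-- `W` is generated inside `N` by the rules "if `ran t ⊆ W` then `s₀(a, t) ∈ W`". The structure map
is the restriction of `s₀`, hence still injective. -/
theorem exists_tree (hN : ∃ e : ℕ → K.M w, Forces NID w e) (p A : K.M w) :
    ∃ W s, IsTree p A W s := by
  obtain ⟨N, s₀, hs, hinj⟩ := exists_injective_algebra p A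
  obtain ⟨Φ, hΦ⟩ := image (P := fun v f m z => ∃ a t x, m = ⟪⟪a, t⟫, x⟫ ∧ z = ⟪ran t, x⟫)
    (∃ₛ ∃ₛ ∃ₛ ∃ₛ ∃ₛ (isPair 1 4 3 ∧ₛ isPair 6 1 2 ∧ₛ ranFml 0 3 ∧ₛ isPair 5 0 2)) (nil w) s₀
    (by intro v f m z; simp) (by
      intro v f m hm
      obtain ⟨q, hq, x, hx, rfl⟩ := (hs.res f).exists_eq hm
      rw [res_poly, mem_poly] at hq
      obtain ⟨a, ha, t, ht, rfl⟩ := hq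
      exact ⟨_, a, t, x, rfl, rfl⟩) (by
      rintro v f m - _ _ ⟨a, t, x, rfl, rfl⟩ ⟨a', t', x', e, rfl⟩
      simp only [opair_inj] at e
      obtain ⟨⟨rfl, rfl⟩, rfl⟩ := e
      rfl)
  have hs₀ : ∀ v (f : K.Hom w v) a t x, ⟪⟪a, t⟫, x⟫ ∈ s₀ ⇡ f →
      a ∈ A ⇡ f ∧ IsFun t (fib (p ⇡ f) a) (N ⇡ f) ∧ x ∈ N ⇡ f := by
    intro v f a t x h
    have h1 := (hs.res f).mem_dom h
    rw [res_poly, opair_mem_poly] at h1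
    exact ⟨h1.1, h1.2, (hs.res f).mem_cod h⟩
  obtain ⟨W, hW, hWN⟩ := exists_lfp hN N Φ (by
    intro v f z hz
    obtain ⟨m, hm, a, t, x, rfl, rfl⟩ := (hΦ v f z).1 hz
    obtain ⟨-, ht, hx⟩ := hs₀ v f a t x hm
    exact ⟨_, _, rfl, ht.sub_ran, hx⟩)
  obtain ⟨s, hsW, h⟩ := exists_fun (P := fun v f q x => ⟪q, x⟫ ∈ s₀ ⇡ f) (pairMem 1 0 2)
    (s₀ ⦂ nil w) (poly p A W) W (by intro v f q x; simp) (by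
      intro v f q hq
      rw [res_poly, mem_poly] at hq
      obtain ⟨a, ha, t, ht, rfl⟩ := hq
      have htN : IsFun t (fib (p ⇡ f) a) (N ⇡ f) :=
        ht.of_sub_ran (ht.sub_ran.trans (hWN.res f))
      obtain ⟨x, hx, hqx⟩ := (hs.res f).exists_val (x := ⟪a, t⟫)
        (by rw [res_poly, opair_mem_poly]; exact ⟨ha, htN⟩)
      refine ⟨x, hW.closed v f (ran t) x ?_ ht.sub_ran, hqx⟩
      exact (hΦ v f _).2 ⟨_, hqx, a, t, x, rfl, rfl⟩)
    (by intro v f q hq x x' hx hx'; exact (hs.res f).eq hx hx')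
  refine ⟨W, s, hsW, fun v f q q' x hx hx' => ?_, fun v f Y hY => ?_⟩
  · exact hinj v f q q' x ((h _ _ _ _).1 hx).2 ((h _ _ _ _).1 hx').2
  · have := (hW.res f).induction (P := fun u g x => x ∈ Y ⇡ g) (0 ∈ₛ 1) (by simp) (Y ⦂ nil v)
      (by intro u g x; simp) (by
        intro u g a x hax haW ha
        rw [res_comp, hΦ] at hax
        obtain ⟨m, hm, a, t, x, rfl, e⟩ := hax
        rw [opair_inj] at e
        obtain ⟨rfl, rfl⟩ := e
        obtain ⟨haA, ht, -⟩ := hs₀ u _ a t x hm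
        refine hY u g a t x ?_ (fun u' g' y hy => by simpa using ha u' g' y hy)
        rw [res_comp, h]
        refine ⟨?_, hm⟩
        rw [res_poly, opair_mem_poly]
        refine ⟨haA, ht.of_sub_ran ?_⟩
        simpa using haW)
    exact this

namespace IsTree

variable {p A W s : K.M w}

theorem res (h : IsTree p A W s) (f : K.Hom w v) : IsTree (p ⇡ f) (A ⇡ f) (W ⇡ f) (s ⇡ f) := by
  refine ⟨by simpa using h.alg.res f, fun u g => ?_, fun u g => ?_⟩
  · simpa using h.inj u (K.comp f g)
  · simpa using h.least u (K.comp f g)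

theorem mem_dom (h : IsTree p A W s) {a t x : K.M w} (hx : ⟪⟪a, t⟫, x⟫ ∈ s) :
    a ∈ A ∧ IsFun t (fib p a) W ∧ x ∈ W := by
  have h1 := h.alg.mem_dom hx
  rw [opair_mem_poly] at h1
  exact ⟨h1.1, h1.2, h.alg.mem_cod hx⟩

theorem eq (h : IsTree p A W s) {a t a' t' x : K.M w} (hx : ⟪⟪a, t⟫, x⟫ ∈ s)
    (hx' : ⟪⟪a', t'⟫, x⟫ ∈ s) : a = a' ∧ t = t' := by
  have := h.inj w (K.idn w) _ _ x (by simpa using hx) (by simpa using hx')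
  simpa using this

theorem induction (h : IsTree p A W s) {P : ∀ v, K.Hom w v → K.M v → Prop} (φ : Fml)
    (hφ : φ.IsBounded) (e : ℕ → K.M w)
    (hP : ∀ v f x, Forces φ v (x ⦂ fun k => e k ⇡ f) ↔ P v f x)
    (H : ∀ v f a t x, ⟪⟪a, t⟫, x⟫ ∈ s ⇡ f →
      (∀ u (g : K.Hom v u) b y, ⟪b, y⟫ ∈ t ⇡ g → P u (K.comp f g) y) → P v f x) :
    ∀ v f x, x ∈ W ⇡ f → P v f x := by
  obtain ⟨Y, hY⟩ := separation φ hφ e W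
  simp only [hP] at hY
  have := h.least w (K.idn w) Y (by
    intro u g a t x hx ht
    rw [res_id] at hx
    rw [hY]
    refine ⟨(h.alg.res g).mem_cod hx, H u g a t x hx fun u' g' b y hy => ?_⟩
    have h1 := ht u' g' y (by rw [res_ran, mem_ran]; exact ⟨b, hy⟩)
    rw [res_comp, hY] at h1
    exact h1.2)
  intro v f x hx
  exact ((hY v f x).1 (this v f x (by simpa using hx))).2

end IsTree

/-! ### Recursion -/

/-- `z` is the rule that is given by the element `m` of the graph of one structure map and the
element `n` of the graph of another one. -/
def IsRecRule (m n z : K.M w) : Prop := ∃ a t x r y,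
  m = ⟪⟪a, t⟫, x⟫ ∧ n = ⟪⟪a, r⟫, y⟫ ∧ z = ⟪zip t r, ⟪x, y⟫⟫

/-- The formula that defines `IsRecRule`. -/
def recRuleFml (m n z : ℕ) : Fml :=
  ∃ₛ ∃ₛ ∃ₛ ∃ₛ ∃ₛ ∃ₛ ∃ₛ ∃ₛ ∃ₛ (isPair 3 8 7 ∧ₛ isPair (m + 9) 3 6 ∧ₛ
    isPair 2 8 5 ∧ₛ isPair (n + 9) 2 4 ∧ₛ zipFml 1 7 5 ∧ₛ isPair 0 6 4 ∧ₛ isPair (z + 9) 1 0)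

@[simp] theorem forces_recRuleFml {e : ℕ → K.M w} {m n z : ℕ} :
    Forces (recRuleFml m n z) w e ↔ IsRecRule (e m) (e n) (e z) := by
  simp [recRuleFml, IsRecRule]

/-- `Γ` is the smallest subalgebra of the product of `(W, s)` and `(X, r)`. -/
structure IsRecGraph (s X r W Γ Ψ : K.M w) : Prop where
  lfp : IsLfp Γ Ψ
  sub : Sub Γ (prod W X)
  rules : ∀ v (f : K.Hom w v) z, z ∈ Ψ ⇡ f ↔ ∃ m ∈ s ⇡ f, ∃ n ∈ r ⇡ f, IsRecRule m n z

theorem exists_recGraph (hN : ∃ e : ℕ → K.M w, Forces NID w e)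
    {p A W s X r : K.M w} (hW : IsTree p A W s) (hX : IsFun r (poly p A X) X) :
    ∃ Γ Ψ, IsRecGraph s X r W Γ Ψ := by
  have hr : ∀ v (f : K.Hom w v) n, n ∈ r ⇡ f → ∃ a ∈ A ⇡ f, ∃ t,
      IsFun t (fib (p ⇡ f) a) (X ⇡ f) ∧ ∃ y ∈ X ⇡ f, n = ⟪⟪a, t⟫, y⟫ := by
    intro v f n hn
    obtain ⟨q, hq, y, hy, rfl⟩ := (hX.res f).exists_eq hn
    rw [res_poly, mem_poly] at hq
    obtain ⟨a, ha, t, ht, rfl⟩ := hq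
    exact ⟨a, ha, t, ht, y, hy, rfl⟩
  have hs : ∀ v (f : K.Hom w v) n, n ∈ s ⇡ f → ∃ a ∈ A ⇡ f, ∃ t,
      IsFun t (fib (p ⇡ f) a) (W ⇡ f) ∧ ∃ y ∈ W ⇡ f, n = ⟪⟪a, t⟫, y⟫ := by
    intro v f n hn
    obtain ⟨q, hq, y, hy, rfl⟩ := (hW.alg.res f).exists_eq hn
    rw [res_poly, mem_poly] at hq
    obtain ⟨a, ha, t, ht, rfl⟩ := hq
    exact ⟨a, ha, t, ht, y, hy, rfl⟩
  obtain ⟨Ψ, hΨ⟩ := union_image (P := fun v f m z => ∃ n ∈ r ⇡ f, IsRecRule m n z)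
    (bex 2 (recRuleFml 2 0 1)) (r ⦂ nil w) s (by intro v f m z; simp) fun v f m hm => by
    obtain ⟨c, hc⟩ := union_image (P := fun u g n z => IsRecRule (m ⇡ g) n z)
      (recRuleFml 2 1 0) (m ⦂ nil v) (r ⇡ f) (by intro u g n z; simp) fun u g n hn => by
      obtain ⟨a, -, t, -, x, -, rfl⟩ := hs v f m hm
      obtain ⟨a', -, t', -, y, -, rfl⟩ := hr u (K.comp f g) n (by simpa using hn)
      -- The labels `a` and `a'` need not be decidably equal. The pair contributes a subsingleton of
      -- rules, cut out of a singleton by the condition that they agree.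
      obtain ⟨S, hS⟩ := separation (1 =ₛ 2) (by simp) (a ⇡ g ⦂ a' ⦂ nil u)
        (sing ⟪zip (t ⇡ g) t', ⟪x ⇡ g, y⟫⟫)
      refine ⟨S, fun u' g' z => ?_⟩
      rw [hS]
      simp only [IsRecRule, res_opair, opair_inj, res_sing, mem_sing, res_zip, res_comp,
        forces_eq, cons_succ, cons_zero, cons_res]
      constructor
      · rintro ⟨rfl, e⟩
        exact ⟨_, _, _, _, _, ⟨⟨rfl, rfl⟩, rfl⟩, ⟨⟨e.symm, rfl⟩, rfl⟩, rfl⟩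
      · rintro ⟨_, _, _, _, _, ⟨⟨rfl, rfl⟩, rfl⟩, ⟨⟨e, rfl⟩, rfl⟩, rfl⟩
        exact ⟨rfl, e.symm⟩
    exact ⟨c, by simpa using hc⟩
  obtain ⟨Γ, hΓ, hsub⟩ := exists_lfp hN (prod W X) Ψ (by
    intro v f z hz
    obtain ⟨m, hm, n, hn, a, t, x, t', y, rfl, rfl, rfl⟩ := (hΨ v f z).1 hz
    obtain ⟨_, -, _, ht, _, hx, e⟩ := hs v f _ hm
    simp only [opair_inj] at e
    obtain ⟨⟨rfl, rfl⟩, rfl⟩ := e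
    obtain ⟨_, -, _, ht', _, hy, e⟩ := hr v f _ hn
    simp only [opair_inj] at e
    obtain ⟨⟨rfl, rfl⟩, rfl⟩ := e
    refine ⟨_, _, rfl, fun u g z hz => ?_, ?_⟩
    · rw [res_zip, mem_zip] at hz
      obtain ⟨b, x', y', h₁, h₂, rfl⟩ := hz
      rw [res_prod, res_prod, opair_mem_prod]
      exact ⟨(ht.res g).mem_cod h₁, (ht'.res g).mem_cod h₂⟩
    · rw [res_prod, opair_mem_prod]
      exact ⟨hx, hy⟩)
  exact ⟨Γ, Ψ, hΓ, hsub, hΨ⟩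

namespace IsRecGraph

variable {p A W s X r Γ Ψ : K.M w}

theorem res (h : IsRecGraph s X r W Γ Ψ) (f : K.Hom w v) :
    IsRecGraph (s ⇡ f) (X ⇡ f) (r ⇡ f) (W ⇡ f) (Γ ⇡ f) (Ψ ⇡ f) := by
  refine ⟨h.lfp.res f, by simpa using h.sub.res f, fun u g => ?_⟩
  simpa using h.rules u (K.comp f g)

theorem closed (h : IsRecGraph s X r W Γ Ψ) {a t x t' y : K.M w} (hx : ⟪⟪a, t⟫, x⟫ ∈ s)
    (hy : ⟪⟪a, t'⟫, y⟫ ∈ r) (H : Sub (zip t t') Γ) : ⟪x, y⟫ ∈ Γ := by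
  refine h.lfp.mem (a := zip t t') ?_ H
  have := (h.rules w (K.idn w) ⟪zip t t', ⟪x, y⟫⟫).2
  simp only [res_id] at this
  exact this ⟨_, hx, _, hy, a, t, x, t', y, rfl, rfl, rfl⟩

theorem exists_eq (h : IsRecGraph s X r W Γ Ψ) {x y : K.M w} (hxy : ⟪x, y⟫ ∈ Γ) :
    ∃ a t t', ⟪⟪a, t⟫, x⟫ ∈ s ∧ ⟪⟪a, t'⟫, y⟫ ∈ r ∧ Sub (zip t t') Γ := by
  obtain ⟨c, hc, hs⟩ := h.lfp.exists_rule hxy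
  have := (h.rules w (K.idn w) ⟪c, ⟪x, y⟫⟫).1
  simp only [res_id] at this
  obtain ⟨m, hm, n, hn, a, t, x, t', y, rfl, rfl, e⟩ := this hc
  simp only [opair_inj] at e
  obtain ⟨rfl, rfl, rfl⟩ := e
  exact ⟨a, t, t', hm, hn, hs⟩

/-- Here injectivity of `s` is decisive: the rule that put `⟪x, y⟫` into `Γ` must use the given
presentation `⟪a, t⟫` of `x`. -/
theorem exists_of_mem (h : IsRecGraph s X r W Γ Ψ) (hW : IsTree p A W s)
    (hX : IsFun r (poly p A X) X) {x y : K.M w} (hxy : ⟪x, y⟫ ∈ Γ) {a t : K.M w}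
    (hx : ⟪⟪a, t⟫, x⟫ ∈ s) : ∃ t', IsFun t' (fib p a) X ∧ ⟪⟪a, t'⟫, y⟫ ∈ r ∧ Sub (zip t t') Γ := by
  obtain ⟨a', t₁, t', hx', hy, hs⟩ := h.exists_eq hxy
  obtain ⟨rfl, rfl⟩ := hW.eq hx hx'
  have h1 := hX.mem_dom hy
  rw [opair_mem_poly] at h1
  exact ⟨t', h1.2, hy, hs⟩

end IsRecGraph

theorem Sub.zip_mem {t t' Γ b x y : K.M w} (h : Sub (zip t t') Γ) (hx : ⟪b, x⟫ ∈ t)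
    (hy : ⟪b, y⟫ ∈ t') : ⟪x, y⟫ ∈ Γ := h.mem (mem_zip.2 ⟨b, x, y, hx, hy, rfl⟩)

namespace IsRecGraph

variable {p A W s X r Γ Ψ : K.M w}

/-- For existence, `Γ` is functional on the values of `t`, so `Γ ∘ t` is a function to which `r`
applies. For uniqueness, two values of `x` arise from functions `t₁` and `t₂` that both equal `Γ ∘
t`. -/
theorem exists_unique_step (h : IsRecGraph s X r W Γ Ψ) (hW : IsTree p A W s)
    (hX : IsFun r (poly p A X) X) {a t x : K.M w} (hx : ⟪⟪a, t⟫, x⟫ ∈ s)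
    (hE : ∀ v (f : K.Hom w v) b z, ⟪b, z⟫ ∈ t ⇡ f → ∃ y ∈ X ⇡ f, ⟪z, y⟫ ∈ Γ ⇡ f)
    (hU : ∀ v (f : K.Hom w v) b z, ⟪b, z⟫ ∈ t ⇡ f →
      ∀ y y', ⟪z, y⟫ ∈ Γ ⇡ f → ⟪z, y'⟫ ∈ Γ ⇡ f → y = y') :
    (∃ y ∈ X, ⟪x, y⟫ ∈ Γ) ∧ ∀ y y', ⟪x, y⟫ ∈ Γ → ⟪x, y'⟫ ∈ Γ → y = y' := by
  obtain ⟨ha, ht, hxW⟩ := hW.mem_dom hx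
  constructor
  · obtain ⟨t', ht', h'⟩ := exists_fun
      (P := fun v f b y => ∃ z, ⟪b, z⟫ ∈ t ⇡ f ∧ ⟪z, y⟫ ∈ Γ ⇡ f)
      (∃ₛ (pairMem 2 0 3 ∧ₛ pairMem 0 1 4)) (t ⦂ Γ ⦂ nil w) (fib p a) X
      (by intro v f b y; simp) (by
        intro v f b hb
        obtain ⟨z, -, hz⟩ := (ht.res f).exists_val hb
        obtain ⟨y, hy, hzy⟩ := hE v f b z hz
        exact ⟨y, hy, z, hz, hzy⟩) (by
        rintro v f b hb y y' ⟨z, hz, hy⟩ ⟨z', hz', hy'⟩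
        obtain rfl := (ht.res f).eq hz hz'
        exact hU v f b z hz y y' hy hy')
    obtain ⟨y, hy, hqy⟩ := hX.exists_val (opair_mem_poly.2 ⟨ha, ht'⟩)
    refine ⟨y, hy, h.closed hx hqy fun v f c hc => ?_⟩
    rw [res_zip, mem_zip] at hc
    obtain ⟨b, z, y', hz, hy', rfl⟩ := hc
    obtain ⟨-, z', hz', hy'⟩ := (h' v f b y').1 hy'
    rwa [(ht.res f).eq hz hz']
  · intro y y' hy hy'
    obtain ⟨t₁, ht₁, hy₁, hs₁⟩ := h.exists_of_mem hW hX hy hx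
    obtain ⟨t₂, ht₂, hy₂, hs₂⟩ := h.exists_of_mem hW hX hy' hx
    suffices t₁ = t₂ by
      subst this
      exact hX.eq hy₁ hy₂
    refine ht₁.ext ht₂ fun v f b z hz => ?_
    have hb := (ht₁.res f).mem_dom hz
    obtain ⟨z', -, hz'⟩ := (ht₂.res f).exists_val hb
    obtain ⟨m, -, hm⟩ := (ht.res f).exists_val hb
    have e₁ := hs₁.res f
    have e₂ := hs₂.res f
    rw [res_zip] at e₁ e₂
    rwa [hU v f b m hm z z' (e₁.zip_mem hm hz) (e₂.zip_mem hm hz')]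

theorem isFun (h : IsRecGraph s X r W Γ Ψ) (hW : IsTree p A W s)
    (hX : IsFun r (poly p A X) X) : IsFun Γ W X := by
  have hΓ : ∀ v (f : K.Hom w v) x y, ⟪x, y⟫ ∈ Γ ⇡ f → x ∈ W ⇡ f ∧ y ∈ X ⇡ f := by
    intro v f x y hxy
    have := h.sub v f _ hxy
    rwa [res_prod, opair_mem_prod] at this
  have key := hW.induction (P := fun v f x => (∃ y ∈ X ⇡ f, ⟪x, y⟫ ∈ Γ ⇡ f) ∧
      ∀ u (g : K.Hom v u) y y', y ∈ X ⇡ K.comp f g → y' ∈ X ⇡ K.comp f g →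
        ⟪x ⇡ g, y⟫ ∈ Γ ⇡ K.comp f g ∧ ⟪x ⇡ g, y'⟫ ∈ Γ ⇡ K.comp f g → y = y')
    -- Restricting the values to `X` makes the predicate bounded, as induction on `W` requires;
    -- nothing is lost, since `Γ ⊆ W × X`.
    (bex 1 (bPairMem 1 0 3) ∧ₛ
      ball 1 (ball (1 + 1) (bPairMem 2 1 4 ∧ₛ bPairMem 2 0 4 →ₛ 1 =ₛ 0))) (by simp)
    (X ⦂ Γ ⦂ nil w) (by intro v f x; rw [forces_and, forces_ball_ball_imp]; simp) (by
      intro v f a t x hx ih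
      have hX' : IsFun (r ⇡ f) (poly (p ⇡ f) (A ⇡ f) (X ⇡ f)) (X ⇡ f) := by
        simpa using hX.res f
      have hE : ∀ u (g : K.Hom v u) b z, ⟪b, z⟫ ∈ t ⇡ g →
          ∃ y ∈ X ⇡ K.comp f g, ⟪z, y⟫ ∈ Γ ⇡ K.comp f g :=
        fun u g b z hz => (ih u g b z hz).1
      have hU : ∀ u (g : K.Hom v u) b z, ⟪b, z⟫ ∈ t ⇡ g → ∀ y y',
          ⟪z, y⟫ ∈ Γ ⇡ K.comp f g → ⟪z, y'⟫ ∈ Γ ⇡ K.comp f g → y = y' := by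
        intro u g b z hz y y' hy hy'
        have := (ih u g b z hz).2 u (K.idn u) y y'
        simp only [comp_idn, res_id] at this
        exact this (hΓ _ _ _ _ hy).2 (hΓ _ _ _ _ hy').2 ⟨hy, hy'⟩
      refine ⟨((h.res f).exists_unique_step (hW.res f) hX' hx (by simpa using hE)
        (by simpa using hU)).1, fun u g y y' _ _ hyy => ?_⟩
      have hXg : IsFun (r ⇡ K.comp f g)
          (poly (p ⇡ K.comp f g) (A ⇡ K.comp f g) (X ⇡ K.comp f g)) (X ⇡ K.comp f g) := by
        simpa using hX.res (K.comp f g)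
      refine ((h.res (K.comp f g)).exists_unique_step (hW.res _) hXg (a := a ⇡ g) (t := t ⇡ g)
        (x := x ⇡ g) (by simpa using mem_res' hx g) ?_ ?_).2 y y' hyy.1 hyy.2
      · intro u' g' b z hz
        simpa using hE u' (K.comp g g') b z (by simpa using hz)
      · intro u' g' b z hz
        simpa using hU u' (K.comp g g') b z (by simpa using hz))
  refine ⟨fun v f q hq => ?_, fun v f x hx => ?_, fun v f x y y' hy hy' => ?_⟩
  · have := h.sub v f q hq
    rwa [res_prod, mem_prod] at this
  · obtain ⟨⟨y, -, hy⟩, -⟩ := key v f x hx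
    exact ⟨y, hy⟩
  · have := (key v f x (hΓ _ _ _ _ hy).1).2 v (K.idn v) y y'
    simp only [comp_idn, res_id] at this
    exact this (hΓ _ _ _ _ hy).2 (hΓ _ _ _ _ hy').2 ⟨hy, hy'⟩

end IsRecGraph

/-! ### Morphisms and initiality -/

@[simp] theorem forces_isAlg {e : ℕ → K.M w} {p A X s : ℕ} :
    Forces (isAlg p A X s) w e ↔ IsFun (e s) (poly (e p) (e A) (e X)) (e X) := by
  simp [isAlg]

/-- `c` is the composite of `α` and `t`. -/
def IsComposite (c α t : K.M w) : Prop := ∀ v (f : K.Hom w v) z, z ∈ c ⇡ f ↔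
  ∃ b x y, ⟪b, x⟫ ∈ t ⇡ f ∧ ⟪x, y⟫ ∈ α ⇡ f ∧ z = ⟪b, y⟫

@[simp] theorem forces_isComp {e : ℕ → K.M w} {c α t : ℕ} :
    Forces (isComp c α t) w e ↔ IsComposite (e c) (e α) (e t) := by
  rw [isComp, forces_all_iff]
  simp [IsComposite]

/-- `α` is a morphism of algebras from `(X, s)` to `(Y, r)`. -/
structure IsMorphism (α X s Y r : K.M w) : Prop where
  isFun : IsFun α X Y
  map : ∀ v (f : K.Hom w v) q x, ⟪q, x⟫ ∈ s ⇡ f → ∃ a t c y, q = ⟪a, t⟫ ∧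
    IsComposite c (α ⇡ f) t ∧ ⟪x, y⟫ ∈ α ⇡ f ∧ ⟪⟪a, c⟫, y⟫ ∈ r ⇡ f

@[simp] theorem forces_isMor {e : ℕ → K.M w} {α X s Y r : ℕ} :
    Forces (isMor α X s Y r) w e ↔ IsMorphism (e α) (e X) (e s) (e Y) (e r) := by
  rw [isMor, forces_and, forces_all_all_imp]
  simp only [forces_isFun, forces_pairMem, forces_ex, forces_and, isPolyMap, forces_isPair,
    forces_isComp, cons_zero, cons_succ]
  constructor
  · rintro ⟨h₁, h₂⟩
    refine ⟨h₁, fun v f q x hx => ?_⟩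
    obtain ⟨_, y, ⟨a, t, c, rfl, rfl, hc⟩, hxy, hy⟩ := h₂ v f q x hx
    exact ⟨a, t, c, y, rfl, hc, hxy, hy⟩
  · rintro ⟨h₁, h₂⟩
    refine ⟨h₁, fun v f q x hx => ?_⟩
    obtain ⟨a, t, c, y, rfl, hc, hxy, hy⟩ := h₂ v f q x hx
    exact ⟨_, y, ⟨a, t, c, rfl, rfl, hc⟩, hxy, hy⟩

theorem IsRecGraph.isMorphism {p A W s X r Γ Ψ : K.M w} (h : IsRecGraph s X r W Γ Ψ)
    (hW : IsTree p A W s) (hX : IsFun r (poly p A X) X) : IsMorphism Γ W s X r := by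
  have hΓ := h.isFun hW hX
  refine ⟨hΓ, fun v f q x hx => ?_⟩
  obtain ⟨q, hq, _, hxW, e⟩ := (hW.alg.res f).exists_eq hx
  rw [opair_inj] at e
  obtain ⟨rfl, rfl⟩ := e
  rw [res_poly, mem_poly] at hq
  obtain ⟨a, ha, t, ht, rfl⟩ := hq
  obtain ⟨y, hy, hxy⟩ := (hΓ.res f).exists_val hxW
  obtain ⟨t', ht', hy', hs⟩ := (h.res f).exists_of_mem (hW.res f) (by simpa using hX.res f) hxy hx
  refine ⟨a, t, t', y, rfl, fun u g z => ⟨fun hz => ?_, ?_⟩, hxy, hy'⟩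
  · obtain ⟨b, hb, y', -, rfl⟩ := (ht'.res g).exists_eq hz
    obtain ⟨m, -, hm⟩ := (ht.res g).exists_val hb
    have e₁ := hs.res g
    rw [res_zip] at e₁
    exact ⟨b, m, y', hm, e₁.zip_mem hm hz, rfl⟩
  · rintro ⟨b, m, y', hm, hmy, rfl⟩
    obtain ⟨y₂, -, hy₂⟩ := (ht'.res g).exists_val ((ht.res g).mem_dom hm)
    have e₁ := hs.res g
    rw [res_zip] at e₁
    rwa [((hΓ.res f).res g).eq hmy (e₁.zip_mem hm hy₂)]

/-- The graph of a morphism is closed under the rules generating `Γ`, so it contains `Γ`; two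
functions on `W` with one graph inside the other are equal. -/
theorem IsRecGraph.eq_of_isMorphism {p A W s X r Γ Ψ α : K.M w} (h : IsRecGraph s X r W Γ Ψ)
    (hW : IsTree p A W s) (hX : IsFun r (poly p A X) X) (hα : IsMorphism α W s X r) : α = Γ := by
  have hΓ := h.isFun hW hX
  suffices Sub Γ α from (hΓ.ext hα.isFun fun v f x y hxy => this v f _ hxy).symm
  refine h.lfp.sub fun v f c z hc hs => ?_
  obtain ⟨m, hm, n, hn, a, t, x, t', y, rfl, rfl, e⟩ := (h.rules v f _).1 hc
  rw [opair_inj] at e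
  obtain ⟨rfl, rfl⟩ := e
  obtain ⟨a', t₁, d, y', e, hd, hxy, hy⟩ := hα.map v f _ _ hm
  rw [opair_inj] at e
  obtain ⟨rfl, rfl⟩ := e
  have ht := ((hW.res f).mem_dom hm).2.1
  have ht' := (hX.res f).mem_dom hn
  rw [res_poly, opair_mem_poly] at ht'
  have ht' := ht'.2
  suffices d = t' by
    subst this
    rwa [(hX.res f).eq hn hy]
  refine ext fun u g z => ?_
  have e₁ := hs.res g
  rw [res_zip] at e₁
  rw [hd]
  constructor
  · rintro ⟨b, m, y', hm, hmy, rfl⟩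
    obtain ⟨y₂, -, hy₂⟩ := (ht'.res g).exists_val ((ht.res g).mem_dom hm)
    rwa [((hα.isFun.res f).res g).eq hmy (e₁.zip_mem hm hy₂)]
  · intro hz
    obtain ⟨b, hb, y', -, rfl⟩ := (ht'.res g).exists_eq hz
    obtain ⟨m, -, hm⟩ := (ht.res g).exists_val hb
    exact ⟨b, m, y', hm, e₁.zip_mem hm hz, rfl⟩

theorem forces_wTypesExist (hN : ∃ e : ℕ → K.M w, Forces NID w e)
    (e : ℕ → K.M w) : Forces WTypesExist w e := by
  -- NID is needed at two later worlds: where `f` is given, to build `W`, and where a competing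
  -- algebra appears, to build the recursion graph.
  have hN' : ∀ v (_ : K.Hom w v), ∃ e : ℕ → K.M v, Forces NID v e := fun v f =>
    hN.elim fun e he => ⟨_, forces_res _ f he⟩
  intro v₁ f₁ B v₂ f₂ A
  rw [forces_all_imp]
  intro v f p _
  obtain ⟨W, s, hW⟩ := exists_tree (hN' v (K.comp f₁ (K.comp f₂ f))) p (A ⇡ f)
  refine ⟨W, s, ?_, ?_⟩
  · rw [forces_isAlg]
    exact hW.alg
  intro u₁ g₁ X
  rw [forces_all_imp]
  intro u g r hr
  rw [forces_isAlg] at hr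
  have hWg := hW.res (K.comp g₁ g)
  obtain ⟨Γ, Ψ, h⟩ := exists_recGraph
    (hN' u (K.comp f₁ (K.comp f₂ (K.comp f (K.comp g₁ g))))) hWg (X := X ⇡ g) (r := r) (by simpa using hr)
  have hr' : IsFun r (poly (p ⇡ K.comp g₁ g) (A ⇡ f ⇡ K.comp g₁ g) (X ⇡ g)) (X ⇡ g) := by
    simpa using hr
  refine ⟨Γ, ?_, ?_⟩
  · simpa using h.isMorphism hWg hr'
  · rw [forces_all_imp]
    intro u' g' α hα
    have := (h.res g').eq_of_isMorphism (α := α) (hWg.res g') (by simpa using hr'.res g')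
      (by simpa using hα)
    simpa using this

end CST

theorem mainTheorem3 : CST.Prv CST.CZF [] (CST.Fml.imp CST.NID CST.WTypesExist) := by
  refine CST.prv_of_forces CST.ren_mem_czf fun K hK w e v f h => ?_
  have : CST.CZFModel K := ⟨hK⟩
  exact CST.forces_wTypesExist ⟨_, h⟩ _
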